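/- Let $d\in\{1,2,3\}$, let $m$ be an integer with $m>d/2$, and let $T>0$, $M\ge 0$. For $s\in\mathbb R$ let $H^s=H^s(\mathbb R^d)$ be the $L^2$-based Sobolev space (for $s<0$ a space of tempered distributions). All time derivatives below are derivatives of $L^2(\mathbb R^d)$-valued functions on $[0,T]$ (one-sided at the end points), and all equations hold at every $t\in[0,T]$ in the sense of tempered distributions on $\mathbb R^d$. There is a constant $C$, depending only on $d$, $m$, $T$ and $M$, such that the following holds for all $0<\varepsilon<\gamma\le 1$. Let $\psi,\varphi\in C^2([0,T];L^2(\mathbb R^d))$ be a real-valued solution of the Klein–Gordon–Zakharov system $$\varepsilon^2\partial_{tt}\psi-\Delta\psi+\frac1{\varepsilon^2}\psi+\psi\varphi=0,\qquad \gamma^2\partial_{tt}\varphi-\Delta\varphi-\Delta(\psi^2)=0$$ with $\psi(0)=\psi_0$, $\partial_t\psi(0)=\psi_1/\varepsilon^2$, $\varphi(0)=\varphi_0$, $\partial_t\varphi(0)=\varphi_1/\gamma$, where $\psi_0,\psi_1,\varphi_0,\varphi_1\in L^2(\mathbb R^d)$, and assume $$\|\psi_0\|_{H^{m+6}}+\|\psi_1\|_{H^{m+6}}+\|\varphi\|_{L^\infty([0,T];H^{m+6})}+\gamma\|\partial_t\varphi\|_{L^\infty([0,T];H^{m+2})}+\gamma^2\|\partial_{tt}\varphi\|_{L^\infty([0,T];H^{m})}\le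 M.\tag{A}$$ Let $z\in C^1([0,T];L^2(\mathbb R^d;\mathbb C))$ solve $$2i\,\partial_t z-\Delta z+\varphi z=0,\qquad z(0)=z_0:=\tfrac12(\psi_0-i\psi_1),$$ and let $I\in C^2([0,T];L^2(\mathbb R^d))$ solve the free wave equation $$\gamma^2\partial_{tt}I-\Delta I=0,\qquad I(0)=\varphi_0+2|z_0|^2,\qquad \partial_tI(0)=\frac{\varphi_1}{\gamma}+2\,\mathrm{Im}(\overline{z_0}\,\Delta z_0).$$ Define the remainders $r$ and $q$ on $[0,T]$ by $$\psi=e^{it/\varepsilon^2}z+e^{-it/\varepsilon^2}\overline z+r,\qquad \varphi=-2|z|^2+I+q .$$ Then $z\in C^3([0,T];L^2)$, the functions $r$ and $q$ are differentiable from $[0,T]$ to $L^2$, and $$\|z(t)\|_{H^{m+6}}+\|\partial_tz(t)\|_{H^{m+4}}+\gamma\|\partial_{tt}z(t)\|_{H^{m+2}}+\gamma^2\|\partial_t^3z(t)\|_{H^m}\le C,\qquad t\in[0,T],$$ $$\|r\|_{L^\infty([0,T];H^m)}\le C\varepsilon^2,\qquad \|\partial_tr\|_{L^\infty([0,T];H^m)}\le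 C,$$ $$\|q\|_{L^\infty([0,T];H^{m-1})}\le C\gamma,\qquad \|\partial_tq\|_{L^\infty([0,T];H^{m-2})}\le C.$$ -/

import Mathlib

open MeasureTheory Set
open scoped ENNReal NNReal SchwartzMap Laplacian ComplexConjugate

noncomputable section

namespace KGZ

/-- The physical space `ℝ^d` with its Euclidean norm. -/
abbrev Space (d : ℕ) : Type := EuclideanSpace ℝ (Fin d)

/-- The Hilbert space `L²(ℝ^d; ℂ)`. -/
abbrev L2 (d : ℕ) : Type := Lp ℂ 2 (volume : Measure (Space d))

/-- The norm of `H^s(ℝ^d)`, for real `s` of either sign: the `L²` norm of the Bessel potential of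
order `s` of the tempered distribution `u`, and `∞` when `u` does not belong to `H^s`. -/
def sobolevNorm {d : ℕ} (s : ℝ) (u : 𝓢'(Space d, ℂ)) : ℝ≥0∞ :=
  ⨅ (f : L2 d) (_ : TemperedDistribution.besselPotential (Space d) ℂ s u = (f : 𝓢'(Space d, ℂ))),
    ‖f‖ₑ

/-- The norm is finite exactly on Mathlib's Sobolev space `H^{s,2}`. -/
theorem sobolevNorm_lt_top_iff {d : ℕ} (s : ℝ) (u : 𝓢'(Space d, ℂ)) :
    sobolevNorm s u < ∞ ↔ TemperedDistribution.MemSobolev s 2 u := by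
  simp only [sobolevNorm, iInf_lt_iff, TemperedDistribution.MemSobolev]
  exact ⟨fun ⟨f, hf, _⟩ => ⟨f, hf⟩, fun ⟨f, hf⟩ => ⟨f, hf, enorm_lt_top⟩⟩

/-- The `H^s` norm of an `L²` function, which may be infinite. -/
def hNorm {d : ℕ} (s : ℝ) (u : L2 d) : ℝ≥0∞ := sobolevNorm s (u : 𝓢'(Space d, ℂ))

/-- The norm of `L^∞([0,T]; H^s)`. It is taken as a supremum over all times; for functions that are
continuous in time with values in `L²` this is the essential supremum. -/
def supNorm {d : ℕ} (T s : ℝ) (u : ℝ → L2 d) : ℝ≥0∞ := ⨆ t ∈ Icc (0 : ℝ) T, hNorm s (u t)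

/-- The `k`-th time derivative on `[0,T]`, in `L²` (one-sided at the end points). -/
def dt {d : ℕ} (T : ℝ) (k : ℕ) (u : ℝ → L2 d) (t : ℝ) : L2 d :=
  iteratedDerivWithin k u (Icc 0 T) t

/-- `Δ u = f` in the sense of tempered distributions. It is used only for functions `u`, `f` that
are sums of `L²` functions and of products of two `L²` functions, so the integrals converge. -/
def LaplacianEq {d : ℕ} (u f : Space d → ℂ) : Prop :=
  ∀ χ : 𝓢(Space d, ℂ), ∫ x, (Δ χ) x * u x = ∫ x, χ x * f x

/-- `(ψ, φ)` is a real-valued solution on `[0,T]` of the Klein-Gordon-Zakharov system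
`ε² ∂ₜₜψ - Δψ + ε⁻² ψ + ψ φ = 0`, `γ² ∂ₜₜφ - Δφ - Δ(ψ²) = 0` with the data
`ψ(0) = ψ₀`, `∂ₜψ(0) = ψ₁ / ε²`, `φ(0) = φ₀`, `∂ₜφ(0) = φ₁ / γ`. -/
structure IsSolution {d : ℕ} (T ε γ : ℝ) (ψ₀ ψ₁ φ₀ φ₁ : L2 d) (ψ φ : ℝ → L2 d) : Prop where
  contDiffOn_psi : ContDiffOn ℝ 2 ψ (Icc 0 T)
  contDiffOn_phi : ContDiffOn ℝ 2 φ (Icc 0 T)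
  real_psi : ∀ t ∈ Icc (0 : ℝ) T, ∀ᵐ x, (ψ t x).im = 0
  real_phi : ∀ t ∈ Icc (0 : ℝ) T, ∀ᵐ x, (φ t x).im = 0
  eq_psi : ∀ t ∈ Icc (0 : ℝ) T,
    LaplacianEq (ψ t) fun x => ε ^ 2 * dt T 2 ψ t x + 1 / ε ^ 2 * ψ t x + ψ t x * φ t x
  eq_phi : ∀ t ∈ Icc (0 : ℝ) T,
    LaplacianEq (fun x => φ t x + ψ t x ^ 2) fun x => γ ^ 2 * dt T 2 φ t x
  init_psi : ψ 0 = ψ₀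
  init_dt_psi : dt T 1 ψ 0 = (1 / ε ^ 2) • ψ₁
  init_phi : φ 0 = φ₀
  init_dt_phi : dt T 1 φ 0 = (1 / γ) • φ₁

/-- The left-hand side of the uniform bound that is assumed on the data and the solution. -/
def assumedNorm {d : ℕ} (m : ℕ) (T γ : ℝ) (ψ₀ ψ₁ : L2 d) (φ : ℝ → L2 d) : ℝ≥0∞ :=
  hNorm (m + 6) ψ₀ + hNorm (m + 6) ψ₁ + supNorm T (m + 6) φ
    + ENNReal.ofReal γ * supNorm T (m + 2) (dt T 1 φ)
    + ENNReal.ofReal (γ ^ 2) * supNorm T m (dt T 2 φ)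

/-- `z` solves the Schrödinger equation `2i ∂ₜz - Δz + φ z = 0` on `[0,T]` with the initial value
`z(0) = (ψ₀ - i ψ₁) / 2`. -/
structure IsProfile {d : ℕ} (T : ℝ) (ψ₀ ψ₁ : L2 d) (φ z : ℝ → L2 d) : Prop where
  contDiffOn : ContDiffOn ℝ 1 z (Icc 0 T)
  eq : ∀ t ∈ Icc (0 : ℝ) T,
    LaplacianEq (z t) fun x => 2 * Complex.I * dt T 1 z t x + φ t x * z t x
  init : z 0 = (1 / 2 : ℂ) • (ψ₀ - Complex.I • ψ₁)

/-- `w` is the initial layer (written `I` on paper): it solves the free wave equation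
`γ² ∂ₜₜw - Δw = 0` on `[0,T]` with `w(0) = φ₀ + 2 |z₀|²` and
`∂ₜw(0) = φ₁ / γ + 2 Im(conj z₀ Δz₀)`. -/
structure IsInitialLayer {d : ℕ} (T γ : ℝ) (φ₀ φ₁ z₀ : L2 d) (w : ℝ → L2 d) : Prop where
  contDiffOn : ContDiffOn ℝ 2 w (Icc 0 T)
  eq : ∀ t ∈ Icc (0 : ℝ) T, LaplacianEq (w t) fun x => γ ^ 2 * dt T 2 w t x
  init : ∀ᵐ x, w 0 x = φ₀ x + 2 * (‖z₀ x‖ ^ 2 : ℝ)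
  init_dt : ∃ g : L2 d, LaplacianEq z₀ g ∧
    ∀ᵐ x, dt T 1 w 0 x = 1 / γ * φ₁ x + 2 * ((conj (z₀ x) * g x).im : ℝ)

/-- `ψ = e^{it/ε²} z + e^{-it/ε²} conj z + r` on `[0,T]`. -/
def IsModulatedExpansion {d : ℕ} (T ε : ℝ) (ψ z r : ℝ → L2 d) : Prop :=
  ∀ t ∈ Icc (0 : ℝ) T, ∀ᵐ x,
    ψ t x = Complex.exp (Complex.I * (t / ε ^ 2)) * z t x
      + Complex.exp (-(Complex.I * (t / ε ^ 2))) * conj (z t x) + r t x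

/-- `φ = -2 |z|² + w + q` on `[0,T]`. -/
def IsDensityExpansion {d : ℕ} (T : ℝ) (φ z w q : ℝ → L2 d) : Prop :=
  ∀ t ∈ Icc (0 : ℝ) T, ∀ᵐ x, φ t x = -2 * (‖z t x‖ ^ 2 : ℝ) + w t x + q t x

end KGZ

end

/-!
The estimates are proved on the Fourier side. The Sobolev norms are weighted `L²` norms of the
Fourier transform (`hNorm_eq_wn`), the weak Laplacian is a multiplier (`LaplacianEq.fourier`), and a
product is a convolution, so that Young's inequality, together with the triangle inequality for the
weights, gives the product estimates (`wn_pm_le`). Every evolution equation is brought into the form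
`∂ₜY = i s(ξ) Y + G` with a real symbol `s`, which does not contribute to the energy, and Gronwall's
inequality finishes (`energy_pair`). The solutions are only assumed to take values in `L²`. The
energy estimates therefore use weights that are bounded for each cutoff parameter; the constants do
not depend on the parameter, and Fatou's lemma removes the cutoff (`wn_le_of_tendsto`).

*The profile.* The energy estimate for the Schrödinger equation bounds `z` in `H^{m+6}`, first in
`H²` and then in the full norm with a product estimate that is linear in the highest norm. The time
derivatives come from differentiating the equation; each one costs two space derivatives, and a
factor `γ⁻¹` as soon as a derivative falls on `φ` (`profile_bounds`).

*The remainder `r`.* Put `ω = ε⁻²`. Because `z` solves the Schrödinger equation, the carrier wave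
`e^{iωt} z` solves the Klein-Gordon equation up to the source `ε² e^{iωt} ∂ₜₜz`, so `r` solves it
with the source `-(e^{iωt} ∂ₜₜz + c.c.)` after division by `ε²` (`ModData.ft_rem2`). This source is
of order `γ⁻¹`, and a direct energy estimate would lose that factor. For each of the two signs of
the Klein-Gordon frequency `Ω = √(ω(|2πξ|² + ω))` one of the two terms is nearly resonant: it is the
time derivative of `e^{iωt} ∂ₜz` up to `|ω - Ω| ≤ |2πξ|²` times `∂ₜz`. The other term is not
resonant and is integrated in time, which gains `(ω + Ω)⁻¹ ≤ ε²`. The energy variable `modY`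
contains both corrections, and its source is bounded uniformly (`modY_deriv`,
`ModData.norm_source_le`). The energy controls `∂ₜr` and `Ω r`, and `Ω ≥ ε⁻²` gives the factor `ε²`
in the bound of `r` (`ModData.wn_rem_le`).

*The remainder `q`.* It has zero initial data and solves `γ² ∂ₜₜq - Δq = Δ(ψ² - 2|z|²) + 2γ²
∂ₜₜ|z|²`. By the bound of `r`, `ψ² - 2|z|²` consists of the second harmonics `e^{2iωt} z² + c.c.`
and of a term of size `ε² ≤ γ²`. The energy estimate for `q` in `H^{m-1}` has the weight `|ξ|⁻¹` on
the source, which has to be compensated at low frequencies. For the terms with a Laplacian this is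
clear. By the Schrödinger equation, `∂ₜₜ|z|²` is a sum of expressions `f Δg - g Δf`, that is, a
divergence, although `∂ₜₜz` alone is not bounded uniformly in `γ` (`ModData.rho2_eq`,
`wn_commutator_le`). The second harmonics are not small, but they oscillate with the frequency `2ω`
and are removed by a normal form that gains `κ = (4ω²γ²)⁻¹ = ε⁴/(4γ²) ≤ γ²/4` (`waveY_deriv`,
`wave_bounds`). All sources are then of size `γ²`, which gives `q = O(γ)` and `∂ₜq = O(1)`
(`DensData.wn_q_le`).
-/

open FourierTransform Filter Topology

namespace KGZ

variable {d : ℕ}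

/-! ### The Fourier transform on `L²` and the weak Laplacian -/

/-- Multiplication by a bounded function as an operator on `L²`; it is `0` when the function is not
essentially bounded. -/
noncomputable def mulOp (a : Space d → ℂ) : L2 d →L[ℂ] L2 d :=
  open Classical in
  if h : MemLp a ∞ volume then (ContinuousLinearMap.mul ℂ ℂ).holderL volume ∞ 2 2 (h.toLp a) else 0

theorem coeFn_mulOp {a : Space d → ℂ} (h : MemLp a ∞ volume) (f : L2 d) :
    mulOp a f =ᵐ[volume] fun ξ => a ξ * f ξ := by
  rw [mulOp, dif_pos h]
  filter_upwards [(ContinuousLinearMap.mul ℂ ℂ).coeFn_holder (r := 2) (h.toLp a) f, h.coeFn_toLp]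
    with x h1 h2
  have h3 : ((ContinuousLinearMap.mul ℂ ℂ).holderL volume ∞ 2 2 (h.toLp a)) f
    = (ContinuousLinearMap.mul ℂ ℂ).holder 2 (h.toLp a) f := rfl
  rw [h3, h1, h2]
  rfl

/-- Schwartz functions separate locally integrable functions. -/
theorem ae_eq_of_forall_schwartz {u v : Space d → ℂ} (hu : LocallyIntegrable u)
    (hv : LocallyIntegrable v) (h : ∀ χ : 𝓢(Space d, ℂ), ∫ x, χ x * u x = ∫ x, χ x * v x) :
    u =ᵐ[volume] v := by
  apply ae_eq_of_integral_contDiff_smul_eq hu hv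
  intro g hg hgc
  have h1 : HasCompactSupport (Complex.ofRealCLM ∘ g) := hgc.comp_left rfl
  have h2 : ContDiff ℝ (⊤ : ℕ∞) (Complex.ofRealCLM ∘ g) := by fun_prop
  simpa using h (h1.toSchwartzMap h2)

theorem locallyIntegrable_L2 (f : L2 d) : LocallyIntegrable (f : Space d → ℂ) :=
  (Lp.memLp f).locallyIntegrable (by norm_num)

/-- The Fourier transform on `L²`. -/
noncomputable def ft : L2 d →L[ℂ] L2 d :=
  (Lp.fourierTransformₗᵢ (Space d) ℂ).toContinuousLinearEquiv.toContinuousLinearMap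

/-- The inverse Fourier transform on `L²`. -/
noncomputable def ftInv : L2 d →L[ℂ] L2 d :=
  (Lp.fourierTransformₗᵢ (Space d) ℂ).symm.toContinuousLinearEquiv.toContinuousLinearMap

theorem ft_eq (f : L2 d) : 𝓕 f = ft f := rfl

@[simp] theorem ft_ftInv (f : L2 d) : ft (ftInv f) = f :=
  (Lp.fourierTransformₗᵢ (Space d) ℂ).apply_symm_apply f

@[simp] theorem ftInv_ft (f : L2 d) : ftInv (ft f) = f :=
  (Lp.fourierTransformₗᵢ (Space d) ℂ).symm_apply_apply f

@[simp] theorem norm_ft (f : L2 d) : ‖ft f‖ = ‖f‖ := (Lp.fourierTransformₗᵢ (Space d) ℂ).norm_map f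

theorem ft_injective : Function.Injective (ft : L2 d → L2 d) :=
  Function.LeftInverse.injective ftInv_ft

theorem integral_fourier_mul (f : L2 d) (χ : 𝓢(Space d, ℂ)) :
    ∫ ξ, χ ξ * ft f ξ = ∫ x, 𝓕 χ x * f x := by
  have h := congrArg (fun T : 𝓢'(Space d, ℂ) => T χ) (Lp.fourier_toTemperedDistribution_eq f)
  simp only [TemperedDistribution.fourier_apply, Lp.toTemperedDistribution_apply,
    smul_eq_mul] at h
  exact h.symm

theorem ae_eq_fourier_of_forall {f : L2 d} {v : Space d → ℂ} (hv : LocallyIntegrable v)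
    (h : ∀ χ : 𝓢(Space d, ℂ), ∫ x, χ x * v x = ∫ x, 𝓕 χ x * f x) :
    ft f =ᵐ[volume] v :=
  ae_eq_of_forall_schwartz (locallyIntegrable_L2 _) hv fun χ => by rw [integral_fourier_mul, h]

theorem smulLeftCLM_fourier_eq_iff {g : Space d → ℂ} (hg : g.HasTemperateGrowth) (u v : L2 d) :
    TemperedDistribution.smulLeftCLM ℂ g (𝓕 (u : 𝓢'(Space d, ℂ))) = 𝓕 (v : 𝓢'(Space d, ℂ)) ↔
      (fun ξ => g ξ * ft u ξ) =ᵐ[volume] ft v := by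
  rw [Lp.fourier_toTemperedDistribution_eq, Lp.fourier_toTemperedDistribution_eq, ft_eq, ft_eq]
  have key : ∀ χ : 𝓢(Space d, ℂ), ∀ ξ, (SchwartzMap.smulLeftCLM ℂ g χ) ξ • ft u ξ
      = χ ξ * (g ξ * ft u ξ) := by
    intro χ ξ
    rw [SchwartzMap.smulLeftCLM_apply_apply hg]
    simp only [smul_eq_mul]; ring
  constructor
  · intro h
    apply ae_eq_of_forall_schwartz
    · exact (locallyIntegrable_L2 (ft u)).continuous_mul hg.1.continuous
    · exact locallyIntegrable_L2 _
    · intro χ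
      have h := congrArg (fun T : 𝓢'(Space d, ℂ) => T χ) h
      simpa only [TemperedDistribution.smulLeftCLM_apply_apply, Lp.toTemperedDistribution_apply,
        key, smul_eq_mul] using h
  · intro h
    ext χ
    simp only [TemperedDistribution.smulLeftCLM_apply_apply, Lp.toTemperedDistribution_apply,
      key, smul_eq_mul]
    apply integral_congr_ae
    filter_upwards [h] with ξ hξ
    rw [hξ]

/-- The squared modulus of the Fourier symbol of the gradient, so that `-Δ` is the multiplier
`lam`. -/
noncomputable def lam (ξ : Space d) : ℝ := (2 * Real.pi * ‖ξ‖) ^ 2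

/-- The symbol `⟨ξ⟩ˢ` of the Bessel potential. -/
noncomputable def jb (s : ℝ) (ξ : Space d) : ℝ := (1 + ‖ξ‖ ^ 2) ^ (s / 2)

/-- The `L²` norm of the Fourier transform of `f` with the weight `W`. -/
noncomputable def wn (W : Space d → ℝ) (f : L2 d) : ℝ≥0∞ :=
  eLpNorm (fun ξ => (W ξ : ℂ) * ft f ξ) 2 volume

theorem jb_pos (s : ℝ) (ξ : Space d) : 0 < jb s ξ := by unfold jb; positivity

theorem continuous_jb (s : ℝ) : Continuous (jb s : Space d → ℝ) := by
  have : (fun x : Space d ↦ ((1 + ‖x‖ ^ 2) ^ (s / 2) : ℝ)).HasTemperateGrowth := by fun_prop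
  exact this.1.continuous

theorem continuous_lam : Continuous (lam : Space d → ℝ) := by unfold lam; fun_prop

/-- The Sobolev norm, which is defined by the Bessel potential in the sense of distributions, is a
weighted norm of the Fourier transform. Both sides are `∞` outside `H^s`. -/
theorem hNorm_eq_wn (s : ℝ) (f : L2 d) : hNorm s f = wn (jb s) f := by
  have hg : (fun x : Space d ↦ (((1 + ‖x‖ ^ 2) ^ (s / 2) : ℝ) : ℂ)).HasTemperateGrowth := by
    fun_prop
  have key : ∀ g : L2 d, TemperedDistribution.besselPotential (Space d) ℂ s (f : 𝓢'(Space d, ℂ))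
      = (g : 𝓢'(Space d, ℂ)) ↔ (fun ξ => (jb s ξ : ℂ) * ft f ξ) =ᵐ[volume] ft g := by
    intro g
    refine Iff.trans ?_ (smulLeftCLM_fourier_eq_iff hg f g)
    rw [← TemperedDistribution.fourier_besselPotential_eq_smulLeftCLM_fourier_apply]
    refine ⟨fun h => by rw [h], fun h => ?_⟩
    have := congrArg (fun T : 𝓢'(Space d, ℂ) => 𝓕⁻ T) h
    simpa only [fourierInv_fourier_eq] using this
  have hn : ∀ g : L2 d, (fun ξ => (jb s ξ : ℂ) * ft f ξ) =ᵐ[volume] ft g → ‖g‖ₑ = wn (jb s) f := by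
    intro g hg
    rw [wn, eLpNorm_congr_ae hg, ← Lp.enorm_def, ← ofReal_norm, ← ofReal_norm,
      norm_ft]
  unfold KGZ.hNorm KGZ.sobolevNorm
  by_cases hm : MemLp (fun ξ => (jb s ξ : ℂ) * ft f ξ) 2 volume
  · have hg : (fun ξ => (jb s ξ : ℂ) * ft f ξ) =ᵐ[volume] ft (ftInv (hm.toLp _)) := by
      rw [ft_ftInv]; exact hm.coeFn_toLp.symm
    apply le_antisymm
    · exact iInf₂_le_of_le _ ((key _).2 hg) (hn _ hg).le
    · exact le_iInf₂ fun g h => (hn _ ((key g).1 h)).ge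
  · have : wn (jb s) f = ∞ := by
      by_contra h
      exact hm ⟨((Complex.continuous_ofReal.comp (continuous_jb s)).aestronglyMeasurable).mul
        (Lp.aestronglyMeasurable _), lt_top_iff_ne_top.2 h⟩
    rw [this, eq_top_iff]
    refine le_iInf₂ fun g h => absurd ?_ hm
    exact (memLp_congr_ae ((key g).1 h)).2 (Lp.memLp _)

theorem LaplacianEq.congr {u u' f f' : Space d → ℂ} (h : LaplacianEq u f)
    (hu : u =ᵐ[volume] u') (hf : f =ᵐ[volume] f') : LaplacianEq u' f' := by
  intro χ
  rw [← integral_congr_ae (g := fun x => Δ χ x * u' x)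
      (f := fun x => Δ χ x * u x) (by filter_upwards [hu] with x hx; rw [hx]), h χ]
  exact integral_congr_ae (by filter_upwards [hf] with x hx; rw [hx])

/-- On `L²` functions the weak Laplacian is the Fourier multiplier `-lam`. -/
theorem LaplacianEq.fourier {u f : L2 d} (h : LaplacianEq u f) :
    ft f =ᵐ[volume] fun ξ => -(lam ξ : ℂ) * ft u ξ := by
  have h1 : Δ (u : 𝓢'(Space d, ℂ)) = (f : 𝓢'(Space d, ℂ)) := by
    ext χ
    simpa [TemperedDistribution.laplacian_apply_apply] using h χ
  rw [TemperedDistribution.laplacian_eq_fourierMultiplierCLM] at h1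
  have hg0 : (fun x : Space d ↦ ((‖x‖ ^ 2 : ℝ) : ℂ)).HasTemperateGrowth := by
    fun_prop
  have hg : (fun x : Space d ↦ (-(lam x) : ℂ)).HasTemperateGrowth := by
    unfold lam
    simp only [mul_pow]
    have := hg0
    push_cast at this ⊢
    fun_prop
  refine ((smulLeftCLM_fourier_eq_iff hg u f).1 ?_).symm
  have e : (fun x : Space d ↦ (-(lam x) : ℂ)) =
      ((-(2 * Real.pi) ^ 2 : ℝ) : ℂ) • (fun x : Space d ↦ ((‖x‖ ^ 2 : ℝ) : ℂ)) := by
    ext x; simp [lam]; ring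
  have h2 : (f : 𝓢'(Space d, ℂ)) = ((-(2 * Real.pi) ^ 2 : ℝ) : ℂ) •
      (TemperedDistribution.fourierMultiplierCLM ℂ fun x ↦ ((‖x‖ ^ 2 : ℝ) : ℂ))
        (u : 𝓢'(Space d, ℂ)) := by
    rw [← h1]; ext; simp
  rw [h2, e, TemperedDistribution.smulLeftCLM_smul hg0,
    TemperedDistribution.fourierMultiplierCLM_apply, FourierTransform.fourier_smul,
    fourier_fourierInv_eq]
  rfl

/-- Complex conjugation on `L²`. -/
noncomputable def cj : L2 d →L[ℝ] L2 d :=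
  ContinuousLinearMap.compLpL 2 volume (Complex.conjCLE : ℂ →L[ℝ] ℂ)

theorem coeFn_cj (f : L2 d) : cj f =ᵐ[volume] fun x => conj (f x) :=
  ContinuousLinearMap.coeFn_compLpL _ f

/-- The character `x ↦ exp (2πi⟨x, ξ⟩)`. -/
noncomputable def chr (ξ x : Space d) : ℂ := (Real.fourierChar (inner ℝ x ξ) : ℂ)

theorem memLp_chr (ξ : Space d) : MemLp (chr ξ) ∞ volume := by
  refine memLp_top_of_bound ?_ 1 (ae_of_all _ fun x => ?_)
  · apply Continuous.aestronglyMeasurable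
    unfold chr; fun_prop
  · rw [chr, Circle.norm_coe]

theorem measurePreserving_const_sub (ξ : Space d) :
    MeasurePreserving (fun η : Space d => ξ - η) volume volume :=
  Measure.measurePreserving_sub_left volume ξ

theorem integral_fourier_mul_of_integrable {f : Space d → ℂ} (hf : Integrable f)
    (χ : 𝓢(Space d, ℂ)) : ∫ x, 𝓕 χ x * f x = ∫ ξ, χ ξ * 𝓕 f ξ := by
  simpa using! VectorFourier.integral_fourierIntegral_smul_eq_flip (L := innerₗ (Space d))
    Real.continuous_fourierChar continuous_inner χ.integrable hf

/-- On `L¹ ∩ L²` the Fourier transform is given by the integral. -/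
theorem ft_ae_eq_of_integrable {f : L2 d} (hf : Integrable (f : Space d → ℂ)) :
    ft f =ᵐ[volume] 𝓕 (f : Space d → ℂ) := by
  refine ae_eq_fourier_of_forall ?_ fun χ => (integral_fourier_mul_of_integrable hf χ).symm
  apply Continuous.locallyIntegrable
  exact VectorFourier.fourierIntegral_continuous Real.continuous_fourierChar continuous_inner hf

/-- An integrable function whose Fourier transform is square integrable is itself square
integrable. -/
theorem ae_eq_ftInv_of_integrable {f : Space d → ℂ} (hf : Integrable f) {g : L2 d}
    (h : 𝓕 f =ᵐ[volume] g) : f =ᵐ[volume] ftInv g := by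
  refine ae_eq_of_forall_schwartz hf.locallyIntegrable (locallyIntegrable_L2 _) fun χ => ?_
  have e : χ = 𝓕 (𝓕⁻ χ) := (fourier_fourierInv_eq χ).symm
  have h2 := integral_fourier_mul (ftInv g) (𝓕⁻ χ)
  rw [ft_ftInv] at h2
  rw [e, ← h2, integral_fourier_mul_of_integrable hf]
  exact integral_congr_ae (by filter_upwards [h] with x hx; rw [hx])

/-- Modulation and conjugation become reflection, translation and conjugation on the Fourier
side. -/
theorem ft_mulOp_chr_cj (ξ : Space d) (f : L2 d) :
    ft (mulOp (chr ξ) (cj f)) =ᵐ[volume] fun η => conj (ft f (ξ - η)) := by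
  have main : ft (mulOp (chr ξ) (cj f)) =
      cj (Lp.compMeasurePreservingₗᵢ ℂ _ (measurePreserving_const_sub ξ) (ft f)) := by
    refine DenseRange.induction_on (p := fun f : L2 d => ft (mulOp (chr ξ) (cj f)) =
      cj (Lp.compMeasurePreservingₗᵢ ℂ _ (measurePreserving_const_sub ξ) (ft f)))
      (SchwartzMap.denseRange_toLpCLM (F := ℂ) (p := 2) (μ := volume)
        ENNReal.ofNat_ne_top) f ?_ ?_
    · exact isClosed_eq (by fun_prop) (by fun_prop)
    · intro χ
      change ft (mulOp (chr ξ) (cj (χ.toLp 2 volume))) = cj (Lp.compMeasurePreservingₗᵢ ℂ _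
        (measurePreserving_const_sub ξ) (ft (χ.toLp 2 volume)))
      set u := mulOp (chr ξ) (cj (χ.toLp 2 volume)) with hu
      have h1 : u =ᵐ[volume] fun x => chr ξ x * conj (χ x) := by
        filter_upwards [coeFn_mulOp (memLp_chr ξ) (cj (χ.toLp 2 volume)),
          coeFn_cj (χ.toLp 2 volume), χ.coeFn_toLp 2 volume] with x e1 e2 e3
        rw [hu, e1, e2]
        exact congrArg (fun y => chr ξ x * conj y) e3
      have hi : Integrable (fun x => chr ξ x * conj (χ x)) := by
        refine (χ.integrable (μ := volume)).mono ?_ (ae_of_all _ fun x => ?_)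
        · exact ((memLp_chr ξ).1).mul
            (Complex.continuous_conj.comp χ.continuous).aestronglyMeasurable
        · rw [norm_mul, chr, Circle.norm_coe, one_mul, RCLike.norm_conj]
      refine Lp.ext ?_
      have h4 : (ft (χ.toLp 2 volume)) = (𝓕 χ).toLp 2 volume := by
        rw [← ft_eq]; exact SchwartzMap.toLp_fourier_eq χ
      have h5 := (measurePreserving_const_sub ξ).quasiMeasurePreserving.ae
        ((𝓕 χ).coeFn_toLp 2 volume)
      rw [h4]
      filter_upwards [ft_ae_eq_of_integrable (hi.congr h1.symm),
        coeFn_cj (Lp.compMeasurePreservingₗᵢ ℂ _ (measurePreserving_const_sub ξ)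
          ((𝓕 χ).toLp 2 volume)),
        Lp.coeFn_compMeasurePreserving ((𝓕 χ).toLp 2 volume) (measurePreserving_const_sub ξ), h5]
        with η e1 e2 e3 e5
      rw [e1, e2, Real.fourier_congr_ae h1 η]
      refine Eq.trans ?_ (congrArg conj (e3.trans e5)).symm
      rw [SchwartzMap.fourier_coe, Real.fourier_eq, Real.fourier_eq, ← integral_conj]
      congr 1 with x
      simp only [Circle.smul_def, chr, smul_eq_mul, map_mul, ← Circle.coe_inv_eq_conj,
        ← AddChar.map_neg_eq_inv, ← mul_assoc, ← Circle.coe_mul, ← AddChar.map_add_eq_mul]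
      congr 4
      rw [inner_sub_right]; ring
  rw [main]
  filter_upwards [coeFn_cj (Lp.compMeasurePreservingₗᵢ ℂ _ (measurePreserving_const_sub ξ) (ft f)),
    Lp.coeFn_compMeasurePreserving (ft f) (measurePreserving_const_sub ξ)] with η h1 h2
  rw [h1]
  exact congrArg conj h2

theorem ft_cj (f : L2 d) : ft (cj f) =ᵐ[volume] fun ξ => conj (ft f (-ξ)) := by
  have h : mulOp (chr 0) (cj f) = cj f := by
    refine Lp.ext ?_
    filter_upwards [coeFn_mulOp (memLp_chr 0) (cj f)] with x hx
    rw [hx]; simp [chr]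
  have := ft_mulOp_chr_cj 0 f
  simpa [h] using this

/-! ### Products and convolutions -/

theorem measurable_ft (f : L2 d) : Measurable (ft f : Space d → ℂ) :=
  (Lp.stronglyMeasurable _).measurable

theorem eLpNorm_two_sq {ε : Type*} [ENorm ε] (u : Space d → ε) :
    eLpNorm u 2 volume ^ 2 = ∫⁻ ξ, ‖u ξ‖ₑ ^ 2 := by
  rw [eLpNorm_eq_lintegral_rpow_enorm_toReal (by norm_num) (by norm_num)]
  simp only [ENNReal.toReal_ofNat, ENNReal.rpow_ofNat, one_div]
  rw [← ENNReal.rpow_natCast, ← ENNReal.rpow_mul]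
  simp

/-- The Cauchy-Schwarz inequality. -/
theorem lintegral_mul_sq_le {a b : Space d → ℝ≥0∞} (ha : Measurable a) (hb : Measurable b) :
    (∫⁻ ξ, a ξ * b ξ) ^ 2 ≤ (∫⁻ ξ, a ξ) * ∫⁻ ξ, a ξ * b ξ ^ 2 := by
  have h := ENNReal.lintegral_mul_le_Lp_mul_Lq volume Real.HolderConjugate.two_two
    (f := fun ξ => a ξ ^ (1 / 2 : ℝ)) (g := fun ξ => a ξ ^ (1 / 2 : ℝ) * b ξ)
    (by fun_prop) (by fun_prop)
  have hs : ∀ x : ℝ≥0∞, x ^ (1 / 2 : ℝ) * x ^ (1 / 2 : ℝ) = x := fun x => by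
    rw [← ENNReal.rpow_add_of_nonneg _ _ (by norm_num) (by norm_num)]; norm_num
  have hq : ∀ x : ℝ≥0∞, (x ^ (1 / 2 : ℝ)) ^ 2 = x := fun x => by rw [sq, hs]
  simp only [Pi.mul_apply, ENNReal.rpow_ofNat, ← mul_assoc, hs, mul_pow, hq] at h
  calc _ ≤ _ := pow_le_pow_left' h 2
    _ = _ := by rw [mul_pow, hq, hq]

/-- The convolution of two nonnegative functions. -/
noncomputable def convE (α β : Space d → ℝ≥0∞) (ξ : Space d) : ℝ≥0∞ := ∫⁻ η, α (ξ - η) * β η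

theorem convE_comm {α β : Space d → ℝ≥0∞} : convE α β = convE β α := by
  ext ξ
  rw [convE, convE, ← lintegral_sub_left_eq_self _ ξ]
  simp [mul_comm]

theorem measurable_convE {α β : Space d → ℝ≥0∞} (hα : Measurable α) (hβ : Measurable β) :
    Measurable (convE α β) := by
  unfold convE
  apply Measurable.lintegral_prod_right'
    (f := fun p : Space d × Space d => α (p.1 - p.2) * β p.2)
  fun_prop

/-- Young's inequality `L¹ * L² ⊆ L²`. -/
theorem eLpNorm_convE_le {α β : Space d → ℝ≥0∞} (hα : Measurable α) (hβ : Measurable β) :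
    eLpNorm (convE α β) 2 volume ≤ (∫⁻ ξ, α ξ) * eLpNorm β 2 volume := by
  have key : eLpNorm (convE α β) 2 volume ^ 2 ≤ ((∫⁻ ξ, α ξ) * eLpNorm β 2 volume) ^ 2 := by
    rw [mul_pow, eLpNorm_two_sq, eLpNorm_two_sq]
    simp only [enorm_eq_self]
    calc ∫⁻ ξ, convE α β ξ ^ 2
        ≤ ∫⁻ ξ, (∫⁻ η, α η) * ∫⁻ η, α (ξ - η) * β η ^ 2 := by
          refine lintegral_mono fun ξ => ?_
          rw [← lintegral_sub_left_eq_self _ ξ]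
          exact lintegral_mul_sq_le (by fun_prop) hβ
      _ = (∫⁻ η, α η) * ∫⁻ ξ, ∫⁻ η, α (ξ - η) * β η ^ 2 := by
          rw [lintegral_const_mul]
          apply Measurable.lintegral_prod_right'
            (f := fun p : Space d × Space d => α (p.1 - p.2) * β p.2 ^ 2)
          fun_prop
      _ = (∫⁻ η, α η) * ∫⁻ η, ∫⁻ ξ, α (ξ - η) * β η ^ 2 := by
          rw [lintegral_lintegral_swap]
          apply Measurable.aemeasurable
          fun_prop
      _ = (∫⁻ η, α η) ^ 2 * ∫⁻ η, β η ^ 2 := by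
          rw [sq, mul_assoc]
          congr 1
          rw [← lintegral_const_mul _ (by fun_prop)]
          congr 1 with η
          rw [lintegral_mul_const _ (by fun_prop), lintegral_sub_right_eq_self]
  exact (ENNReal.pow_le_pow_left_iff two_ne_zero).1 key

theorem eLpNorm_convE_le' {α β : Space d → ℝ≥0∞} (hα : Measurable α) (hβ : Measurable β) :
    eLpNorm (convE α β) 2 volume ≤ eLpNorm α 2 volume * ∫⁻ ξ, β ξ := by
  rw [convE_comm, mul_comm]; exact eLpNorm_convE_le hβ hα

/-- The `L¹` norm of the Fourier transform of `f` with the weight `b`. -/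
noncomputable def w1 (b : Space d → ℝ) (f : L2 d) : ℝ≥0∞ :=
  ∫⁻ ξ, ENNReal.ofReal (b ξ) * ‖ft f ξ‖ₑ

theorem wn_eq {W : Space d → ℝ} (hW : ∀ ξ, 0 ≤ W ξ) (f : L2 d) :
    wn W f = eLpNorm (fun ξ => ENNReal.ofReal (W ξ) * ‖ft f ξ‖ₑ) 2 volume := by
  rw [wn]
  refine eLpNorm_congr_enorm_ae (ae_of_all _ fun ξ => ?_)
  rw [enorm_mul, enorm_eq_self, ← ofReal_norm (W ξ : ℂ), Complex.norm_real,
    Real.norm_of_nonneg (hW ξ)]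

theorem integrable_conv (f g : L2 d) (ξ : Space d) :
    Integrable fun η => f (ξ - η) * g η :=
  MemLp.integrable_mul (p := 2) (q := 2)
    ((Lp.memLp f).comp_measurePreserving (measurePreserving_const_sub ξ)) (Lp.memLp g)

/-- The Fourier transform of a product is the convolution of the Fourier transforms. -/
theorem fourier_mul_eq (f g : L2 d) (ξ : Space d) :
    𝓕 (fun x => f x * g x) ξ = ∫ η, ft f (ξ - η) * ft g η := by
  have h1 : inner ℂ (ft (mulOp (chr ξ) (cj f))) (ft g) = inner ℂ (mulOp (chr ξ) (cj f)) g :=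
    Lp.inner_fourier_eq _ _
  rw [L2.inner_def, L2.inner_def] at h1
  rw [Real.fourier_eq]
  calc _ = ∫ x, inner ℂ ((mulOp (chr ξ) (cj f)) x) (g x) := by
        apply integral_congr_ae
        filter_upwards [coeFn_mulOp (memLp_chr ξ) (cj f), coeFn_cj f] with x e1 e2
        rw [e1, e2]
        simp only [RCLike.inner_apply, map_mul, chr, Circle.smul_def, smul_eq_mul,
          ← Circle.coe_inv_eq_conj, ← AddChar.map_neg_eq_inv, RingHomCompTriple.comp_apply,
          RingHom.id_apply]
        ring
    _ = _ := by
        rw [← h1]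
        apply integral_congr_ae
        filter_upwards [ft_mulOp_chr_cj ξ f] with η e
        rw [e]
        simp [RCLike.inner_apply, mul_comm]

theorem enorm_fourier_mul_le (f g : L2 d) (ξ : Space d) :
    ‖𝓕 (fun x => f x * g x) ξ‖ₑ ≤ convE (fun ξ => ‖ft f ξ‖ₑ) (fun ξ => ‖ft g ξ‖ₑ) ξ := by
  rw [fourier_mul_eq]
  refine (enorm_integral_le_lintegral_enorm _).trans_eq ?_
  simp [convE, enorm_mul]

/-- If the convolution of the Fourier transforms is square integrable, then so is the product. -/
theorem mul_memLp_of_conv {f g : L2 d}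
    (h : eLpNorm (convE (fun ξ => ‖ft f ξ‖ₑ) (fun ξ => ‖ft g ξ‖ₑ)) 2 volume < ∞) :
    MemLp (fun x => f x * g x) 2 volume ∧ ∀ u : L2 d, (u =ᵐ[volume] fun x => f x * g x) →
      ft u =ᵐ[volume] fun ξ => ∫ η, ft f (ξ - η) * ft g η := by
  have hi : Integrable fun x => f x * g x :=
    MemLp.integrable_mul (p := 2) (q := 2) (Lp.memLp f) (Lp.memLp g)
  have hG : MemLp (𝓕 (fun x => f x * g x)) 2 volume := by
    refine ⟨(VectorFourier.fourierIntegral_continuous Real.continuous_fourierChar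
      continuous_inner hi).aestronglyMeasurable, lt_of_le_of_lt ?_ h⟩
    exact eLpNorm_mono_enorm fun ξ => by
      rw [enorm_eq_self]; exact enorm_fourier_mul_le f g ξ
  have h2 := ae_eq_ftInv_of_integrable hi hG.coeFn_toLp.symm
  refine ⟨(memLp_congr_ae h2).2 (Lp.memLp _), fun u hu => ?_⟩
  have h3 : u = ftInv (hG.toLp _) := Lp.ext (hu.trans h2)
  rw [h3, ft_ftInv]
  filter_upwards [hG.coeFn_toLp] with ξ hξ
  rw [hξ, fourier_mul_eq]

/-- The product of two `L²` functions when it is in `L²`, and `0` otherwise. -/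
noncomputable def pm (f g : L2 d) : L2 d :=
  open Classical in
  if h : MemLp (fun x => f x * g x) 2 volume then h.toLp _ else 0

theorem conv_lt_top {f g : L2 d} (h : w1 1 f < ∞) :
    eLpNorm (convE (fun ξ => ‖ft f ξ‖ₑ) (fun ξ => ‖ft g ξ‖ₑ)) 2 volume < ∞ := by
  refine (eLpNorm_convE_le (measurable_ft f).enorm (measurable_ft g).enorm).trans_lt ?_
  refine ENNReal.mul_lt_top ?_ ?_
  · simpa [w1] using h
  · rw [eLpNorm_enorm]; exact (Lp.memLp _).2

theorem coeFn_pm {f g : L2 d} (h : w1 1 f < ∞) :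
    pm f g =ᵐ[volume] fun x => f x * g x := by
  have hm := (mul_memLp_of_conv (conv_lt_top (g := g) h)).1
  rw [pm, dif_pos hm]
  exact hm.coeFn_toLp

theorem pm_comm (f g : L2 d) : pm f g = pm g f := by
  have h : (fun x => f x * g x) = fun x => g x * f x := by ext x; ring
  unfold pm
  congr!

theorem ft_pm {f g : L2 d} (h : w1 1 f < ∞) :
    ft (pm f g) =ᵐ[volume] fun ξ => ∫ η, ft f (ξ - η) * ft g η :=
  (mul_memLp_of_conv (conv_lt_top h)).2 _ (coeFn_pm h)

theorem enorm_ft_pm_le {f g : L2 d} (h : w1 1 f < ∞) :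
    ∀ᵐ ξ, ‖ft (pm f g) ξ‖ₑ ≤ convE (fun ξ => ‖ft f ξ‖ₑ) (fun ξ => ‖ft g ξ‖ₑ) ξ := by
  filter_upwards [ft_pm (g := g) h] with ξ hξ
  rw [hξ, ← fourier_mul_eq]
  exact enorm_fourier_mul_le f g ξ

/-- Weighted bound of a product: the weight may be moved to either factor. -/
theorem wn_pm_le {W a b : Space d → ℝ} (hWm : Measurable W) (ham : Measurable a)
    (hbm : Measurable b) (hW0 : ∀ ξ, 0 ≤ W ξ) (ha0 : ∀ ξ, 0 ≤ a ξ) (hb0 : ∀ ξ, 0 ≤ b ξ)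
    (hW : ∀ ξ η, W ξ ≤ a (ξ - η) + b (ξ - η) * W η) {f g : L2 d} (hf : w1 1 f < ∞) :
    wn W (pm f g) ≤ wn a f * w1 1 g + w1 b f * wn W g := by
  have hfm := (measurable_ft f).enorm
  have hgm := (measurable_ft g).enorm
  rw [wn_eq hW0, wn_eq ha0, wn_eq hW0]
  set A : Space d → ℝ≥0∞ := fun ξ => ENNReal.ofReal (a ξ) * ‖ft f ξ‖ₑ with hA
  set B : Space d → ℝ≥0∞ := fun ξ => ENNReal.ofReal (b ξ) * ‖ft f ξ‖ₑ with hB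
  set V : Space d → ℝ≥0∞ := fun ξ => ENNReal.ofReal (W ξ) * ‖ft g ξ‖ₑ with hV
  have hAm : Measurable A := by fun_prop
  have hBm : Measurable B := by fun_prop
  have hVm : Measurable V := by fun_prop
  calc eLpNorm (fun ξ => ENNReal.ofReal (W ξ) * ‖ft (pm f g) ξ‖ₑ) 2 volume
      ≤ eLpNorm (convE A (fun ξ => ‖ft g ξ‖ₑ) + convE B V) 2 volume := by
        refine eLpNorm_mono_enorm_ae ?_
        filter_upwards [enorm_ft_pm_le (g := g) hf] with ξ hξ
        rw [enorm_eq_self, enorm_eq_self]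
        calc _ ≤ ENNReal.ofReal (W ξ) * convE (fun ξ => ‖ft f ξ‖ₑ) (fun ξ => ‖ft g ξ‖ₑ) ξ := by
              gcongr
          _ = ∫⁻ η, ENNReal.ofReal (W ξ) * (‖ft f (ξ - η)‖ₑ * ‖ft g η‖ₑ) := by
              rw [convE, lintegral_const_mul _ (by fun_prop)]
          _ ≤ ∫⁻ η, (A (ξ - η) * ‖ft g η‖ₑ + B (ξ - η) * V η) := by
              refine lintegral_mono fun η => ?_
              calc _ ≤ ENNReal.ofReal (a (ξ - η) + b (ξ - η) * W η)
                    * (‖ft f (ξ - η)‖ₑ * ‖ft g η‖ₑ) := by gcongr; exact hW ξ η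
                _ = _ := by
                  rw [ENNReal.ofReal_add (ha0 _) (mul_nonneg (hb0 _) (hW0 _)),
                    ENNReal.ofReal_mul (hb0 _)]
                  simp only [hA, hB, hV]; ring
          _ = _ := by
              rw [lintegral_add_left (by fun_prop)]; rfl
    _ ≤ eLpNorm (convE A (fun ξ => ‖ft g ξ‖ₑ)) 2 volume + eLpNorm (convE B V) 2 volume :=
        eLpNorm_add_le (measurable_convE hAm hgm).aestronglyMeasurable
          (measurable_convE hBm hVm).aestronglyMeasurable (by norm_num)
    _ ≤ _ := by
        gcongr
        · refine (eLpNorm_convE_le' hAm hgm).trans_eq ?_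
          simp [w1]
        · exact eLpNorm_convE_le hBm hVm

/-- The modulus of the Fourier symbol of the gradient. -/
noncomputable def kap (ξ : Space d) : ℝ := 2 * Real.pi * ‖ξ‖

theorem lam_eq (ξ : Space d) : lam ξ = kap ξ ^ 2 := rfl

theorem kap_nonneg (ξ : Space d) : 0 ≤ kap ξ := by unfold kap; positivity

theorem continuous_kap : Continuous (kap : Space d → ℝ) := by unfold kap; fun_prop

theorem abs_lam_sub_le (ξ η : Space d) :
    |lam (ξ - η) - lam η| ≤ kap ξ * (kap (ξ - η) + kap η) := by
  have h1 : |kap (ξ - η) - kap η| ≤ kap ξ := by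
    have e1 : ‖ξ - η‖ ≤ ‖ξ‖ + ‖η‖ := norm_sub_le _ _
    have e2 : ‖η‖ ≤ ‖ξ‖ + ‖ξ - η‖ := by
      have := norm_sub_le ξ (ξ - η); rwa [sub_sub_cancel] at this
    have hp : 0 < 2 * Real.pi := by positivity
    unfold kap
    rw [abs_le]
    constructor <;> nlinarith
  rw [lam_eq, lam_eq, sq_sub_sq, abs_mul, mul_comm,
    abs_of_nonneg (add_nonneg (kap_nonneg _) (kap_nonneg _))]
  exact mul_le_mul_of_nonneg_right h1 (add_nonneg (kap_nonneg _) (kap_nonneg _))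

/-- The Fourier transform of `f Δg - g Δf` is small at low frequencies, since this expression is a
divergence; `F` and `G` stand for `Δf` and `Δg`. -/
theorem wn_div_kap_le {W b : Space d → ℝ} (hWm : Measurable W)
    (hbm : Measurable b) (hW0 : ∀ ξ, 0 ≤ W ξ) (hb0 : ∀ ξ, 0 ≤ b ξ)
    (hW : ∀ ξ η, W ξ ≤ b (ξ - η) * W η) {f g F G : L2 d} (hf : w1 1 f < ∞) (hg : w1 1 g < ∞)
    (hF : ft F =ᵐ[volume] fun ξ => -(lam ξ : ℂ) * ft f ξ)
    (hG : ft G =ᵐ[volume] fun ξ => -(lam ξ : ℂ) * ft g ξ) :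
    wn (fun ξ => W ξ / kap ξ) (pm f G - pm g F)
      ≤ w1 (fun ξ => b ξ * kap ξ) f * wn W g + w1 b f * wn (fun ξ => W ξ * kap ξ) g := by
  have hfm := (measurable_ft f).enorm
  have hgm := (measurable_ft g).enorm
  have hkm : Measurable (kap : Space d → ℝ) := continuous_kap.measurable
  have hk := kap_nonneg (d := d)
  rw [wn_eq fun ξ => div_nonneg (hW0 ξ) (hk ξ), wn_eq hW0,
    wn_eq fun ξ => mul_nonneg (hW0 ξ) (hk ξ)]
  set A : Space d → ℝ≥0∞ := fun ξ => ENNReal.ofReal (b ξ * kap ξ) * ‖ft f ξ‖ₑ with hA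
  set B : Space d → ℝ≥0∞ := fun ξ => ENNReal.ofReal (b ξ) * ‖ft f ξ‖ₑ with hB
  set U : Space d → ℝ≥0∞ := fun ξ => ENNReal.ofReal (W ξ) * ‖ft g ξ‖ₑ with hU
  set V : Space d → ℝ≥0∞ := fun ξ => ENNReal.ofReal (W ξ * kap ξ) * ‖ft g ξ‖ₑ with hV
  have hAm : Measurable A := by fun_prop
  have hBm : Measurable B := by fun_prop
  have hUm : Measurable U := by fun_prop
  have hVm : Measurable V := by fun_prop
  have e1 : ∀ᵐ ξ, ft (pm f G - pm g F) ξ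
      = ∫ η, ((lam (ξ - η) - lam η : ℝ) : ℂ) * (ft f (ξ - η) * ft g η) := by
    rw [map_sub, pm_comm g F]
    have hFg : ft (pm F g) =ᵐ[volume] fun ξ => ∫ η, ft F (ξ - η) * ft g η := by
      refine (mul_memLp_of_conv ?_).2 _ ?_
      · rw [convE_comm]; exact conv_lt_top hg
      · rw [pm_comm]
        filter_upwards [coeFn_pm (g := F) hg] with x hx
        rw [hx, mul_comm]
    filter_upwards [Lp.coeFn_sub (ft (pm f G)) (ft (pm F g)), ft_pm (g := G) hf, hFg]
      with ξ h1 h2 h3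
    rw [h1, Pi.sub_apply, h2, h3, ← integral_sub (integrable_conv _ _ _) (integrable_conv _ _ _)]
    apply integral_congr_ae
    filter_upwards [hG, (measurePreserving_const_sub ξ).quasiMeasurePreserving.ae hF] with η h4 h5
    rw [h4, h5]; push_cast; ring
  calc eLpNorm (fun ξ => ENNReal.ofReal (W ξ / kap ξ) * ‖ft (pm f G - pm g F) ξ‖ₑ) 2 volume
      ≤ eLpNorm (convE A U + convE B V) 2 volume := by
        refine eLpNorm_mono_enorm_ae ?_
        filter_upwards [e1] with ξ hξ
        rw [enorm_eq_self, enorm_eq_self, hξ]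
        calc _ ≤ ENNReal.ofReal (W ξ / kap ξ) *
              ∫⁻ η, ENNReal.ofReal (kap ξ * (kap (ξ - η) + kap η))
                * (‖ft f (ξ - η)‖ₑ * ‖ft g η‖ₑ) := by
              gcongr
              refine (enorm_integral_le_lintegral_enorm _).trans (lintegral_mono fun η => ?_)
              simp only [enorm_mul]
              gcongr
              rw [← ofReal_norm, Complex.norm_real]
              exact ENNReal.ofReal_le_ofReal (abs_lam_sub_le ξ η)
          _ = ∫⁻ η, ENNReal.ofReal (W ξ / kap ξ) * (ENNReal.ofReal (kap ξ * (kap (ξ - η) + kap η))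
                * (‖ft f (ξ - η)‖ₑ * ‖ft g η‖ₑ)) := by
              rw [lintegral_const_mul _ (by fun_prop)]
          _ ≤ ∫⁻ η, (A (ξ - η) * U η + B (ξ - η) * V η) := by
              refine lintegral_mono fun η => ?_
              rw [← mul_assoc, ← ENNReal.ofReal_mul (div_nonneg (hW0 ξ) (hk ξ))]
              calc _ ≤ ENNReal.ofReal (b (ξ - η) * kap (ξ - η) * W η + b (ξ - η) * (W η * kap η))
                    * (‖ft f (ξ - η)‖ₑ * ‖ft g η‖ₑ) := by
                    gcongr
                    calc W ξ / kap ξ * (kap ξ * (kap (ξ - η) + kap η))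
                        ≤ W ξ * (kap (ξ - η) + kap η) := by
                          rw [← mul_assoc]
                          refine mul_le_mul_of_nonneg_right ?_ (add_nonneg (hk _) (hk _))
                          -- At the origin the quotient `W ξ / kap ξ` is `0`.
                          rcases eq_or_ne (kap ξ) 0 with h0 | h0
                          · simp [h0, hW0]
                          · rw [div_mul_cancel₀ _ h0]
                      _ ≤ b (ξ - η) * W η * (kap (ξ - η) + kap η) :=
                          mul_le_mul_of_nonneg_right (hW ξ η) (add_nonneg (hk _) (hk _))
                      _ = _ := by ring
                _ = _ := by
                  rw [ENNReal.ofReal_add (mul_nonneg (mul_nonneg (hb0 _) (hk _)) (hW0 _))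
                    (mul_nonneg (hb0 _) (mul_nonneg (hW0 _) (hk _))),
                    ENNReal.ofReal_mul (mul_nonneg (hb0 _) (hk _)),
                    ENNReal.ofReal_mul (q := W η * kap η) (hb0 _)]
                  simp only [hA, hB, hU, hV]; ring
          _ = _ := by
              rw [lintegral_add_left (by fun_prop)]; rfl
    _ ≤ eLpNorm (convE A U) 2 volume + eLpNorm (convE B V) 2 volume :=
        eLpNorm_add_le (measurable_convE hAm hUm).aestronglyMeasurable
          (measurable_convE hBm hVm).aestronglyMeasurable (by norm_num)
    _ ≤ _ := by
        gcongr
        · exact eLpNorm_convE_le hAm hUm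
        · exact eLpNorm_convE_le hBm hVm

/-! ### Weights and weighted norms -/

theorem wn_le_of_ae {W V : Space d → ℝ} {f g : L2 d} {C : ℝ}
    (h : ∀ᵐ ξ, |W ξ| * ‖ft f ξ‖ ≤ C * (|V ξ| * ‖ft g ξ‖)) : wn W f ≤ ENNReal.ofReal C * wn V g := by
  rw [wn, wn]
  refine eLpNorm_le_mul_eLpNorm_of_ae_le_mul ?_ 2
  filter_upwards [h] with ξ hξ
  simpa using hξ

theorem wn_mono_of_ae {W V : Space d → ℝ} {f g : L2 d}
    (h : ∀ᵐ ξ, |W ξ| * ‖ft f ξ‖ ≤ |V ξ| * ‖ft g ξ‖) : wn W f ≤ wn V g := by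
  have := wn_le_of_ae (f := f) (g := g) (W := W) (V := V) (C := 1) (by simpa using h)
  simpa using this

theorem wn_mono {W V : Space d → ℝ} (h : ∀ ξ, |W ξ| ≤ |V ξ|) (f : L2 d) : wn W f ≤ wn V f :=
  wn_mono_of_ae (ae_of_all _ fun ξ => mul_le_mul_of_nonneg_right (h ξ) (norm_nonneg _))

theorem wn_le_const_mul {W V : Space d → ℝ} {C : ℝ} (h : ∀ ξ, |W ξ| ≤ C * |V ξ|) (f : L2 d) :
    wn W f ≤ ENNReal.ofReal C * wn V f :=
  wn_le_of_ae (ae_of_all _ fun ξ => by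
    rw [← mul_assoc]; exact mul_le_mul_of_nonneg_right (h ξ) (norm_nonneg _))

theorem aestronglyMeasurable_mul_ft {W : Space d → ℝ} (hW : Measurable W) (f : L2 d) :
    AEStronglyMeasurable (fun ξ => (W ξ : ℂ) * ft f ξ) volume :=
  ((Complex.measurable_ofReal.comp hW).mul (measurable_ft f)).aestronglyMeasurable

theorem wn_add_le {W : Space d → ℝ} (hW : Measurable W) (f g : L2 d) :
    wn W (f + g) ≤ wn W f + wn W g := by
  have : wn W (f + g) = eLpNorm ((fun ξ => (W ξ : ℂ) * ft f ξ) + fun ξ => (W ξ : ℂ) * ft g ξ) 2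
      volume := by
    refine eLpNorm_congr_ae ?_
    rw [map_add]
    filter_upwards [Lp.coeFn_add (ft f) (ft g)] with ξ hξ
    rw [hξ]; simp only [Pi.add_apply]; ring
  rw [this]
  exact eLpNorm_add_le (aestronglyMeasurable_mul_ft hW f) (aestronglyMeasurable_mul_ft hW g)
    (by norm_num)

theorem wn_smul (W : Space d → ℝ) (c : ℂ) (f : L2 d) : wn W (c • f) = ‖c‖ₑ * wn W f := by
  rw [wn, wn, ← eLpNorm_const_smul]
  refine eLpNorm_congr_ae ?_
  rw [map_smul]
  filter_upwards [Lp.coeFn_smul c (ft f)] with ξ hξ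
  rw [hξ]; simp only [Pi.smul_apply, smul_eq_mul]; ring

theorem wn_neg (W : Space d → ℝ) (f : L2 d) : wn W (-f) = wn W f := by
  have := wn_smul W (-1) f
  simpa using this

theorem wn_sub_le {W : Space d → ℝ} (hW : Measurable W) (f g : L2 d) :
    wn W (f - g) ≤ wn W f + wn W g := by
  rw [sub_eq_add_neg, ← wn_neg W g]; exact wn_add_le hW f (-g)

theorem wn_cj {W : Space d → ℝ} (hW : Measurable W) (he : ∀ ξ, W (-ξ) = W ξ) (f : L2 d) :
    wn W (cj f) = wn W f := by
  rw [wn, wn]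
  have h := eLpNorm_comp_measurePreserving (p := 2) (aestronglyMeasurable_mul_ft hW f)
    (Measure.measurePreserving_neg (volume : Measure (Space d)))
  rw [← h]
  refine eLpNorm_congr_norm_ae ?_
  filter_upwards [ft_cj f] with ξ hξ
  rw [hξ]
  simp [he]

theorem w1_cj {b : Space d → ℝ} (he : ∀ ξ, b (-ξ) = b ξ) (f : L2 d) : w1 b (cj f) = w1 b f := by
  rw [w1, w1, ← lintegral_neg_eq_self]
  refine lintegral_congr_ae ?_
  have h := (Measure.measurePreserving_neg (volume : Measure (Space d))).quasiMeasurePreserving.ae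
    (ft_cj f)
  filter_upwards [h] with ξ hξ
  rw [hξ]
  simp [he]

theorem memLp_top_of_le {a : Space d → ℂ} (hm : Measurable a) {C : ℝ} (h : ∀ ξ, ‖a ξ‖ ≤ C) :
    MemLp a ∞ volume :=
  memLp_top_of_bound hm.aestronglyMeasurable C (ae_of_all _ h)

theorem enorm_mulOp_ft {W : Space d → ℝ} (hW : MemLp (fun ξ => (W ξ : ℂ)) ∞ volume) (f : L2 d) :
    ‖mulOp (fun ξ => (W ξ : ℂ)) (ft f)‖ₑ = wn W f := by
  rw [Lp.enorm_def, wn]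
  exact eLpNorm_congr_ae (coeFn_mulOp hW _)

/-- Fatou's lemma for weighted norms. -/
theorem wn_le_of_tendsto {W : Space d → ℝ} {V : ℕ → Space d → ℝ} (hV : ∀ n, Measurable (V n))
    (h : ∀ᵐ ξ, ∀ᶠ n in atTop, |W ξ| ≤ |V n ξ|) {f : L2 d} {C : ℝ≥0∞}
    (hC : ∀ n, wn (V n) f ≤ C) : wn W f ≤ C := by
  refine (ENNReal.pow_le_pow_left_iff two_ne_zero).1 ?_
  rw [wn, eLpNorm_two_sq]
  calc _ ≤ ∫⁻ ξ, liminf (fun n => ‖(V n ξ : ℂ) * ft f ξ‖ₑ ^ 2) atTop := by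
        refine lintegral_mono_ae ?_
        filter_upwards [h] with ξ hξ
        refine le_liminf_of_le (by isBoundedDefault) ?_
        filter_upwards [hξ] with n hn
        simp only [enorm_mul]
        gcongr
        rw [← ofReal_norm, ← ofReal_norm]
        exact ENNReal.ofReal_le_ofReal (by simpa using hn)
    _ ≤ liminf (fun n => ∫⁻ ξ, ‖(V n ξ : ℂ) * ft f ξ‖ₑ ^ 2) atTop := by
        refine lintegral_liminf_le fun n => ?_
        have := hV n
        have := measurable_ft f
        fun_prop
    _ ≤ C ^ 2 := by
        refine liminf_le_of_le (by isBoundedDefault) fun b hb => ?_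
        obtain ⟨n, hn⟩ := hb.exists
        refine hn.trans ?_
        rw [← eLpNorm_two_sq]
        exact pow_le_pow_left' (hC n) 2

theorem w1_mono {a b : Space d → ℝ} (h : ∀ ξ, a ξ ≤ b ξ) (f : L2 d) : w1 a f ≤ w1 b f :=
  lintegral_mono fun ξ => by gcongr; exact h ξ

theorem w1_const_mul {C : ℝ} (hC : 0 ≤ C) {b : Space d → ℝ} (hb : Measurable b) (f : L2 d) :
    w1 (fun ξ => C * b ξ) f = ENNReal.ofReal C * w1 b f := by
  have := measurable_ft f
  rw [w1, w1, ← lintegral_const_mul _ (by fun_prop)]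
  congr 1 with ξ
  rw [ENNReal.ofReal_mul hC, mul_assoc]

theorem jb_add (s r : ℝ) (ξ : Space d) : jb (s + r) ξ = jb s ξ * jb r ξ := by
  rw [jb, jb, jb, ← Real.rpow_add (by positivity)]; congr 1; ring

@[simp] theorem jb_zero (ξ : Space d) : jb 0 ξ = 1 := by simp [jb]

theorem jb_two (ξ : Space d) : jb 2 ξ = 1 + ‖ξ‖ ^ 2 := by simp [jb]

@[simp] theorem jb_neg_arg (s : ℝ) (ξ : Space d) : jb s (-ξ) = jb s ξ := by simp [jb]

theorem jb_mono {s r : ℝ} (h : s ≤ r) (ξ : Space d) : jb s ξ ≤ jb r ξ :=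
  Real.rpow_le_rpow_of_exponent_le (by simp) (by linarith)

theorem one_le_jb {s : ℝ} (h : 0 ≤ s) (ξ : Space d) : 1 ≤ jb s ξ := by
  simpa using jb_mono h ξ

theorem wn_jb_mono {s r : ℝ} (h : s ≤ r) (f : L2 d) : wn (jb s) f ≤ wn (jb r) f :=
  wn_mono (fun ξ => by
    rw [abs_of_pos (jb_pos _ _), abs_of_pos (jb_pos _ _)]; exact jb_mono h ξ) f

/-- The norm of the embedding of `H^s` with `s > d / 2` into the Fourier transforms of `L¹`
functions. -/
noncomputable def embC (d : ℕ) (s : ℝ) : ℝ≥0∞ := eLpNorm (jb (-s) : Space d → ℝ) 2 volume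

theorem embC_lt_top {s : ℝ} (hs : (d : ℝ) < 2 * s) : embC d s < ∞ := by
  rw [embC, eLpNorm_lt_top_iff_lintegral_rpow_enorm_lt_top (by norm_num) (by norm_num)]
  have hi := integrable_rpow_neg_one_add_norm_sq (E := Space d) (μ := volume) (r := 2 * s)
    (by simpa using hs)
  refine lt_of_le_of_lt (le_of_eq ?_) hi.lintegral_lt_top
  congr 1 with ξ
  rw [← ofReal_norm, Real.norm_of_nonneg (jb_pos _ _).le, ENNReal.ofReal_rpow_of_nonneg
    (jb_pos _ _).le (by simp), jb, ← Real.rpow_mul (by positivity)]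
  congr 2
  simp; ring

/-- The Sobolev embedding, on the Fourier side, by the Cauchy-Schwarz inequality. -/
theorem w1_jb_le (r s : ℝ) (f : L2 d) : w1 (jb r) f ≤ embC d (s - r) * wn (jb s) f := by
  have hfm := (measurable_ft f).enorm
  have hj : ∀ s : ℝ, Measurable (jb s : Space d → ℝ) := fun s => (continuous_jb s).measurable
  have h := ENNReal.lintegral_mul_le_Lp_mul_Lq volume Real.HolderConjugate.two_two
    (f := fun ξ : Space d => ENNReal.ofReal (jb (-(s - r)) ξ))
    (g := fun ξ => ENNReal.ofReal (jb s ξ) * ‖ft f ξ‖ₑ)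
    (by have := hj (-(s-r)); fun_prop) (by have := hj s; fun_prop)
  rw [wn_eq (fun ξ => (jb_pos _ _).le), embC, eLpNorm_eq_lintegral_rpow_enorm_toReal (by norm_num)
    (by norm_num), eLpNorm_eq_lintegral_rpow_enorm_toReal (by norm_num) (by norm_num)]
  simp only [enorm_eq_self, ENNReal.toReal_ofNat]
  refine Eq.trans_le ?_ (h.trans_eq ?_)
  · rw [w1]
    congr 1 with ξ
    rw [Pi.mul_apply, ← mul_assoc, ← ENNReal.ofReal_mul (jb_pos _ _).le, ← jb_add]
    congr 3; ring
  · congr 4 with ξ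
    rw [← ofReal_norm, Real.norm_of_nonneg (jb_pos _ _).le]

theorem kap_le_jb (ξ : Space d) : kap ξ ≤ 2 * Real.pi * jb 1 ξ := by
  unfold kap
  gcongr
  rw [jb, ← Real.sqrt_eq_rpow]
  exact Real.le_sqrt_of_sq_le (by linarith)

/-- Peetre's inequality. -/
theorem jb_two_peetre (ξ η : Space d) : jb 2 ξ ≤ 2 * (jb 2 (ξ - η) * jb 2 η) := by
  simp only [jb_two]
  have h : ‖ξ‖ ≤ ‖ξ - η‖ + ‖η‖ := by simpa using norm_add_le (ξ - η) η
  have h0 := norm_nonneg ξ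
  nlinarith [sq_nonneg (‖ξ - η‖ - ‖η‖), mul_nonneg (sq_nonneg ‖ξ - η‖) (sq_nonneg ‖η‖),
    norm_nonneg (ξ - η), norm_nonneg η]

theorem jb_eq_rpow (s : ℝ) (ξ : Space d) : jb s ξ = jb 2 ξ ^ (s / 2) := by rw [jb_two]; rfl

theorem jb_peetre {s : ℝ} (hs : 0 ≤ s) (ξ η : Space d) :
    jb s ξ ≤ 2 ^ (s / 2) * (jb s (ξ - η) * jb s η) := by
  rw [jb_eq_rpow s, jb_eq_rpow s (ξ - η), jb_eq_rpow s η,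
    ← Real.mul_rpow (jb_pos _ _).le (jb_pos _ _).le,
    ← Real.mul_rpow (by norm_num) (mul_pos (jb_pos _ _) (jb_pos _ _)).le]
  exact Real.rpow_le_rpow (jb_pos _ _).le (jb_two_peetre ξ η) (by linarith)

theorem jb_neg (s : ℝ) (ξ : Space d) : jb (-s) ξ = (jb s ξ)⁻¹ := by
  rw [jb, jb, ← Real.rpow_neg (by positivity)]; congr 1; ring

theorem jb_neg_two_peetre (ξ η : Space d) : jb (-2) ξ ≤ 2 * (jb 2 (ξ - η) * jb (-2) η) := by
  have h := jb_two_peetre η ξ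
  have e : jb 2 (η - ξ) = jb 2 (ξ - η) := by rw [← jb_neg_arg, neg_sub]
  rw [e] at h
  have h1 := jb_pos 2 ξ
  have h2 := jb_pos 2 η
  rw [jb_neg, jb_neg, ← mul_assoc, ← div_eq_mul_inv, le_div_iff₀ h2, inv_mul_le_iff₀ h1]
  linarith

/-- The triangle inequality for the weights `⟨ξ⟩ˢ`. -/
theorem jb_tame {s : ℝ} (hs : 0 ≤ s) (ξ η : Space d) :
    jb s ξ ≤ 2 ^ s * jb s (ξ - η) + 2 ^ s * jb s η := by
  have h : ‖ξ‖ ≤ ‖ξ - η‖ + ‖η‖ := by simpa using norm_add_le (ξ - η) η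
  have h4 : ∀ x : Space d, (4 : ℝ) ^ (s / 2) * jb s x = (4 * jb 2 x) ^ (s / 2) := fun x => by
    rw [Real.mul_rpow (by norm_num) (jb_pos _ _).le, ← jb_eq_rpow]
  have e : (2 : ℝ) ^ s = 4 ^ (s / 2) := by
    rw [show (4 : ℝ) = 2 ^ (2 : ℝ) by norm_num, ← Real.rpow_mul (by norm_num)]; congr 1; ring
  rw [e, h4, h4, jb_eq_rpow s ξ]
  have n1 := norm_nonneg ξ
  have n2 := norm_nonneg η
  have n3 := norm_nonneg (ξ - η)
  have p1 : 0 ≤ (4 * jb 2 (ξ - η)) ^ (s / 2) :=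
    Real.rpow_nonneg (mul_nonneg (by norm_num) (jb_pos _ _).le) _
  have p2 : 0 ≤ (4 * jb 2 η) ^ (s / 2) :=
    Real.rpow_nonneg (mul_nonneg (by norm_num) (jb_pos _ _).le) _
  rcases le_total ‖ξ - η‖ ‖η‖ with h1 | h1
  · have : jb 2 ξ ≤ 4 * jb 2 η := by simp only [jb_two]; nlinarith
    have := Real.rpow_le_rpow (jb_pos _ _).le this (show 0 ≤ s / 2 by linarith)
    linarith
  · have : jb 2 ξ ≤ 4 * jb 2 (ξ - η) := by simp only [jb_two]; nlinarith
    have := Real.rpow_le_rpow (jb_pos _ _).le this (show 0 ≤ s / 2 by linarith)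
    linarith

/-- A bounded weight with decay of order `-2` that increases to `⟨ξ⟩ˢ` as `N → ∞`. -/
noncomputable def rwt (s : ℝ) (N : ℕ) (ξ : Space d) : ℝ := min (jb s ξ) (N * jb (-2) ξ)

theorem rwt_nonneg (s : ℝ) (N : ℕ) (ξ : Space d) : 0 ≤ rwt s N ξ :=
  le_min (jb_pos _ _).le (mul_nonneg (Nat.cast_nonneg _) (jb_pos _ _).le)

theorem rwt_le_jb (s : ℝ) (N : ℕ) (ξ : Space d) : rwt s N ξ ≤ jb s ξ := min_le_left _ _

theorem rwt_mul_jb_two_le (s : ℝ) (N : ℕ) (ξ : Space d) : rwt s N ξ * jb 2 ξ ≤ N := by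
  have h1 := jb_pos 2 ξ
  have h2 : rwt s N ξ ≤ N * jb (-2) ξ := min_le_right _ _
  rw [jb_neg] at h2
  calc _ ≤ N * (jb 2 ξ)⁻¹ * jb 2 ξ := by gcongr
    _ = N := by field_simp

theorem measurable_rwt (s : ℝ) (N : ℕ) : Measurable (rwt s N : Space d → ℝ) :=
  ((continuous_jb s).min (continuous_const.mul (continuous_jb (-2)))).measurable

/-- Peetre's inequality for the bounded weights, with a constant that does not depend on `N`. -/
theorem rwt_peetre {s : ℝ} (hs : 0 ≤ s) (N : ℕ) (ξ η : Space d) :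
    rwt s N ξ ≤ 2 * 2 ^ (s / 2) * jb (s + 2) (ξ - η) * rwt s N η := by
  have hc : (1 : ℝ) ≤ 2 ^ (s / 2) := Real.one_le_rpow (by norm_num) (by linarith)
  have hN : (0 : ℝ) ≤ N := Nat.cast_nonneg _
  have p1 := jb_pos (s + 2) (ξ - η)
  have p2 := jb_pos (-2) η
  have p3 := jb_pos s η
  have p4 := jb_pos s (ξ - η)
  rw [rwt, rwt, mul_min_of_nonneg _ _ (mul_nonneg (by positivity) (jb_pos _ _).le)]
  refine min_le_min ?_ ?_
  · calc jb s ξ ≤ 1 * 2 ^ (s / 2) * (jb s (ξ - η) * jb s η) := by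
          rw [one_mul]; exact jb_peetre hs ξ η
      _ ≤ 2 * 2 ^ (s / 2) * (jb (s + 2) (ξ - η) * jb s η) := by
          gcongr
          · norm_num
          · exact jb_mono (by linarith) _
      _ = _ := by ring
  · calc N * jb (-2) ξ ≤ N * (2 * (jb 2 (ξ - η) * jb (-2) η)) := by
          gcongr; exact jb_neg_two_peetre ξ η
      _ ≤ N * (2 * 2 ^ (s / 2) * (jb (s + 2) (ξ - η) * jb (-2) η)) := by
          have h1 : jb 2 (ξ - η) ≤ jb (s + 2) (ξ - η) := jb_mono (by linarith) _
          have h2 : (2 : ℝ) ≤ 2 * 2 ^ (s / 2) := by linarith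
          have p5 := jb_pos 2 (ξ - η)
          gcongr
      _ = _ := by ring

/-- The triangle inequality for the bounded weights, with a constant that does not depend on `N`. It
fails without the unbounded weight on one of the two terms, since `rwt s N` decays at infinity. -/
theorem rwt_tame {s : ℝ} (hs : 2 ≤ s) (N : ℕ) (ξ η : Space d) :
    rwt s N ξ ≤ 4 * 2 ^ s * jb s (ξ - η) + 4 * 2 ^ s * rwt s N η := by
  have hN : (0 : ℝ) ≤ N := Nat.cast_nonneg _
  have hc : (1 : ℝ) ≤ 2 ^ s := Real.one_le_rpow (by norm_num) (by linarith)
  have h : ‖ξ‖ ≤ ‖ξ - η‖ + ‖η‖ := by simpa using norm_add_le (ξ - η) η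
  have h' : ‖η‖ ≤ ‖ξ‖ + ‖ξ - η‖ := by simpa using norm_sub_le ξ (ξ - η)
  have n1 := norm_nonneg ξ
  have n2 := norm_nonneg η
  have n3 := norm_nonneg (ξ - η)
  have p1 := jb_pos s (ξ - η)
  have p2 := rwt_nonneg s N η
  have h4 : ∀ x : Space d, (4 : ℝ) ^ (s / 2) * jb s x = (4 * jb 2 x) ^ (s / 2) := fun x => by
    rw [Real.mul_rpow (by norm_num) (jb_pos _ _).le, ← jb_eq_rpow]
  have e : (2 : ℝ) ^ s = 4 ^ (s / 2) := by
    rw [show (4 : ℝ) = 2 ^ (2 : ℝ) by norm_num, ← Real.rpow_mul (by norm_num)]; congr 1; ring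
  rcases le_total ‖ξ - η‖ (‖ξ‖ / 2) with h1 | h1
    -- Here `|η|` and `|ξ|` are comparable, so both terms of the minimum can be compared.
  · have a1 : jb s ξ ≤ 2 ^ s * jb s η := by
      rw [e, h4, jb_eq_rpow s ξ]
      refine Real.rpow_le_rpow (jb_pos _ _).le ?_ (by linarith)
      simp only [jb_two]; nlinarith
    have a2 : jb (-2) ξ ≤ 4 * jb (-2) η := by
      have q1 := jb_pos 2 ξ
      have q2 := jb_pos 2 η
      rw [jb_neg, jb_neg, ← div_eq_mul_inv, le_div_iff₀ q2, inv_mul_le_iff₀ q1]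
      simp only [jb_two]; nlinarith
    have a3 : rwt s N ξ ≤ 4 * 2 ^ s * rwt s N η := by
      rw [rwt, rwt, mul_min_of_nonneg _ _ (by positivity)]
      have q1 := jb_pos s η
      have q2 := jb_pos (-2) η
      refine min_le_min ?_ ?_
      · nlinarith [mul_pos (show (0 : ℝ) < 2 ^ s by positivity) q1]
      · calc N * jb (-2) ξ ≤ N * (4 * jb (-2) η) := by gcongr
          _ = 4 * 1 * (N * jb (-2) η) := by ring
          _ ≤ _ := by gcongr
    have : 0 ≤ 4 * (2 : ℝ) ^ s * jb s (ξ - η) := by positivity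
    linarith
  · have a1 : jb s ξ ≤ 2 ^ s * jb s (ξ - η) := by
      rw [e, h4, jb_eq_rpow s ξ]
      refine Real.rpow_le_rpow (jb_pos _ _).le ?_ (by linarith)
      simp only [jb_two]; nlinarith
    have a2 := rwt_le_jb s N ξ
    have : 0 ≤ 4 * (2 : ℝ) ^ s * rwt s N η := by positivity
    nlinarith [mul_pos (show (0 : ℝ) < 2 ^ s by positivity) p1]

theorem eventually_jb_le_rwt (s : ℝ) (ξ : Space d) :
    ∀ᶠ N : ℕ in atTop, |jb s ξ| ≤ |rwt s N ξ| := by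
  have p := jb_pos (-2) ξ
  filter_upwards [eventually_ge_atTop ⌈jb s ξ / jb (-2) ξ⌉₊] with N hN
  rw [abs_of_pos (jb_pos _ _), abs_of_nonneg (rwt_nonneg _ _ _)]
  refine le_min le_rfl ?_
  rw [← div_le_iff₀ p]
  exact (Nat.le_ceil _).trans (by exact_mod_cast hN)

/-- Bounds with the bounded weights that are uniform in `N` are bounds in `H^s`: energy estimates
may be proved for the bounded weights, for which all norms of `L²` functions are finite. -/
theorem wn_jb_le_of_rwt {s : ℝ} {f : L2 d} {C : ℝ≥0∞} (h : ∀ N : ℕ, wn (rwt s N) f ≤ C) :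
    wn (jb s) f ≤ C :=
  wn_le_of_tendsto (measurable_rwt s) (ae_of_all _ fun ξ => eventually_jb_le_rwt s ξ) h

/-! ### Energy estimates and time derivatives -/

/-- Gronwall's inequality. -/
theorem gronwall_Icc {T K G : ℝ} (hK : 0 ≤ K) (hG : 0 ≤ G) {E E' : ℝ → ℝ}
    (hE : ∀ t ∈ Icc 0 T, HasDerivWithinAt E (E' t) (Icc 0 T) t)
    (h : ∀ t ∈ Icc 0 T, E' t ≤ K * E t + G) (hE0 : 0 ≤ E 0) :
    ∀ t ∈ Icc 0 T, E t ≤ (E 0 + G * T) * Real.exp (K * T) := by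
  intro t ht
  have hT : 0 ≤ T := ht.1.trans ht.2
  set F : ℝ → ℝ := fun t => Real.exp (-K * t) * E t - G * t with hF
  have hFd : ∀ t ∈ Icc 0 T, HasDerivWithinAt F
      (Real.exp (-K * t) * (-K) * E t + Real.exp (-K * t) * E' t - G) (Icc 0 T) t := by
    intro t ht
    have h1 : HasDerivWithinAt (fun t => Real.exp (-K * t)) (Real.exp (-K * t) * (-K))
        (Icc 0 T) t := by
      simpa using ((hasDerivAt_id t).const_mul (-K)).exp.hasDerivWithinAt
    have h2 : HasDerivWithinAt (fun t => G * t) G (Icc 0 T) t := by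
      simpa using ((hasDerivAt_id t).const_mul G).hasDerivWithinAt
    exact (h1.mul (hE t ht)).sub h2
  have hanti : AntitoneOn F (Icc 0 T) := by
    refine antitoneOn_of_hasDerivWithinAt_nonpos (convex_Icc 0 T)
      (fun t ht => (hFd t ht).continuousWithinAt)
      (fun t ht => (hFd t (interior_subset ht)).mono interior_subset) fun t ht => ?_
    have ht' := interior_subset ht
    have h1 := h t ht'
    have h2 : Real.exp (-K * t) ≤ 1 := Real.exp_le_one_iff.2 (by nlinarith [ht'.1])
    have h3 := Real.exp_pos (-K * t)
    nlinarith
  have h1 := hanti ⟨le_rfl, hT⟩ ht ht.1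
  simp only [hF, mul_zero, Real.exp_zero, one_mul, sub_zero] at h1
  have h3 : E t = Real.exp (K * t) * (Real.exp (-K * t) * E t) := by
    rw [← mul_assoc, ← Real.exp_add]; simp
  rw [h3, mul_comm]
  have h4 : Real.exp (K * t) ≤ Real.exp (K * T) := Real.exp_le_exp.2 (by nlinarith [ht.2])
  have h5 : Real.exp (-K * t) * E t ≤ E 0 + G * T := by nlinarith [ht.2]
  calc _ ≤ (E 0 + G * T) * Real.exp (K * t) := by gcongr
    _ ≤ _ := by gcongr

/-- Multiplication by `i s` with a real function `s` is skew-adjoint and does not change the energy.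
The function `s` may be unbounded. -/
theorem inner_le_of_skew {Y Y' G : L2 d} {s : Space d → ℝ}
    (h : Y' =ᵐ[volume] fun ξ => Complex.I * s ξ * Y ξ + G ξ) :
    inner ℝ Y Y' ≤ ‖Y‖ * ‖G‖ := by
  have e : inner ℝ Y Y' = inner ℝ Y G := by
    rw [L2.inner_def, L2.inner_def]
    apply integral_congr_ae
    filter_upwards [h] with ξ hξ
    rw [hξ]
    simp [Complex.inner]; ring
  rw [e]
  exact real_inner_le_norm _ _

/-- Energy estimate for a pair of evolutions, each of which is skew-adjoint up to a source. -/
theorem energy_pair {T A B : ℝ} (hB : 0 ≤ B) {Y Z Y' Z' : ℝ → L2 d}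
    (hY : ∀ t ∈ Icc 0 T, HasDerivWithinAt Y (Y' t) (Icc 0 T) t)
    (hZ : ∀ t ∈ Icc 0 T, HasDerivWithinAt Z (Z' t) (Icc 0 T) t)
    (hY' : ∀ t ∈ Icc 0 T, ∃ (s : Space d → ℝ) (G : L2 d),
      (Y' t =ᵐ[volume] fun ξ => Complex.I * s ξ * Y t ξ + G ξ) ∧ ‖G‖ ≤ A + B * (‖Y t‖ + ‖Z t‖))
    (hZ' : ∀ t ∈ Icc 0 T, ∃ (s : Space d → ℝ) (G : L2 d),
      (Z' t =ᵐ[volume] fun ξ => Complex.I * s ξ * Z t ξ + G ξ) ∧ ‖G‖ ≤ A + B * (‖Y t‖ + ‖Z t‖)) :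
    ∀ t ∈ Icc 0 T, ‖Y t‖ ^ 2 + ‖Z t‖ ^ 2 ≤
      (‖Y 0‖ ^ 2 + ‖Z 0‖ ^ 2 + 2 * A ^ 2 * T) * Real.exp ((4 * B + 1) * T) := by
  refine gronwall_Icc (E' := fun t => 2 * inner ℝ (Y t) (Y' t) + 2 * inner ℝ (Z t) (Z' t))
    (by positivity) (by positivity)
    (fun t ht => ((hY t ht).norm_sq).add ((hZ t ht).norm_sq)) (fun t ht => ?_) (by positivity)
  obtain ⟨s, G, h1, h2⟩ := hY' t ht
  obtain ⟨s', G', h3, h4⟩ := hZ' t ht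
  have h5 := inner_le_of_skew h1
  have h6 := inner_le_of_skew h3
  have p1 := norm_nonneg (Y t)
  have p2 := norm_nonneg (Z t)
  have h7 := mul_le_mul_of_nonneg_left h2 p1
  have h8 := mul_le_mul_of_nonneg_left h4 p2
  have h9 : inner ℝ (Y t) (Y' t) + inner ℝ (Z t) (Z' t) ≤
      (‖Y t‖ + ‖Z t‖) * (A + B * (‖Y t‖ + ‖Z t‖)) := by
    calc _ ≤ ‖Y t‖ * (A + B * (‖Y t‖ + ‖Z t‖)) + ‖Z t‖ * (A + B * (‖Y t‖ + ‖Z t‖)) := by linarith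
      _ = _ := by ring
  have h10 : (‖Y t‖ + ‖Z t‖) ^ 2 ≤ 2 * (‖Y t‖ ^ 2 + ‖Z t‖ ^ 2) := by
    nlinarith [sq_nonneg (‖Y t‖ - ‖Z t‖)]
  have h11 := mul_le_mul_of_nonneg_left h10 hB
  nlinarith [sq_nonneg ((‖Y t‖ + ‖Z t‖) - 2 * A)]

section TimeDerivative

variable {T : ℝ}

theorem hasDerivWithinAt_dt (hT : 0 < T) {u : ℝ → L2 d} {n k : ℕ} (hu : ContDiffOn ℝ n u (Icc 0 T))
    (hk : k < n) {t : ℝ} (ht : t ∈ Icc 0 T) :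
    HasDerivWithinAt (dt T k u) (dt T (k + 1) u t) (Icc 0 T) t := by
  have h := hu.differentiableOn_iteratedDerivWithin (m := k) (by exact_mod_cast hk)
    (uniqueDiffOn_Icc hT)
  unfold dt
  rw [iteratedDerivWithin_succ]
  exact (h t ht).hasDerivWithinAt

theorem dt_zero (u : ℝ → L2 d) : dt T 0 u = u := by
  ext1 t; simp [dt]

theorem continuousOn_dt (hT : 0 < T) {u : ℝ → L2 d} {n k : ℕ} (hu : ContDiffOn ℝ n u (Icc 0 T))
    (hk : k ≤ n) : ContinuousOn (dt T k u) (Icc 0 T) :=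
  hu.continuousOn_iteratedDerivWithin (by exact_mod_cast hk) (uniqueDiffOn_Icc hT)

theorem dt_succ_eq (hT : 0 < T) {u v : ℝ → L2 d} {u' : L2 d} {k : ℕ}
    (h : ∀ t ∈ Icc 0 T, dt T k u t = v t) {t : ℝ} (ht : t ∈ Icc 0 T)
    (hv : HasDerivWithinAt v u' (Icc 0 T) t) : dt T (k + 1) u t = u' := by
  unfold dt
  rw [iteratedDerivWithin_succ]
  have h1 := derivWithin_congr (s := Icc 0 T) (x := t) (f := v) (f₁ := dt T k u) h (h t ht)
  exact h1.trans (hv.derivWithin (uniqueDiffOn_Icc hT t ht))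

theorem contDiffOn_succ_of_hasDeriv (hT : 0 < T) {u u' : ℝ → L2 d} {n : ℕ}
    (h : ∀ t ∈ Icc 0 T, HasDerivWithinAt u (u' t) (Icc 0 T) t)
    (h' : ContDiffOn ℝ n u' (Icc 0 T)) : ContDiffOn ℝ (n + 1 : ℕ) u (Icc 0 T) := by
  push_cast
  rw [contDiffOn_succ_iff_derivWithin (uniqueDiffOn_Icc hT)]
  refine ⟨fun t ht => (h t ht).differentiableWithinAt, by simp, h'.congr fun t ht => ?_⟩
  exact (h t ht).derivWithin (uniqueDiffOn_Icc hT t ht)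

/-- If `u = S U` and `u' = S U'` with an injective operator `S`, and `U`, `U'` are continuous, then
`U` is differentiable with derivative `U'`. -/
theorem hasDerivWithinAt_of_comp_injective (hT : 0 < T) {S : L2 d →L[ℝ] L2 d}
    (hS : Function.Injective S) {u u' U U' : ℝ → L2 d}
    (hu : ∀ t ∈ Icc 0 T, HasDerivWithinAt u (u' t) (Icc 0 T) t)
    (h : ∀ t ∈ Icc 0 T, u t = S (U t)) (h' : ∀ t ∈ Icc 0 T, u' t = S (U' t))
    (hU' : ContinuousOn U' (Icc 0 T)) :
    ∀ t ∈ Icc 0 T, HasDerivWithinAt U (U' t) (Icc 0 T) t := by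
  have key : ∀ t ∈ Icc 0 T, U t = U 0 + ∫ s in (0 : ℝ)..t, U' s := by
    intro t ht
    apply hS
    have hsub : uIcc 0 t ⊆ Icc 0 T := by
      rw [uIcc_of_le ht.1]; exact Icc_subset_Icc_right ht.2
    have hi : IntervalIntegrable U' volume 0 t := (hU'.mono hsub).intervalIntegrable
    rw [map_add, ← ContinuousLinearMap.intervalIntegral_comp_comm _ hi, ← h t ht,
      ← h 0 ⟨le_rfl, hT.le⟩]
    have h1 : ∫ s in (0 : ℝ)..t, S (U' s) = ∫ s in (0 : ℝ)..t, u' s :=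
      intervalIntegral.integral_congr fun s hs => (h' s (hsub hs)).symm
    have hsub' : Icc 0 t ⊆ Icc 0 T := Icc_subset_Icc_right ht.2
    rw [h1, intervalIntegral.integral_eq_sub_of_hasDerivAt_of_le ht.1 (f := u)]
    · abel
    · exact fun s hs => ((hu s (hsub' hs)).continuousWithinAt).mono hsub'
    · intro s hs
      exact (hu s (hsub' (Ioo_subset_Icc_self hs))).hasDerivAt
        (Icc_mem_nhds hs.1 (hs.2.trans_le ht.2))
    · refine ContinuousOn.intervalIntegrable ?_
      refine (S.continuous.comp_continuousOn (hU'.mono hsub)).congr fun s hs => h' s (hsub hs)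
  intro t ht
  have h2 : HasDerivWithinAt (fun t => U 0 + ∫ s in (0 : ℝ)..t, U' s) (U' t) (Icc 0 T) t := by
    refine HasDerivWithinAt.const_add _ ?_
    have : Fact (t ∈ Icc 0 T) := ⟨ht⟩
    refine intervalIntegral.integral_hasDerivWithinAt_right ?_ ?_ (hU' t ht)
    · exact (hU'.mono (by rw [uIcc_of_le ht.1]; exact Icc_subset_Icc_right ht.2)).intervalIntegrable
    · exact hU'.stronglyMeasurableAtFilter_nhdsWithin measurableSet_Icc t
  exact h2.congr key (key t ht)

end TimeDerivative

/-! ### Product estimates and the product rule -/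

theorem one_eq_jb_zero : (1 : Space d → ℝ) = jb 0 := by ext ξ; simp

/-- The constant of the embedding of `H²` into the Fourier transforms of `L¹` functions, in
dimension at most three. -/
noncomputable def kemb (d : ℕ) : ℝ≥0 := (embC d 2).toNNReal

theorem coe_kemb (hd : d ≤ 3) : (kemb d : ℝ≥0∞) = embC d 2 := by
  refine ENNReal.coe_toNNReal (embC_lt_top ?_).ne
  have : (d : ℝ) ≤ 3 := by exact_mod_cast hd
  linarith

theorem w1_jb_le_two (hd : d ≤ 3) (r : ℝ) (f : L2 d) :
    w1 (jb r) f ≤ kemb d * wn (jb (r + 2)) f := by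
  have := w1_jb_le r (r + 2) f
  rwa [add_sub_cancel_left, ← coe_kemb hd] at this

theorem w1_one_le (hd : d ≤ 3) (f : L2 d) : w1 1 f ≤ kemb d * wn (jb 2) f := by
  have := w1_jb_le_two hd 0 f
  rwa [zero_add, ← one_eq_jb_zero] at this

theorem w1_one_lt_top (hd : d ≤ 3) {f : L2 d} (h : wn (jb 2) f < ∞) : w1 1 f < ∞ :=
  (w1_one_le hd f).trans_lt (ENNReal.mul_lt_top ENNReal.coe_lt_top h)

theorem wn_one (f : L2 d) : wn 1 f = ‖f‖ₑ := by
  rw [wn]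
  simp only [Pi.one_apply, Complex.ofReal_one, one_mul]
  rw [← Lp.enorm_def, ← ofReal_norm, norm_ft, ofReal_norm]

/-- The constant of the product estimates. -/
noncomputable def pC (d : ℕ) (s : ℝ) : ℝ≥0 := (4 * 2 ^ s + 2 * 2 ^ (s / 2)) * (1 + kemb d)

theorem measurable_jb (s : ℝ) : Measurable (jb s : Space d → ℝ) := (continuous_jb s).measurable

theorem wn_zero_fun (f : L2 d) : wn (fun _ => 0) f = 0 := by simp [wn]

theorem wn_pm_peetre_aux {W b : Space d → ℝ} (hWm : Measurable W) (hbm : Measurable b)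
    (hW0 : ∀ ξ, 0 ≤ W ξ) (hb0 : ∀ ξ, 0 ≤ b ξ) (hW : ∀ ξ η, W ξ ≤ b (ξ - η) * W η)
    {f g : L2 d} (hf : w1 1 f < ∞) : wn W (pm f g) ≤ w1 b f * wn W g := by
  have := wn_pm_le (a := fun _ => 0) hWm measurable_const hbm hW0 (fun _ => le_rfl) hb0
    (by simpa using hW) (g := g) hf
  simpa [wn_zero_fun] using this

theorem enorm_pm_le {f g : L2 d} (hf : w1 1 f < ∞) : ‖pm f g‖ₑ ≤ w1 1 f * ‖g‖ₑ := by
  rw [← wn_one, ← wn_one]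
  exact wn_pm_peetre_aux measurable_one measurable_one (by simp) (by simp) (by simp) hf

theorem wn_jb_lt_top_mono {s r : ℝ} (h : s ≤ r) {f : L2 d} (hf : wn (jb r) f < ∞) :
    wn (jb s) f < ∞ := (wn_jb_mono h f).trans_lt hf

theorem ofReal_two_rpow_le (s : ℝ) :
    ENNReal.ofReal (2 * 2 ^ (s / 2)) * kemb d ≤ pC d s := by
  have h : (2 * 2 ^ (s / 2) : ℝ≥0) * kemb d ≤ pC d s := by
    unfold pC; gcongr <;> simp
  rw [show (2 * 2 ^ (s / 2) : ℝ) = ((2 * 2 ^ (s / 2) : ℝ≥0) : ℝ) by push_cast; rfl,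
    ENNReal.ofReal_coe_nnreal]
  exact_mod_cast h

/-- Product estimate that puts all the weight on the second factor, at the cost of two derivatives
of the first one. -/
theorem wn_pm_le_peetre (hd : d ≤ 3) {s : ℝ} (hs : 0 ≤ s) {f g : L2 d}
    (hf : wn (jb (s + 2)) f < ∞) :
    wn (jb s) (pm f g) ≤ pC d s * wn (jb (s + 2)) f * wn (jb s) g := by
  have hm := measurable_jb (d := d)
  have h := wn_pm_peetre_aux (b := fun ξ => 2 * 2 ^ (s / 2) * jb s ξ) (hm s) ((hm s).const_mul _)
    (fun ξ => (jb_pos _ _).le) (fun ξ => mul_nonneg (by positivity) (jb_pos _ _).le) (fun ξ η => by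
      have := jb_peetre hs ξ η
      have p1 := jb_pos s (ξ - η)
      have p2 := jb_pos s η
      have p3 : (0 : ℝ) < 2 ^ (s / 2) := by positivity
      nlinarith [mul_pos p3 (mul_pos p1 p2)]) (g := g)
    (w1_one_lt_top hd (wn_jb_lt_top_mono (by linarith) hf))
  rw [w1_const_mul (by positivity) (hm s)] at h
  refine h.trans (mul_le_mul_left ?_ _)
  calc _ ≤ ENNReal.ofReal (2 * 2 ^ (s / 2)) * (kemb d * wn (jb (s + 2)) f) := by
        gcongr; exact w1_jb_le_two hd s f
    _ ≤ _ := by rw [← mul_assoc]; gcongr; exact ofReal_two_rpow_le s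

theorem wn_rwt_pm_le_peetre (hd : d ≤ 3) {s : ℝ} (hs : 0 ≤ s) (N : ℕ) {f g : L2 d}
    (hf : wn (jb (s + 4)) f < ∞) :
    wn (rwt s N) (pm f g) ≤ pC d s * wn (jb (s + 4)) f * wn (rwt s N) g := by
  have hm := measurable_jb (d := d)
  have h := wn_pm_peetre_aux (b := fun ξ => 2 * 2 ^ (s / 2) * jb (s + 2) ξ) (measurable_rwt s N)
    ((hm (s + 2)).const_mul _) (rwt_nonneg s N)
    (fun ξ => mul_nonneg (by positivity) (jb_pos _ _).le) (rwt_peetre hs N) (g := g)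
    (w1_one_lt_top hd (wn_jb_lt_top_mono (by linarith) hf))
  rw [w1_const_mul (by positivity) (hm _)] at h
  refine h.trans (mul_le_mul_left ?_ _)
  calc _ ≤ ENNReal.ofReal (2 * 2 ^ (s / 2)) * (kemb d * wn (jb (s + 4)) f) := by
        gcongr
        have := w1_jb_le_two hd (s + 2) f
        rwa [show s + 2 + 2 = s + 4 by ring] at this
    _ ≤ _ := by rw [← mul_assoc]; gcongr; exact ofReal_two_rpow_le s

theorem wn_pm_le_tame_aux {s : ℝ} {W : Space d → ℝ} (hWm : Measurable W) (hW0 : ∀ ξ, 0 ≤ W ξ)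
    (h : ∀ ξ η, W ξ ≤ 4 * 2 ^ s * jb s (ξ - η) + 4 * 2 ^ s * W η) {f g : L2 d}
    (hf : w1 1 f < ∞) :
    wn W (pm f g) ≤ pC d s * (wn (jb s) f * w1 1 g + w1 1 f * wn W g) := by
  have hm := measurable_jb (d := d)
  have h := wn_pm_le (a := fun ξ => 4 * 2 ^ s * jb s ξ)
    (b := fun ξ => 4 * 2 ^ s * (1 : Space d → ℝ) ξ) hWm ((hm s).const_mul _) (measurable_one.const_mul _)
    hW0
    (fun ξ => mul_nonneg (by positivity) (jb_pos _ _).le) (fun ξ => by simp; positivity)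
    (fun ξ η => by simpa using h ξ η) (g := g) hf
  rw [w1_const_mul (by positivity) measurable_one] at h
  have h2 : wn (fun ξ => 4 * 2 ^ s * jb s ξ) f ≤ ENNReal.ofReal (4 * 2 ^ s) * wn (jb s) f :=
    wn_le_const_mul (fun ξ => by
      rw [abs_mul, abs_of_nonneg (by positivity : (0 : ℝ) ≤ 4 * 2 ^ s)]) f
  have h3 : ENNReal.ofReal (4 * 2 ^ s) ≤ pC d s := by
    have h : (4 * 2 ^ s : ℝ≥0) ≤ pC d s := by
      unfold pC
      calc (4 * 2 ^ s : ℝ≥0) = (4 * 2 ^ s) * 1 := by simp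
        _ ≤ _ := by gcongr <;> simp
    rw [show (4 * 2 ^ s : ℝ) = ((4 * 2 ^ s : ℝ≥0) : ℝ) by push_cast; rfl,
      ENNReal.ofReal_coe_nnreal]
    exact_mod_cast h
  calc _ ≤ _ := h
    _ ≤ ENNReal.ofReal (4 * 2 ^ s) * wn (jb s) f * w1 1 g
        + ENNReal.ofReal (4 * 2 ^ s) * w1 1 f * wn W g := by gcongr
    _ = ENNReal.ofReal (4 * 2 ^ s) * (wn (jb s) f * w1 1 g + w1 1 f * wn W g) := by ring
    _ ≤ _ := by gcongr

theorem wn_rwt_pm_le_tame {s : ℝ} (hs : 2 ≤ s) (N : ℕ) {f g : L2 d} (hf : w1 1 f < ∞) :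
    wn (rwt s N) (pm f g) ≤ pC d s * (wn (jb s) f * w1 1 g + w1 1 f * wn (rwt s N) g) :=
  wn_pm_le_tame_aux (measurable_rwt s N) (rwt_nonneg s N) (rwt_tame hs N) hf

/-- Product estimate in which the weight falls on one of the factors at a time. -/
theorem wn_pm_le_tame {s : ℝ} (hs : 0 ≤ s) {f g : L2 d} (hf : w1 1 f < ∞) :
    wn (jb s) (pm f g) ≤ pC d s * (wn (jb s) f * w1 1 g + w1 1 f * wn (jb s) g) := by
  refine wn_pm_le_tame_aux (measurable_jb s) (fun ξ => (jb_pos _ _).le) (fun ξ η => ?_) hf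
  have h := jb_tame hs ξ η
  have p0 : (0 : ℝ) < 2 ^ s := by positivity
  nlinarith [mul_pos p0 (jb_pos s (ξ - η)), mul_pos p0 (jb_pos s η)]

theorem pm_add_right {f g h : L2 d} (hf : w1 1 f < ∞) : pm f (g + h) = pm f g + pm f h := by
  refine Lp.ext ?_
  filter_upwards [coeFn_pm (g := g + h) hf, coeFn_pm (g := g) hf, coeFn_pm (g := h) hf,
    Lp.coeFn_add g h, Lp.coeFn_add (pm f g) (pm f h)] with x h1 h2 h3 h4 h5
  rw [h1, h5, Pi.add_apply, h2, h3, h4, Pi.add_apply]; ring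

theorem pm_smul_right (c : ℂ) {f g : L2 d} (hf : w1 1 f < ∞) : pm f (c • g) = c • pm f g := by
  refine Lp.ext ?_
  filter_upwards [coeFn_pm (g := c • g) hf, coeFn_pm (g := g) hf,
    Lp.coeFn_smul c g, Lp.coeFn_smul c (pm f g)] with x h1 h2 h3 h4
  rw [h1, h4, Pi.smul_apply, h2, h3, Pi.smul_apply]; simp only [smul_eq_mul]; ring

theorem w1_add_lt_top {f g : L2 d} (hf : w1 1 f < ∞) (hg : w1 1 g < ∞) : w1 1 (f + g) < ∞ := by
  refine lt_of_le_of_lt ?_ (ENNReal.add_lt_top.2 ⟨hf, hg⟩)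
  have := measurable_ft f
  rw [w1, w1, w1, ← lintegral_add_left (by simp only [Pi.one_apply]; fun_prop), map_add]
  refine lintegral_mono_ae ?_
  filter_upwards [Lp.coeFn_add (ft f) (ft g)] with ξ h
  rw [h, ← mul_add]
  gcongr
  exact enorm_add_le _ _

theorem w1_smul_lt_top (c : ℂ) {f : L2 d} (hf : w1 1 f < ∞) : w1 1 (c • f) < ∞ := by
  refine lt_of_le_of_lt ?_ (ENNReal.mul_lt_top (enorm_lt_top (x := c)) hf)
  have := measurable_ft f
  rw [w1, w1, ← lintegral_const_mul _ (by simp only [Pi.one_apply]; fun_prop), map_smul]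
  refine lintegral_mono_ae ?_
  filter_upwards [Lp.coeFn_smul c (ft f)] with ξ h
  rw [h]; simp

theorem pm_add_left {f g h : L2 d} (hf : w1 1 f < ∞) (hg : w1 1 g < ∞) :
    pm (f + g) h = pm f h + pm g h := by
  refine Lp.ext ?_
  filter_upwards [coeFn_pm (g := h) (w1_add_lt_top hf hg), coeFn_pm (g := h) hf,
    coeFn_pm (g := h) hg, Lp.coeFn_add f g, Lp.coeFn_add (pm f h) (pm g h)] with x h1 h2 h3 h4 h5
  rw [h1, h5, Pi.add_apply, h2, h3, h4, Pi.add_apply]; ring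

theorem pm_smul_left (c : ℂ) {f g : L2 d} (hf : w1 1 f < ∞) : pm (c • f) g = c • pm f g := by
  refine Lp.ext ?_
  filter_upwards [coeFn_pm (g := g) (w1_smul_lt_top c hf), coeFn_pm (g := g) hf,
    Lp.coeFn_smul c f, Lp.coeFn_smul c (pm f g)] with x h1 h2 h3 h4
  rw [h1, h4, Pi.smul_apply, h2, h3, Pi.smul_apply]; simp only [smul_eq_mul]; ring

/-- The isomorphism from `L²` on the Fourier side to `H²`. -/
noncomputable def bess : L2 d →L[ℂ] L2 d := ftInv.comp (mulOp fun ξ => (jb (-2) ξ : ℂ))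

theorem memLp_top_jb_neg_two : MemLp (fun ξ : Space d => (jb (-2) ξ : ℂ)) ∞ volume := by
  refine memLp_top_of_le (Complex.measurable_ofReal.comp (measurable_jb _)) (C := 1) fun ξ => ?_
  rw [Complex.norm_real, Real.norm_of_nonneg (jb_pos _ _).le]
  simpa using jb_mono (by norm_num : (-2 : ℝ) ≤ 0) ξ

theorem ft_bess (U : L2 d) : ft (bess U) =ᵐ[volume] fun ξ => (jb (-2) ξ : ℂ) * U ξ := by
  rw [bess, ContinuousLinearMap.comp_apply, ft_ftInv]
  exact coeFn_mulOp memLp_top_jb_neg_two U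

theorem jb_two_mul_neg_two (ξ : Space d) : (jb 2 ξ : ℂ) * jb (-2) ξ = 1 := by
  rw [← Complex.ofReal_mul, ← jb_add]; simp

theorem wn_two_bess (U : L2 d) : wn (jb 2) (bess U) = ‖U‖ₑ := by
  rw [wn, Lp.enorm_def]
  refine eLpNorm_congr_ae ?_
  filter_upwards [ft_bess U] with ξ hξ
  rw [hξ, ← mul_assoc, jb_two_mul_neg_two, one_mul]

theorem bess_injective : Function.Injective (bess : L2 d → L2 d) := by
  refine (injective_iff_map_eq_zero bess).2 fun U hU => ?_
  have h := wn_two_bess U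
  rw [hU] at h
  have h0 : wn (jb 2) (0 : L2 d) = 0 := by
    have := wn_smul (jb 2) 0 (0 : L2 d)
    simpa using this
  rw [h0] at h
  exact enorm_eq_zero.1 h.symm

/-- The inverse of `bess` on `H²`, extended by `0`. -/
noncomputable def lift2 (f : L2 d) : L2 d :=
  open Classical in
  if h : MemLp (fun ξ => (jb 2 ξ : ℂ) * ft f ξ) 2 volume then h.toLp _ else 0

theorem coeFn_lift2 {f : L2 d} (h : wn (jb 2) f < ∞) :
    lift2 f =ᵐ[volume] fun ξ => (jb 2 ξ : ℂ) * ft f ξ := by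
  have hm : MemLp (fun ξ => (jb 2 ξ : ℂ) * ft f ξ) 2 volume :=
    ⟨aestronglyMeasurable_mul_ft (measurable_jb 2) f, h⟩
  rw [lift2, dif_pos hm]
  exact hm.coeFn_toLp

theorem bess_lift2 {f : L2 d} (h : wn (jb 2) f < ∞) : bess (lift2 f) = f := by
  apply ft_injective
  refine Lp.ext ?_
  filter_upwards [ft_bess (lift2 f), coeFn_lift2 h] with ξ h1 h2
  rw [h1, h2, ← mul_assoc, mul_comm (jb (-2) ξ : ℂ), jb_two_mul_neg_two, one_mul]

theorem w1_bess_lt_top (hd : d ≤ 3) (U : L2 d) : w1 1 (bess U) < ∞ :=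
  w1_one_lt_top hd (by rw [wn_two_bess]; exact enorm_lt_top)

/-- Multiplication `H² × L² → L²` as a bounded bilinear map. -/
noncomputable def mulH (hd : d ≤ 3) : L2 d →L[ℂ] L2 d →L[ℂ] L2 d :=
  LinearMap.mkContinuous₂
    (LinearMap.mk₂ ℂ (fun U g => pm (bess U) g)
      (fun U V g => by rw [map_add, pm_add_left (w1_bess_lt_top hd U) (w1_bess_lt_top hd V)])
      (fun c U g => by rw [map_smul, pm_smul_left c (w1_bess_lt_top hd U)])
      (fun U g h => pm_add_right (w1_bess_lt_top hd U))
      (fun c U g => pm_smul_right c (w1_bess_lt_top hd U)))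
    (kemb d) fun U g => by
      have h := (enorm_pm_le (g := g) (w1_bess_lt_top hd U)).trans
        (mul_le_mul_left (w1_one_le hd (bess U)) _)
      rw [wn_two_bess] at h
      have h2 : ‖pm (bess U) g‖₊ ≤ kemb d * ‖U‖₊ * ‖g‖₊ := by
        simp only [enorm_eq_nnnorm] at h
        exact_mod_cast h
      exact_mod_cast h2

theorem mulH_apply (hd : d ≤ 3) (U g : L2 d) : mulH hd U g = pm (bess U) g := rfl

theorem hasDerivWithinAt_clm (L : L2 d →L[ℂ] L2 d) {u : ℝ → L2 d} {u' : L2 d} {s : Set ℝ} {t : ℝ}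
    (h : HasDerivWithinAt u u' s t) : HasDerivWithinAt (fun t => L (u t)) (L u') s t :=
  (L.restrictScalars ℝ).hasFDerivAt.comp_hasDerivWithinAt t h

theorem hasDerivWithinAt_cj {u : ℝ → L2 d} {u' : L2 d} {s : Set ℝ} {t : ℝ}
    (h : HasDerivWithinAt u u' s t) : HasDerivWithinAt (fun t => cj (u t)) (cj u') s t :=
  cj.hasFDerivAt.comp_hasDerivWithinAt t h

/-- The product rule in `L²`. Multiplication is continuous as a map `H² × L² → L²` only, so the
first factor has to be differentiable with values in `H²`; that is what `lift2` expresses. -/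
theorem hasDerivWithinAt_pm (hd : d ≤ 3) {z u : ℝ → L2 d} {z' u' : L2 d} {s : Set ℝ} {t : ℝ}
    (ht : t ∈ s)
    (hz : ∀ t ∈ s, wn (jb 2) (z t) < ∞) (hz' : wn (jb 2) z' < ∞)
    (h : HasDerivWithinAt (fun t => lift2 (z t)) (lift2 z') s t) (hu : HasDerivWithinAt u u' s t) :
    HasDerivWithinAt (fun t => pm (z t) (u t)) (pm z' (u t) + pm (z t) u') s t := by
  have h1 := (((mulH hd).restrictScalars ℝ).hasFDerivAt.comp_hasDerivWithinAt t h)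
  have h2 : HasDerivWithinAt (fun t => mulH hd (lift2 (z t)) (u t))
      (mulH hd (lift2 z') (u t) + mulH hd (lift2 (z t)) u') s t := by
    let B : L2 d →L[ℝ] L2 d →L[ℝ] L2 d :=
      (ContinuousLinearMap.restrictScalarsL ℂ (L2 d) (L2 d) ℝ ℝ).comp
        ((mulH hd).restrictScalars ℝ)
    have := (B.isBoundedBilinearMap.hasFDerivAt (lift2 (z t), u t)).comp_hasDerivWithinAt t
      (h.prodMk hu)
    convert! this using 1
    exact add_comm _ _
  simp only [mulH_apply] at h2
  rw [bess_lift2 hz', bess_lift2 (hz t ht)] at h2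
  exact h2.congr (fun t ht => by rw [bess_lift2 (hz t ht)]) (by rw [bess_lift2 (hz t ht)])

/-- A function that is continuous in `L²` and bounded in `H³` is continuous in `H²`. -/
theorem continuousOn_lift2 {u : ℝ → L2 d} {s : Set ℝ} (hu : ContinuousOn u s) {C : ℝ≥0}
    (hC : ∀ t ∈ s, wn (jb 3) (u t) ≤ C) : ContinuousOn (fun t => lift2 (u t)) s := by
  have hj := measurable_jb (d := d)
  let a : ℕ → Space d → ℝ := fun n ξ => if jb 1 ξ ≤ n then jb 2 ξ else 0
  have ham : ∀ n, Measurable (a n) := fun n =>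
    Measurable.ite (measurableSet_le (hj 1) measurable_const) (hj 2) measurable_const
  have ha : ∀ n, MemLp (fun ξ => (a n ξ : ℂ)) ∞ volume := fun n => by
    refine memLp_top_of_le (Complex.measurable_ofReal.comp (ham n)) (C := n ^ 2) fun ξ => ?_
    rw [Complex.norm_real]
    simp only [a]
    split_ifs with h
    · rw [Real.norm_of_nonneg (jb_pos _ _).le, show (2 : ℝ) = 1 + 1 by norm_num, jb_add, ← sq]
      exact pow_le_pow_left₀ (jb_pos _ _).le h 2
    · simp
  have hlim : TendstoUniformlyOn (fun n t => mulOp (fun ξ => (a n ξ : ℂ)) (ft (u t)))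
      (fun t => lift2 (u t)) atTop s := by
    rw [Metric.tendstoUniformlyOn_iff]
    intro ε hε
    filter_upwards [eventually_gt_atTop ⌈(C : ℝ) / ε⌉₊] with n hn t ht
    have hn' : (C : ℝ) / ε < n := (Nat.le_ceil _).trans_lt (by exact_mod_cast hn)
    have hn0 : (0 : ℝ) < n := lt_of_le_of_lt (by positivity) hn'
    have h2 : wn (jb 2) (u t) < ∞ :=
      wn_jb_lt_top_mono (by norm_num) ((hC t ht).trans_lt ENNReal.coe_lt_top)
    rw [dist_eq_norm]
    have hle : ‖lift2 (u t) - mulOp (fun ξ => (a n ξ : ℂ)) (ft (u t))‖ₑ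
        ≤ ENNReal.ofReal (n : ℝ)⁻¹ * wn (jb 3) (u t) := by
      rw [Lp.enorm_def, wn]
      refine eLpNorm_le_mul_eLpNorm_of_ae_le_mul ?_ 2
      filter_upwards [Lp.coeFn_sub (lift2 (u t)) (mulOp (fun ξ => (a n ξ : ℂ)) (ft (u t))),
        coeFn_lift2 h2, coeFn_mulOp (ha n) (ft (u t))] with ξ e1 e2 e3
      rw [e1, Pi.sub_apply, e2, e3, ← sub_mul, norm_mul, norm_mul, ← mul_assoc,
        ← Complex.ofReal_sub, Complex.norm_real, Complex.norm_real,
        Real.norm_of_nonneg (jb_pos _ _).le]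
      refine mul_le_mul_of_nonneg_right ?_ (norm_nonneg _)
      simp only [a]
      split_ifs with h
      · simp only [sub_self, norm_zero]; exact mul_nonneg (by positivity) (jb_pos _ _).le
      · rw [sub_zero, Real.norm_of_nonneg (jb_pos _ _).le, le_inv_mul_iff₀ hn0,
          show (3 : ℝ) = 1 + 2 by norm_num, jb_add]
        exact mul_le_mul_of_nonneg_right (not_le.1 h).le (jb_pos _ _).le
    have h3 : ‖lift2 (u t) - mulOp (fun ξ => (a n ξ : ℂ)) (ft (u t))‖ ≤ (n : ℝ)⁻¹ * C := by
      have h4 := hle.trans (mul_le_mul_right (hC t ht) _)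
      rw [← ofReal_norm, ← ENNReal.ofReal_coe_nnreal, ← ENNReal.ofReal_mul (by positivity),
        ENNReal.ofReal_le_ofReal_iff (by positivity)] at h4
      exact h4
    refine h3.trans_lt ?_
    rw [inv_mul_lt_iff₀ hn0, mul_comm]
    rwa [div_lt_iff₀ hε, mul_comm] at hn'
  exact hlim.continuousOn (Frequently.of_forall fun n =>
    ((mulOp _).continuous.comp ft.continuous).comp_continuousOn hu)

/-- Differentiability in `L²` improves to differentiability in `H²` if the derivative is bounded in
`H³`. -/
theorem hasDerivWithinAt_lift2 {T : ℝ} (hT : 0 < T) {u u' : ℝ → L2 d}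
    (hu : ∀ t ∈ Icc 0 T, HasDerivWithinAt u (u' t) (Icc 0 T) t) (hc : ContinuousOn u' (Icc 0 T))
    {C : ℝ≥0} (h : ∀ t ∈ Icc 0 T, wn (jb 2) (u t) < ∞) (h' : ∀ t ∈ Icc 0 T, wn (jb 3) (u' t) ≤ C) :
    ∀ t ∈ Icc 0 T, HasDerivWithinAt (fun t => lift2 (u t)) (lift2 (u' t)) (Icc 0 T) t := by
  have h2 : ∀ t ∈ Icc 0 T, wn (jb 2) (u' t) < ∞ := fun t ht =>
    wn_jb_lt_top_mono (by norm_num) ((h' t ht).trans_lt ENNReal.coe_lt_top)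
  exact hasDerivWithinAt_of_comp_injective hT (S := bess.restrictScalars ℝ) bess_injective hu
    (fun t ht => (bess_lift2 (h t ht)).symm) (fun t ht => (bess_lift2 (h2 t ht)).symm)
    (continuousOn_lift2 hc h')

/-! ### The Schrödinger profile -/

/-- The Laplacian on `H²`, as a bounded operator acting on the `L²` functions `⟨ξ⟩² û`. -/
noncomputable def lapL : L2 d →L[ℂ] L2 d :=
  ftInv.comp (mulOp fun ξ => ((-(lam ξ * jb (-2) ξ) : ℝ) : ℂ))

theorem measurable_lam : Measurable (lam : Space d → ℝ) := continuous_lam.measurable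

theorem lam_nonneg (ξ : Space d) : 0 ≤ lam ξ := sq_nonneg _

theorem lam_le_jb_two (ξ : Space d) : lam ξ ≤ (2 * Real.pi) ^ 2 * jb 2 ξ := by
  rw [lam, mul_pow, jb_two]
  gcongr
  linarith

theorem jb_mul_jb_neg (s : ℝ) (ξ : Space d) : jb s ξ * jb (-s) ξ = 1 := by
  rw [← jb_add]; simp

theorem memLp_top_lapL : MemLp (fun ξ : Space d => ((-(lam ξ * jb (-2) ξ) : ℝ) : ℂ)) ∞ volume := by
  refine memLp_top_of_le (Complex.measurable_ofReal.comp
    (measurable_lam.mul (measurable_jb _)).neg) (C := (2 * Real.pi) ^ 2) fun ξ => ?_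
  rw [Complex.norm_real, norm_neg, Real.norm_of_nonneg (mul_nonneg (lam_nonneg _) (jb_pos _ _).le)]
  calc _ ≤ (2 * Real.pi) ^ 2 * jb 2 ξ * jb (-2) ξ :=
        mul_le_mul_of_nonneg_right (lam_le_jb_two ξ) (jb_pos _ _).le
    _ = _ := by rw [mul_assoc, jb_mul_jb_neg, mul_one]

theorem ft_lapL {f : L2 d} (h : wn (jb 2) f < ∞) :
    ft (lapL (lift2 f)) =ᵐ[volume] fun ξ => -(lam ξ : ℂ) * ft f ξ := by
  rw [lapL, ContinuousLinearMap.comp_apply, ft_ftInv]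
  filter_upwards [coeFn_mulOp memLp_top_lapL (lift2 f), coeFn_lift2 h] with ξ h1 h2
  rw [h1, h2]
  have := jb_two_mul_neg_two ξ
  push_cast
  linear_combination (-(lam ξ : ℂ) * ft f ξ) * this

/-- The operator norm of the Laplacian from `H^{s+2}` to `H^s`. -/
noncomputable def lapC : ℝ≥0 := (2 * Real.toNNReal Real.pi) ^ 2

theorem coe_lapC : (lapC : ℝ) = (2 * Real.pi) ^ 2 := by
  simp [lapC, Real.coe_toNNReal _ Real.pi_pos.le]

theorem wn_lam_le (s : ℝ) {f g : L2 d} (h : ft g =ᵐ[volume] fun ξ => -(lam ξ : ℂ) * ft f ξ) :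
    wn (jb s) g ≤ lapC * wn (jb (s + 2)) f := by
  rw [← ENNReal.ofReal_coe_nnreal, coe_lapC]
  refine wn_le_of_ae ?_
  filter_upwards [h] with ξ hξ
  rw [hξ, norm_mul, norm_neg, Complex.norm_real, Real.norm_of_nonneg (lam_nonneg _),
    abs_of_pos (jb_pos _ _), abs_of_pos (jb_pos _ _), jb_add]
  have h1 := lam_le_jb_two ξ
  have h2 : 0 ≤ jb s ξ * ‖ft f ξ‖ := mul_nonneg (jb_pos _ _).le (norm_nonneg _)
  nlinarith

theorem wn_lapL_le (s : ℝ) {f : L2 d} (h : wn (jb 2) f < ∞) :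
    wn (jb s) (lapL (lift2 f)) ≤ lapC * wn (jb (s + 2)) f := wn_lam_le s (ft_lapL h)

theorem continuousOn_pm (hd : d ≤ 3) {z u : ℝ → L2 d} {s : Set ℝ}
    (hz : ∀ t ∈ s, wn (jb 2) (z t) < ∞)
    (h : ContinuousOn (fun t => lift2 (z t)) s) (hu : ContinuousOn u s) :
    ContinuousOn (fun t => pm (z t) (u t)) s := by
  have h1 : ContinuousOn (fun t => mulH hd (lift2 (z t)) (u t)) s :=
    ((mulH hd).continuous.comp_continuousOn h).clm_apply hu
  refine h1.congr fun t ht => ?_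
  simp only [mulH_apply, bess_lift2 (hz t ht)]

/-- A density `φ` satisfying the a priori bounds, with its first two time derivatives, and a
solution `z` of the Schrödinger equation with the potential `φ`. The functions `φ1`, `φ2` and `z1`
are time derivatives. -/
structure ProfileData (m : ℕ) (T γ : ℝ) (M : ℝ≥0) (φ φ1 φ2 z z1 : ℝ → L2 d) : Prop where
  hT : 0 < T
  hγ : 0 < γ
  hγ1 : γ ≤ 1
  dφ : ∀ t ∈ Icc 0 T, HasDerivWithinAt φ (φ1 t) (Icc 0 T) t
  dφ1 : ∀ t ∈ Icc 0 T, HasDerivWithinAt φ1 (φ2 t) (Icc 0 T) t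
  cφ2 : ContinuousOn φ2 (Icc 0 T)
  dz : ∀ t ∈ Icc 0 T, HasDerivWithinAt z (z1 t) (Icc 0 T) t
  cz1 : ContinuousOn z1 (Icc 0 T)
  eq : ∀ t ∈ Icc 0 T, ft ((2 * Complex.I) • z1 t + pm (φ t) (z t))
    =ᵐ[volume] fun ξ => -(lam ξ : ℂ) * ft (z t) ξ
  bφ : ∀ t ∈ Icc 0 T, wn (jb (m + 6)) (φ t) ≤ M
  bφ1 : ∀ t ∈ Icc 0 T, ENNReal.ofReal γ * wn (jb (m + 2)) (φ1 t) ≤ M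
  bφ2 : ∀ t ∈ Icc 0 T, ENNReal.ofReal (γ ^ 2) * wn (jb m) (φ2 t) ≤ M
  bz0 : wn (jb (m + 6)) (z 0) ≤ M

/-- The constant of the Gronwall estimate for the Schrödinger equation. -/
noncomputable def gK (T : ℝ) (M A B : ℝ≥0) : ℝ≥0 :=
  Real.toNNReal (Real.sqrt ((M ^ 2 + A ^ 2 * T) * Real.exp ((4 * B + 1) * T)))

theorem memLp_top_rwt (s : ℝ) (N : ℕ) : MemLp (fun ξ : Space d => (rwt s N ξ : ℂ)) ∞ volume := by
  refine memLp_top_of_le (Complex.measurable_ofReal.comp (measurable_rwt s N)) (C := N) fun ξ => ?_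
  rw [Complex.norm_real, Real.norm_of_nonneg (rwt_nonneg _ _ _)]
  have h := rwt_mul_jb_two_le s N ξ
  have h1 := one_le_jb (s := 2) (by norm_num) ξ
  nlinarith [rwt_nonneg s N ξ]

section Profile

variable {m : ℕ} {T γ : ℝ} {M : ℝ≥0} {φ φ1 φ2 z z1 : ℝ → L2 d}

theorem ProfileData.zero_mem (h : ProfileData m T γ M φ φ1 φ2 z z1) : (0 : ℝ) ∈ Icc 0 T :=
  ⟨le_rfl, h.hT.le⟩

theorem ProfileData.wn_φ_lt_top (h : ProfileData m T γ M φ φ1 φ2 z z1) {s : ℝ} (hs : s ≤ m + 6)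
    {t : ℝ} (ht : t ∈ Icc 0 T) : wn (jb s) (φ t) < ∞ :=
  wn_jb_lt_top_mono hs ((h.bφ t ht).trans_lt ENNReal.coe_lt_top)

/-- The energy estimate for the Schrödinger equation with a bounded weight: the Laplacian does not
contribute. -/
theorem ProfileData.wn_rwt_le (h : ProfileData m T γ M φ φ1 φ2 z z1) {s : ℝ} (hs : s ≤ m + 6)
    (N : ℕ) {A B : ℝ≥0}
    (hAB : ∀ t ∈ Icc 0 T, wn (rwt s N) (pm (φ t) (z t)) ≤ A + B * wn (rwt s N) (z t)) :
    ∀ t ∈ Icc 0 T, wn (rwt s N) (z t) ≤ gK T M A B := by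
  set W : L2 d →L[ℂ] L2 d := mulOp fun ξ => (rwt s N ξ : ℂ) with hW
  have hWe : ∀ f, ‖W (ft f)‖ₑ = wn (rwt s N) f := enorm_mulOp_ft (memLp_top_rwt s N)
  set Y : ℝ → L2 d := fun t => W (ft (z t)) with hY
  have hYd : ∀ t ∈ Icc 0 T, HasDerivWithinAt Y (W (ft (z1 t))) (Icc 0 T) t := fun t ht =>
    hasDerivWithinAt_clm (W.comp ft) (h.dz t ht)
  have hYG : ∀ t ∈ Icc 0 T, ∃ (σ : Space d → ℝ) (G : L2 d),
      (W (ft (z1 t)) =ᵐ[volume] fun ξ => Complex.I * σ ξ * Y t ξ + G ξ) ∧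
        ‖G‖ ≤ A + B * (‖Y t‖ + ‖Y t‖) := by
    intro t ht
    refine ⟨fun ξ => lam ξ / 2, (Complex.I / 2) • W (ft (pm (φ t) (z t))), ?_, ?_⟩
    · have e := h.eq t ht
      rw [map_add, map_smul] at e
      filter_upwards [e, coeFn_mulOp (memLp_top_rwt s N) (ft (z1 t)),
        coeFn_mulOp (memLp_top_rwt s N) (ft (z t)),
        coeFn_mulOp (memLp_top_rwt s N) (ft (pm (φ t) (z t))),
        Lp.coeFn_smul (Complex.I / 2) (W (ft (pm (φ t) (z t)))),
        Lp.coeFn_add ((2 * Complex.I) • ft (z1 t)) (ft (pm (φ t) (z t))),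
        Lp.coeFn_smul (2 * Complex.I) (ft (z1 t))] with ξ e1 e2 e3 e4 e5 e6 e7
      rw [e6, Pi.add_apply, e7, Pi.smul_apply, smul_eq_mul] at e1
      simp only [hY]
      rw [e5, Pi.smul_apply, smul_eq_mul, hW, e2, e3, e4]
      push_cast
      linear_combination (-(Complex.I / 2) * (rwt s N ξ : ℂ)) * e1
        + (rwt s N ξ : ℂ) * ft (z1 t) ξ * Complex.I_sq
    · have h1 := hAB t ht
      rw [← hWe, ← hWe] at h1
      have h2 : ‖W (ft (pm (φ t) (z t)))‖₊ ≤ A + B * ‖Y t‖₊ := by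
        simp only [enorm_eq_nnnorm] at h1
        exact_mod_cast h1
      have h3 : ‖W (ft (pm (φ t) (z t)))‖ ≤ A + B * ‖Y t‖ := by exact_mod_cast h2
      rw [norm_smul]
      have h4 : ‖Complex.I / 2‖ ≤ 1 := by simp; norm_num
      have hB := B.coe_nonneg
      nlinarith [norm_nonneg (Y t), norm_nonneg (W (ft (pm (φ t) (z t)))),
        mul_nonneg hB (norm_nonneg (Y t))]
  intro t ht
  have h1 := energy_pair B.coe_nonneg hYd hYd hYG hYG t ht
  have h0 : ‖Y 0‖ ≤ M := by
    have h2 : wn (rwt s N) (z 0) ≤ M :=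
      (wn_mono (fun ξ => by
        rw [abs_of_nonneg (rwt_nonneg _ _ _), abs_of_pos (jb_pos _ _)]
        exact (rwt_le_jb s N ξ).trans (jb_mono hs ξ)) (z 0)).trans h.bz0
    rw [← hWe, enorm_eq_nnnorm] at h2
    exact_mod_cast h2
  have h5 : ‖Y t‖ ^ 2 ≤ (M ^ 2 + A ^ 2 * T) * Real.exp ((4 * B + 1) * T) := by
    have h6 : ‖Y 0‖ ^ 2 ≤ (M : ℝ) ^ 2 := pow_le_pow_left₀ (norm_nonneg _) h0 2
    have h7 := Real.exp_pos ((4 * B + 1) * T)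
    nlinarith
  rw [← hWe, enorm_eq_nnnorm, ENNReal.coe_le_coe, gK, ← NNReal.coe_le_coe, coe_nnnorm,
    Real.coe_toNNReal _ (Real.sqrt_nonneg _)]
  exact Real.le_sqrt_of_sq_le h5

/-- The bound of the profile in `H²`. -/
noncomputable def zC2 (d : ℕ) (T : ℝ) (M : ℝ≥0) : ℝ≥0 := gK T M 0 (pC d 2 * M)

theorem ProfileData.wn_two_le (hd : d ≤ 3) (h : ProfileData m T γ M φ φ1 φ2 z z1) :
    ∀ t ∈ Icc 0 T, wn (jb 2) (z t) ≤ zC2 d T M := by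
  intro t ht
  refine wn_jb_le_of_rwt fun N => ?_
  refine h.wn_rwt_le (by linarith [(Nat.cast_nonneg m : (0 : ℝ) ≤ m)]) N (fun t ht => ?_) t ht
  have h6 : (2 : ℝ) + 4 ≤ m + 6 := by linarith [(Nat.cast_nonneg m : (0 : ℝ) ≤ m)]
  refine (wn_rwt_pm_le_peetre hd (by norm_num) N (h.wn_φ_lt_top h6 ht)).trans ?_
  have h7 := (wn_jb_mono h6 (φ t)).trans (h.bφ t ht)
  push_cast
  rw [zero_add]
  gcongr

/-- The bound of the profile in `H^{m+6}`. -/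
noncomputable def zC (d m : ℕ) (T : ℝ) (M : ℝ≥0) : ℝ≥0 :=
  gK T M (pC d (m + 6) * (M * (kemb d * zC2 d T M))) (pC d (m + 6) * (kemb d * M))

theorem ProfileData.wn_z_le (hd : d ≤ 3) (h : ProfileData m T γ M φ φ1 φ2 z z1) :
    ∀ t ∈ Icc 0 T, wn (jb (m + 6)) (z t) ≤ zC d m T M := by
  intro t ht
  have hm := (Nat.cast_nonneg m : (0 : ℝ) ≤ m)
  refine wn_jb_le_of_rwt fun N => ?_
  refine h.wn_rwt_le le_rfl N (fun t ht => ?_) t ht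
  have h2 : wn (jb 2) (φ t) < ∞ := h.wn_φ_lt_top (by linarith) ht
  refine (wn_rwt_pm_le_tame (by linarith) N (w1_one_lt_top hd h2)).trans ?_
  have h3 : w1 1 (z t) ≤ kemb d * zC2 d T M :=
    (w1_one_le hd _).trans (by gcongr; exact h.wn_two_le hd t ht)
  have h4 : w1 1 (φ t) ≤ kemb d * M :=
    (w1_one_le hd _).trans (by
      gcongr
      exact (wn_jb_mono (by linarith) _).trans (h.bφ t ht))
  have h5 := h.bφ t ht
  push_cast
  calc _ ≤ (pC d (m + 6) : ℝ≥0∞) * (M * (kemb d * zC2 d T M)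
        + kemb d * M * wn (rwt (m + 6) N) (z t)) := by gcongr
    _ = _ := by ring

theorem ProfileData.wn_z_lt_top (hd : d ≤ 3) (h : ProfileData m T γ M φ φ1 φ2 z z1) {s : ℝ}
    (hs : s ≤ m + 6) {t : ℝ} (ht : t ∈ Icc 0 T) : wn (jb s) (z t) < ∞ :=
  wn_jb_lt_top_mono hs ((h.wn_z_le hd t ht).trans_lt ENNReal.coe_lt_top)

theorem enorm_two_I_inv_le : ‖(2 * Complex.I)⁻¹‖ₑ ≤ 1 := by
  rw [← ofReal_norm]
  simp

theorem wn_smul_le_of_le_one {c : ℂ} (hc : ‖c‖ₑ ≤ 1) (W : Space d → ℝ) (f : L2 d) :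
    wn W (c • f) ≤ wn W f := by
  rw [wn_smul]
  exact mul_le_of_le_one_left' hc

theorem ProfileData.z1_eq (hd : d ≤ 3) (h : ProfileData m T γ M φ φ1 φ2 z z1) {t : ℝ}
    (ht : t ∈ Icc 0 T) :
    z1 t = (2 * Complex.I)⁻¹ • (lapL (lift2 (z t)) - pm (z t) (φ t)) := by
  have h2 : wn (jb 2) (z t) < ∞ :=
    h.wn_z_lt_top hd (by linarith [(Nat.cast_nonneg m : (0 : ℝ) ≤ m)]) ht
  have e : lapL (lift2 (z t)) = (2 * Complex.I) • z1 t + pm (φ t) (z t) := by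
    apply ft_injective
    exact Lp.ext ((ft_lapL h2).trans (h.eq t ht).symm)
  rw [e, pm_comm (z t), add_sub_cancel_right, smul_smul, inv_mul_cancel₀ (by simp), one_smul]

/-- The bound of the time derivative of the profile in `H^{m+4}`. -/
noncomputable def zC1 (d m : ℕ) (T : ℝ) (M : ℝ≥0) : ℝ≥0 :=
  lapC * zC d m T M + pC d (m + 4) * M * zC d m T M

theorem ProfileData.wn_z1_le (hd : d ≤ 3) (h : ProfileData m T γ M φ φ1 φ2 z z1) :
    ∀ t ∈ Icc 0 T, wn (jb (m + 4)) (z1 t) ≤ zC1 d m T M := by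
  intro t ht
  have hm := (Nat.cast_nonneg m : (0 : ℝ) ≤ m)
  have e6 : (m + 4 + 2 : ℝ) = m + 6 := by ring
  rw [h.z1_eq hd ht]
  refine (wn_smul_le_of_le_one enorm_two_I_inv_le _ _).trans
    ((wn_sub_le (measurable_jb _) _ _).trans ?_)
  have h1 := wn_lapL_le (m + 4) (h.wn_z_lt_top hd (s := 2) (by linarith) ht)
  have h2 := wn_pm_le_peetre hd (s := m + 4) (by linarith) (g := z t)
    (h.wn_φ_lt_top (s := m + 4 + 2) (by linarith) ht)
  rw [e6] at h1 h2
  have h3 := h.wn_z_le hd t ht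
  have h4 := h.bφ t ht
  have h5 : wn (jb (m + 4)) (z t) ≤ zC d m T M := (wn_jb_mono (by linarith) _).trans h3
  rw [pm_comm (z t)]
  unfold zC1
  push_cast
  calc _ ≤ (lapC : ℝ≥0∞) * wn (jb (m + 6)) (z t)
        + pC d (m + 4) * wn (jb (m + 6)) (φ t) * wn (jb (m + 4)) (z t) := add_le_add h1 h2
    _ ≤ _ := by gcongr

theorem le_div_of_ofReal_mul_le {γ : ℝ} (hγ : 0 < γ) {x : ℝ≥0∞} {C : ℝ≥0}
    (h : ENNReal.ofReal γ * x ≤ C) : x ≤ (C / γ.toNNReal : ℝ≥0) := by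
  rw [ENNReal.coe_div (by simpa using hγ), ENNReal.le_div_iff_mul_le (by simp [hγ]) (by simp),
    mul_comm]
  exact h

theorem ofReal_le_one_of_le {γ : ℝ} (h : γ ≤ 1) : ENNReal.ofReal γ ≤ 1 := by simpa using h

/-- Regularity and bounds of the profile: its time derivatives are obtained by differentiating the
Schrödinger equation, which is possible since `z` is differentiable with values in `H²`. -/
theorem profile_bounds (d m : ℕ) (hd : d ≤ 3) (hm : 1 ≤ m) (T : ℝ) (M : ℝ≥0) :
    ∃ C : ℝ≥0, ∀ (γ : ℝ) (φ φ1 φ2 z z1 : ℝ → L2 d), ProfileData m T γ M φ φ1 φ2 z z1 →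
      ∃ z2 z3 : ℝ → L2 d,
        (∀ t ∈ Icc 0 T, HasDerivWithinAt z1 (z2 t) (Icc 0 T) t) ∧
        (∀ t ∈ Icc 0 T, HasDerivWithinAt z2 (z3 t) (Icc 0 T) t) ∧ ContinuousOn z3 (Icc 0 T) ∧
        (∀ t ∈ Icc 0 T, HasDerivWithinAt (fun t => lift2 (z t)) (lift2 (z1 t)) (Icc 0 T) t) ∧
        (∀ t ∈ Icc 0 T, HasDerivWithinAt (fun t => lift2 (z1 t)) (lift2 (z2 t)) (Icc 0 T) t) ∧
        (∀ t ∈ Icc 0 T, ft ((2 * Complex.I) • z2 t + pm (z1 t) (φ t) + pm (z t) (φ1 t))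
          =ᵐ[volume] fun ξ => -(lam ξ : ℂ) * ft (z1 t) ξ) ∧
        ∀ t ∈ Icc 0 T, wn (jb (m + 6)) (z t) ≤ C ∧ wn (jb (m + 4)) (z1 t) ≤ C ∧
          ENNReal.ofReal γ * wn (jb (m + 2)) (z2 t) ≤ C ∧
          ENNReal.ofReal (γ ^ 2) * wn (jb m) (z3 t) ≤ C := by
  have hm0 : (1 : ℝ) ≤ m := by exact_mod_cast hm
  set C0 := zC d m T M with hC0
  set C1 := zC1 d m T M with hC1
  set C2 : ℝ≥0 := lapC * C1 + pC d (m + 2) * M * C1 + pC d (m + 2) * C0 * M with hC2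
  set C3 : ℝ≥0 := lapC * C2 + pC d m * M * C2 + (pC d m * C1 * M + pC d m * C1 * M
    + pC d m * C0 * M) with hC3
  refine ⟨C0 + C1 + C2 + C3, fun γ φ φ1 φ2 z z1 h => ?_⟩
  have hT := h.hT
  have bz := h.wn_z_le hd
  have bz1 := h.wn_z1_le hd
  have fz : ∀ t ∈ Icc 0 T, ∀ s : ℝ, s ≤ m + 6 → wn (jb s) (z t) < ∞ := fun t ht s hs =>
    h.wn_z_lt_top hd hs ht
  have fz1 : ∀ t ∈ Icc 0 T, ∀ s : ℝ, s ≤ m + 4 → wn (jb s) (z1 t) < ∞ := fun t ht s hs =>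
    wn_jb_lt_top_mono hs ((bz1 t ht).trans_lt ENNReal.coe_lt_top)
  have hγ1 := ofReal_le_one_of_le h.hγ1
  have cφ : ContinuousOn φ (Icc 0 T) := fun t ht => (h.dφ t ht).continuousWithinAt
  have cφ1 : ContinuousOn φ1 (Icc 0 T) := fun t ht => (h.dφ1 t ht).continuousWithinAt
  have dZ : ∀ t ∈ Icc 0 T,
      HasDerivWithinAt (fun t => lift2 (z t)) (lift2 (z1 t)) (Icc 0 T) t :=
    hasDerivWithinAt_lift2 hT h.dz h.cz1 (fun t ht => fz t ht 2 (by linarith))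
      fun t ht => (wn_jb_mono (by linarith) _).trans (bz1 t ht)
  have cZ1 : ContinuousOn (fun t => lift2 (z1 t)) (Icc 0 T) :=
    continuousOn_lift2 h.cz1 fun t ht => (wn_jb_mono (by linarith) _).trans (bz1 t ht)
  set z2 : ℝ → L2 d := fun t => (2 * Complex.I)⁻¹ •
    (lapL (lift2 (z1 t)) - (pm (z1 t) (φ t) + pm (z t) (φ1 t))) with hz2
  have d1 : ∀ t ∈ Icc 0 T, HasDerivWithinAt z1 (z2 t) (Icc 0 T) t := by
    intro t ht
    have h1 := hasDerivWithinAt_pm hd ht (fun t ht => fz t ht 2 (by linarith))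
      (fz1 t ht 2 (by linarith)) (dZ t ht) (h.dφ t ht)
    have h2 := (((hasDerivWithinAt_clm lapL (dZ t ht)).sub h1).const_smul (2 * Complex.I)⁻¹)
    exact h2.congr (fun t ht => h.z1_eq hd ht) (h.z1_eq hd ht)
  have cz2 : ContinuousOn z2 (Icc 0 T) := by
    have c1 := continuousOn_pm hd (fun t ht => fz1 t ht 2 (by linarith)) cZ1 cφ
    have c2 := continuousOn_pm hd (fun t ht => fz t ht 2 (by linarith))
        (fun t ht => (dZ t ht).continuousWithinAt) cφ1
    exact ((lapL.continuous.comp_continuousOn cZ1).sub (c1.add c2)).const_smul (2 * Complex.I)⁻¹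
  have eq2 : ∀ t ∈ Icc 0 T, lapL (lift2 (z1 t))
      = (2 * Complex.I) • z2 t + pm (z1 t) (φ t) + pm (z t) (φ1 t) := by
    intro t ht
    rw [hz2, smul_smul, mul_inv_cancel₀ (by simp), one_smul]; abel
  have bz2 : ∀ t ∈ Icc 0 T, ENNReal.ofReal γ * wn (jb (m + 2)) (z2 t) ≤ C2 := by
    intro t ht
    have e4 : (m + 2 + 2 : ℝ) = m + 4 := by ring
    have h1 := wn_lapL_le (m + 2) (fz1 t ht 2 (by linarith))
    have h2 := wn_pm_le_peetre hd (s := m + 2) (by linarith) (g := z1 t)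
      (h.wn_φ_lt_top (s := m + 2 + 2) (by linarith) ht)
    have h3 := wn_pm_le_peetre hd (s := m + 2) (by linarith) (g := φ1 t)
      (fz t ht (m + 2 + 2) (by linarith))
    rw [e4] at h1 h2 h3
    have h4 : wn (jb (m + 2)) (z2 t) ≤ lapC * wn (jb (m + 4)) (z1 t)
        + (pC d (m + 2) * wn (jb (m + 4)) (φ t) * wn (jb (m + 2)) (z1 t)
          + pC d (m + 2) * wn (jb (m + 4)) (z t) * wn (jb (m + 2)) (φ1 t)) := by
      refine (wn_smul_le_of_le_one enorm_two_I_inv_le _ _).trans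
        ((wn_sub_le (measurable_jb _) _ _).trans (add_le_add h1
          ((wn_add_le (measurable_jb _) _ _).trans (add_le_add ?_ h3))))
      rw [pm_comm]; exact h2
    have b1 := bz1 t ht
    have b2 : wn (jb (m + 2)) (z1 t) ≤ C1 := (wn_jb_mono (by linarith) _).trans b1
    have b3 : wn (jb (m + 4)) (φ t) ≤ M := (wn_jb_mono (by linarith) _).trans (h.bφ t ht)
    have b4 : wn (jb (m + 4)) (z t) ≤ C0 := (wn_jb_mono (by linarith) _).trans (bz t ht)
    have b5 := h.bφ1 t ht
    calc _ ≤ ENNReal.ofReal γ * (lapC * C1 + (pC d (m + 2) * M * C1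
          + pC d (m + 2) * C0 * wn (jb (m + 2)) (φ1 t))) := by
          gcongr; refine h4.trans ?_; gcongr
      _ = ENNReal.ofReal γ * (lapC * C1 + pC d (m + 2) * M * C1)
          + pC d (m + 2) * C0 * (ENNReal.ofReal γ * wn (jb (m + 2)) (φ1 t)) := by ring
      _ ≤ 1 * (lapC * C1 + pC d (m + 2) * M * C1) + pC d (m + 2) * C0 * M := by gcongr
      _ = _ := by rw [hC2]; push_cast; ring
  have bz2' : ∀ t ∈ Icc 0 T, wn (jb (m + 2)) (z2 t) ≤ (C2 / γ.toNNReal : ℝ≥0) := fun t ht =>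
    le_div_of_ofReal_mul_le h.hγ (bz2 t ht)
  have fz2 : ∀ t ∈ Icc 0 T, ∀ s : ℝ, s ≤ m + 2 → wn (jb s) (z2 t) < ∞ := fun t ht s hs =>
    wn_jb_lt_top_mono hs ((bz2' t ht).trans_lt ENNReal.coe_lt_top)
  have dZ1 : ∀ t ∈ Icc 0 T,
      HasDerivWithinAt (fun t => lift2 (z1 t)) (lift2 (z2 t)) (Icc 0 T) t :=
    hasDerivWithinAt_lift2 hT d1 cz2 (fun t ht => fz1 t ht 2 (by linarith))
      fun t ht => (wn_jb_mono (by linarith) _).trans (bz2' t ht)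
  have cZ2 : ContinuousOn (fun t => lift2 (z2 t)) (Icc 0 T) :=
    continuousOn_lift2 cz2 fun t ht => (wn_jb_mono (by linarith) _).trans (bz2' t ht)
  set z3 : ℝ → L2 d := fun t => (2 * Complex.I)⁻¹ • (lapL (lift2 (z2 t))
    - ((pm (z2 t) (φ t) + pm (z1 t) (φ1 t)) + (pm (z1 t) (φ1 t) + pm (z t) (φ2 t)))) with hz3
  have d2 : ∀ t ∈ Icc 0 T, HasDerivWithinAt z2 (z3 t) (Icc 0 T) t := by
    intro t ht
    have h1 := hasDerivWithinAt_pm hd ht (fun t ht => fz1 t ht 2 (by linarith))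
      (fz2 t ht 2 (by linarith)) (dZ1 t ht) (h.dφ t ht)
    have h2 := hasDerivWithinAt_pm hd ht (fun t ht => fz t ht 2 (by linarith))
      (fz1 t ht 2 (by linarith)) (dZ t ht) (h.dφ1 t ht)
    exact (((hasDerivWithinAt_clm lapL (dZ1 t ht)).sub (h1.add h2)).const_smul (2 * Complex.I)⁻¹)
  have cz3 : ContinuousOn z3 (Icc 0 T) := by
    have c1 := continuousOn_pm hd (fun t ht => fz2 t ht 2 (by linarith)) cZ2 cφ
    have c2 := continuousOn_pm hd (fun t ht => fz1 t ht 2 (by linarith)) cZ1 cφ1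
    have c3 := continuousOn_pm hd (fun t ht => fz t ht 2 (by linarith))
        (fun t ht => (dZ t ht).continuousWithinAt) h.cφ2
    exact ((lapL.continuous.comp_continuousOn cZ2).sub ((c1.add c2).add (c2.add c3))).const_smul
      (2 * Complex.I)⁻¹
  have bz3 : ∀ t ∈ Icc 0 T, ENNReal.ofReal (γ ^ 2) * wn (jb m) (z3 t) ≤ C3 := by
    intro t ht
    have h1 := wn_lapL_le m (fz2 t ht 2 (by linarith))
    have h2 := wn_pm_le_peetre hd (s := m) (by linarith) (g := z2 t)
      (h.wn_φ_lt_top (s := m + 2) (by linarith) ht)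
    have h3 := wn_pm_le_peetre hd (s := m) (by linarith) (g := φ1 t)
      (fz1 t ht (m + 2) (by linarith))
    have h3' := wn_pm_le_peetre hd (s := m) (by linarith) (g := φ2 t)
      (fz t ht (m + 2) (by linarith))
    have h4 : wn (jb m) (z3 t) ≤ lapC * wn (jb (m + 2)) (z2 t)
        + ((pC d m * wn (jb (m + 2)) (φ t) * wn (jb m) (z2 t)
          + pC d m * wn (jb (m + 2)) (z1 t) * wn (jb m) (φ1 t))
          + (pC d m * wn (jb (m + 2)) (z1 t) * wn (jb m) (φ1 t)
          + pC d m * wn (jb (m + 2)) (z t) * wn (jb m) (φ2 t))) := by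
      refine (wn_smul_le_of_le_one enorm_two_I_inv_le _ _).trans
        ((wn_sub_le (measurable_jb _) _ _).trans (add_le_add h1
          ((wn_add_le (measurable_jb _) _ _).trans (add_le_add
            ((wn_add_le (measurable_jb _) _ _).trans (add_le_add ?_ h3))
            ((wn_add_le (measurable_jb _) _ _).trans (add_le_add h3 h3'))))))
      rw [pm_comm]; exact h2
    have b0 : wn (jb m) (z2 t) ≤ wn (jb (m + 2)) (z2 t) := wn_jb_mono (by linarith) _
    have b1 : wn (jb (m + 2)) (z1 t) ≤ C1 := (wn_jb_mono (by linarith) _).trans (bz1 t ht)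
    have b3 : wn (jb (m + 2)) (φ t) ≤ M := (wn_jb_mono (by linarith) _).trans (h.bφ t ht)
    have b4 : wn (jb (m + 2)) (z t) ≤ C0 := (wn_jb_mono (by linarith) _).trans (bz t ht)
    have b5 : ENNReal.ofReal γ * wn (jb m) (φ1 t) ≤ M :=
      (mul_le_mul_right (wn_jb_mono (by linarith) _) _).trans (h.bφ1 t ht)
    have b6 := h.bφ2 t ht
    have b7 := bz2 t ht
    have eγ : ENNReal.ofReal (γ ^ 2) = ENNReal.ofReal γ * ENNReal.ofReal γ := by
      rw [sq, ENNReal.ofReal_mul h.hγ.le]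
    calc _ ≤ ENNReal.ofReal (γ ^ 2) * (lapC * wn (jb (m + 2)) (z2 t)
        + ((pC d m * M * wn (jb (m + 2)) (z2 t)
          + pC d m * C1 * wn (jb m) (φ1 t))
          + (pC d m * C1 * wn (jb m) (φ1 t)
          + pC d m * C0 * wn (jb m) (φ2 t)))) := by
          gcongr; refine h4.trans ?_; gcongr
      _ = ENNReal.ofReal γ * (lapC * (ENNReal.ofReal γ * wn (jb (m + 2)) (z2 t))
          + pC d m * M * (ENNReal.ofReal γ * wn (jb (m + 2)) (z2 t))
          + (pC d m * C1 * (ENNReal.ofReal γ * wn (jb m) (φ1 t))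
            + pC d m * C1 * (ENNReal.ofReal γ * wn (jb m) (φ1 t))))
          + pC d m * C0 * (ENNReal.ofReal (γ ^ 2) * wn (jb m) (φ2 t)) := by rw [eγ]; ring
      _ ≤ 1 * (lapC * C2 + pC d m * M * C2 + (pC d m * C1 * M + pC d m * C1 * M))
          + pC d m * C0 * M := by gcongr
      _ = _ := by rw [hC3]; push_cast; ring
  refine ⟨z2, z3, d1, d2, cz3, dZ, dZ1, fun t ht => ?_, fun t ht => ⟨?_, ?_, ?_, ?_⟩⟩
  · rw [← eq2 t ht]
    exact ft_lapL (fz1 t ht 2 (by linarith))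
  · refine (bz t ht).trans (ENNReal.coe_le_coe.2 ?_)
    rw [← hC0, add_assoc, add_assoc]; exact le_self_add
  · refine (bz1 t ht).trans (ENNReal.coe_le_coe.2 ?_)
    rw [← hC1, add_comm C0 C1, add_assoc, add_assoc]; exact le_self_add
  · refine (bz2 t ht).trans (ENNReal.coe_le_coe.2 ?_)
    rw [add_comm _ C2, add_assoc]; exact le_self_add
  · exact (bz3 t ht).trans (ENNReal.coe_le_coe.2 le_add_self)

end Profile

/-! ### The normal form of the Klein-Gordon equation -/

theorem cj_smul (c : ℂ) (f : L2 d) : cj (c • f) = conj c • cj f := by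
  refine Lp.ext ?_
  filter_upwards [coeFn_cj (c • f), coeFn_cj f, Lp.coeFn_smul c f, Lp.coeFn_smul (conj c) (cj f)]
    with x h1 h2 h3 h4
  rw [h1, h4, Pi.smul_apply, h2, h3, Pi.smul_apply, smul_eq_mul, smul_eq_mul, map_mul]

theorem w1_one_cj (f : L2 d) : w1 1 (cj f) = w1 1 f := w1_cj (fun _ => rfl) f

theorem cj_pm {f g : L2 d} (h : w1 1 f < ∞) : cj (pm f g) = pm (cj f) (cj g) := by
  refine Lp.ext ?_
  filter_upwards [coeFn_cj (pm f g), coeFn_pm (g := g) h, coeFn_cj f, coeFn_cj g,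
    coeFn_pm (f := cj f) (g := cj g) (by rwa [w1_one_cj])] with x h1 h2 h3 h4 h5
  rw [h1, h5, h2, h3, h4, map_mul]

theorem wn_jb_cj (s : ℝ) (f : L2 d) : wn (jb s) (cj f) = wn (jb s) f :=
  wn_cj (measurable_jb s) (jb_neg_arg s) f

/-- Relations between Fourier transforms with real and even coefficients are preserved by complex
conjugation. -/
theorem ft_cj_eq_of {s : Space d → ℝ} (hs : ∀ ξ, s (-ξ) = s ξ) {f g h : L2 d}
    (hf : ft f =ᵐ[volume] fun ξ => (s ξ : ℂ) * ft g ξ + ft h ξ) :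
    ft (cj f) =ᵐ[volume] fun ξ => (s ξ : ℂ) * ft (cj g) ξ + ft (cj h) ξ := by
  have h' := (Measure.measurePreserving_neg (volume : Measure (Space d))).quasiMeasurePreserving.ae
    hf
  filter_upwards [h', ft_cj f, ft_cj g, ft_cj h] with ξ h1 h2 h3 h4
  rw [h2, h3, h4, h1, hs]
  simp

theorem coeFn_lin2 (a b : ℂ) (f g : L2 d) :
    (a • f + b • g : L2 d) =ᵐ[volume] fun ξ => a * f ξ + b * g ξ := by
  filter_upwards [Lp.coeFn_add (a • f) (b • g), Lp.coeFn_smul a f, Lp.coeFn_smul b g]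
    with ξ h1 h2 h3
  rw [h1, Pi.add_apply, h2, h3]; rfl

theorem coeFn_lin3 (a b c : ℂ) (f g h : L2 d) :
    (a • f + b • g + c • h : L2 d) =ᵐ[volume] fun ξ => a * f ξ + b * g ξ + c * h ξ := by
  filter_upwards [Lp.coeFn_add (a • f + b • g) (c • h), coeFn_lin2 a b f g, Lp.coeFn_smul c h]
    with ξ h1 h2 h3
  rw [h1, Pi.add_apply, h2, h3]; rfl

theorem coeFn_lin4 (a b c e : ℂ) (f g h k : L2 d) :
    (a • f + b • g + c • h + e • k : L2 d) =ᵐ[volume]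
      fun ξ => a * f ξ + b * g ξ + c * h ξ + e * k ξ := by
  filter_upwards [Lp.coeFn_add (a • f + b • g + c • h) (e • k), coeFn_lin3 a b c f g h,
    Lp.coeFn_smul e k] with ξ h1 h2 h3
  rw [h1, Pi.add_apply, h2, h3]; rfl

/-- The oscillation `e^{iθt}`. -/
noncomputable def osc (θ t : ℝ) : ℂ := Complex.exp (Complex.I * (θ * t))

@[simp] theorem norm_osc (θ t : ℝ) : ‖osc θ t‖ = 1 := by
  rw [osc, mul_comm, ← Complex.ofReal_mul, Complex.norm_exp_ofReal_mul_I]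

@[simp] theorem enorm_osc (θ t : ℝ) : ‖osc θ t‖ₑ = 1 := by
  rw [← ofReal_norm, norm_osc, ENNReal.ofReal_one]

theorem conj_osc (θ t : ℝ) : conj (osc θ t) = osc (-θ) t := by
  rw [osc, osc, ← Complex.exp_conj]
  simp

@[simp] theorem osc_zero_right (θ : ℝ) : osc θ 0 = 1 := by simp [osc]

theorem hasDerivWithinAt_osc (θ t : ℝ) (s : Set ℝ) :
    HasDerivWithinAt (osc θ) (Complex.I * θ * osc θ t) s t := by
  have h1 : HasDerivAt (fun t : ℝ => Complex.I * (θ * (t : ℂ))) (Complex.I * (θ * 1)) t :=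
    ((Complex.ofRealCLM.hasDerivAt (x := t)).const_mul (θ : ℂ)).const_mul Complex.I
  have h2 := h1.cexp.hasDerivWithinAt (s := s)
  convert! h2 using 1
  simp only [osc]; ring

theorem wn_osc_smul (W : Space d → ℝ) (θ t : ℝ) (f : L2 d) : wn W (osc θ t • f) = wn W f := by
  rw [wn_smul, enorm_osc, one_mul]

/-- The frequency `√(ω (|2πξ|² + ω))` of the Klein-Gordon equation, where `ω = ε⁻²`. -/
noncomputable def kgf (ω : ℝ) (ξ : Space d) : ℝ := Real.sqrt (ω * (lam ξ + ω))

section KGF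

variable {ω : ℝ}

theorem kgf_sq (hω : 0 < ω) (ξ : Space d) : kgf ω ξ ^ 2 = ω * (lam ξ + ω) :=
  Real.sq_sqrt (mul_nonneg hω.le (add_nonneg (lam_nonneg ξ) hω.le))

theorem le_kgf (hω : 0 < ω) (ξ : Space d) : ω ≤ kgf ω ξ :=
  Real.le_sqrt_of_sq_le (by nlinarith [lam_nonneg ξ])

theorem kgf_le (hω : 0 < ω) (ξ : Space d) : kgf ω ξ ≤ lam ξ + ω := by
  have h := lam_nonneg ξ
  rw [kgf, Real.sqrt_le_left (by linarith)]
  nlinarith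

/-- The difference of the carrier frequency and the Klein-Gordon frequency is bounded uniformly in
`ω`, at the cost of two derivatives. -/
theorem abs_sub_kgf_le (hω : 0 < ω) (ξ : Space d) : |ω - kgf ω ξ| ≤ lam ξ := by
  rw [abs_sub_comm, abs_of_nonneg (by linarith [le_kgf hω ξ])]
  linarith [kgf_le hω ξ]

theorem measurable_kgf (ω : ℝ) : Measurable (kgf ω : Space d → ℝ) := by
  have := measurable_lam (d := d)
  unfold kgf; fun_prop

end KGF

/-- The energy variable of the Klein-Gordon remainder `r`, in the normal form that removes the
oscillating source. For `σ = ±1` the homogeneous equation makes `∂ₜr + iσΩr` rotate with the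
frequency `σΩ`, where `Ω = kgf ω`. The source `e^{iσωt} ∂ₜp1` is nearly resonant with this rotation
and is a time derivative up to terms bounded by `|ω - Ω| |p1|`. The source `e^{-iσωt} n2` is not
resonant; it is integrated in time, which gains the factor `(ω + Ω)⁻¹ ≤ ε²`. -/
noncomputable def modY (W : Space d → ℝ) (ω σ : ℝ) (r r1 p1 n2 : ℝ → L2 d) (t : ℝ) : L2 d :=
  mulOp (fun ξ => (W ξ : ℂ)) (ft (r1 t))
    + (Complex.I * σ) • mulOp (fun ξ => ((W ξ * kgf ω ξ : ℝ) : ℂ)) (ft (r t))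
    + osc (σ * ω) t • mulOp (fun ξ => (W ξ : ℂ)) (ft (p1 t))
    + osc (-(σ * ω)) t • ((Complex.I * σ) •
      mulOp (fun ξ => ((W ξ / (ω + kgf ω ξ) : ℝ) : ℂ)) (ft (n2 t)))

section Multipliers

variable (s : ℝ) (N : ℕ) {ω : ℝ}

theorem memLp_top_rwt_mul_kgf (hω : 0 < ω) :
    MemLp (fun ξ : Space d => ((rwt s N ξ * kgf ω ξ : ℝ) : ℂ)) ∞ volume := by
  refine memLp_top_of_le (Complex.measurable_ofReal.comp
    ((measurable_rwt s N).mul (measurable_kgf ω))) (C := ((2 * Real.pi) ^ 2 + ω) * N) fun ξ => ?_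
  have h1 := rwt_nonneg s N ξ
  have h2 := hω.trans_le (le_kgf hω ξ)
  rw [Complex.norm_real, Real.norm_of_nonneg (mul_nonneg h1 h2.le)]
  have h3 := rwt_mul_jb_two_le s N ξ
  have h4 := one_le_jb (s := 2) (by norm_num) ξ
  calc rwt s N ξ * kgf ω ξ ≤ rwt s N ξ * (((2 * Real.pi) ^ 2 + ω) * jb 2 ξ) := by
        gcongr
        have := kgf_le hω ξ
        have := lam_le_jb_two ξ
        nlinarith
    _ = ((2 * Real.pi) ^ 2 + ω) * (rwt s N ξ * jb 2 ξ) := by ring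
    _ ≤ _ := by gcongr

theorem memLp_top_rwt_mul_sub (hω : 0 < ω) :
    MemLp (fun ξ : Space d => ((rwt s N ξ * (ω - kgf ω ξ) : ℝ) : ℂ)) ∞ volume := by
  have h := ((memLp_top_rwt (d := d) s N).const_mul (ω : ℂ)).sub (memLp_top_rwt_mul_kgf s N hω)
  refine h.congr_norm ?_ (ae_of_all _ fun ξ => ?_)
  · exact (Complex.measurable_ofReal.comp ((measurable_rwt s N).mul
      (measurable_const.sub (measurable_kgf ω)))).aestronglyMeasurable
  · simp only [Pi.sub_apply]; push_cast; congr 1; ring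

theorem memLp_top_rwt_div (hω : 0 < ω) :
    MemLp (fun ξ : Space d => ((rwt s N ξ / (ω + kgf ω ξ) : ℝ) : ℂ)) ∞ volume := by
  refine memLp_top_of_le (Complex.measurable_ofReal.comp
    ((measurable_rwt s N).div (measurable_const.add (measurable_kgf ω)))) (C := N / ω) fun ξ => ?_
  have h1 := rwt_nonneg s N ξ
  have h2 := hω.trans_le (le_kgf hω ξ)
  rw [Complex.norm_real, Real.norm_of_nonneg (div_nonneg h1 (by linarith))]
  have h3 := rwt_mul_jb_two_le s N ξ
  have h4 := one_le_jb (s := 2) (by norm_num) ξ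
  gcongr
  · nlinarith
  · linarith

end Multipliers

section ModY

variable {T ω σ : ℝ} {r r1 r2 p1 p2 n2 n3 F : ℝ → L2 d} {s : ℝ} {N : ℕ}

/-- The normal form turns the oscillating source into terms that are bounded uniformly in `ω`. -/
theorem modY_deriv (hω : 0 < ω) (hσ : σ ^ 2 = 1) {t : ℝ}
    (dr : HasDerivWithinAt r (r1 t) (Icc 0 T) t) (dr1 : HasDerivWithinAt r1 (r2 t) (Icc 0 T) t)
    (dp : HasDerivWithinAt p1 (p2 t) (Icc 0 T) t) (dn : HasDerivWithinAt n2 (n3 t) (Icc 0 T) t)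
    (eq : ft (r2 t) =ᵐ[volume] fun ξ => -((kgf ω ξ ^ 2 : ℝ) : ℂ) * ft (r t) ξ
      - ω * ft (F t) ξ - osc (σ * ω) t * ft (p2 t) ξ - osc (-(σ * ω)) t * ft (n2 t) ξ) :
    ∃ Y' : L2 d, HasDerivWithinAt (modY (rwt s N) ω σ r r1 p1 n2) Y' (Icc 0 T) t ∧
      Y' =ᵐ[volume] fun ξ => Complex.I * ((σ * kgf ω ξ : ℝ) : ℂ)
          * modY (rwt s N) ω σ r r1 p1 n2 t ξ
        + ((-ω : ℂ) • mulOp (fun ξ => (rwt s N ξ : ℂ)) (ft (F t))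
          + (Complex.I * σ * osc (σ * ω) t) •
            mulOp (fun ξ => ((rwt s N ξ * (ω - kgf ω ξ) : ℝ) : ℂ)) (ft (p1 t))
          + (Complex.I * σ * osc (-(σ * ω)) t) •
            mulOp (fun ξ => ((rwt s N ξ / (ω + kgf ω ξ) : ℝ) : ℂ)) (ft (n3 t)) : L2 d) ξ := by
  set W : L2 d →L[ℂ] L2 d := mulOp fun ξ => (rwt s N ξ : ℂ) with hW
  set V : L2 d →L[ℂ] L2 d := mulOp fun ξ => ((rwt s N ξ * kgf ω ξ : ℝ) : ℂ) with hV
  set K : L2 d →L[ℂ] L2 d := mulOp fun ξ => ((rwt s N ξ / (ω + kgf ω ξ) : ℝ) : ℂ) with hK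
  set D : L2 d →L[ℂ] L2 d := mulOp fun ξ => ((rwt s N ξ * (ω - kgf ω ξ) : ℝ) : ℂ) with hD
  set τ : ℂ := Complex.I * σ with hτ
  have hτ2 : τ ^ 2 = -1 := by
    rw [hτ, mul_pow, Complex.I_sq, ← Complex.ofReal_pow, hσ]; simp
  set e := osc (σ * ω) t with he
  set f := osc (-(σ * ω)) t with hf
  have h1 := hasDerivWithinAt_clm (W.comp ft) dr1
  have h2 := (hasDerivWithinAt_clm (V.comp ft) dr).const_smul τ
  have h3 := (hasDerivWithinAt_osc (σ * ω) t (Icc 0 T)).smul (hasDerivWithinAt_clm (W.comp ft) dp)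
  have h4 := (hasDerivWithinAt_osc (-(σ * ω)) t (Icc 0 T)).smul
    ((hasDerivWithinAt_clm (K.comp ft) dn).const_smul τ)
  have e1 : W (ft (r2 t)) + τ • V (ft (r1 t))
      + (e • W (ft (p2 t)) + (Complex.I * ((σ * ω : ℝ) : ℂ) * e) • W (ft (p1 t)))
      + (f • τ • K (ft (n3 t)) + (Complex.I * ((-(σ * ω) : ℝ) : ℂ) * f) • τ • K (ft (n2 t)))
      = ((1 : ℂ) • W (ft (r2 t)) + τ • V (ft (r1 t)) + e • W (ft (p2 t)))
        + ((τ * ω * e) • W (ft (p1 t)) + (f * τ) • K (ft (n3 t))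
          + (-(τ ^ 2) * ω * f) • K (ft (n2 t))) := by
    rw [one_smul, smul_smul, smul_smul, hτ]
    push_cast
    rw [show Complex.I * (σ * ω : ℂ) * e = Complex.I * σ * ω * e by ring,
      show Complex.I * (-(σ * ω) : ℂ) * f * (Complex.I * σ)
        = -((Complex.I * σ) ^ 2) * ω * f by ring]
    abel
  refine ⟨_, (((h1.add h2).add h3).add h4).congr_deriv e1, ?_⟩
  have e2 : modY (rwt s N) ω σ r r1 p1 n2 t = (1 : ℂ) • W (ft (r1 t)) + τ • V (ft (r t))
      + e • W (ft (p1 t)) + (f * τ) • K (ft (n2 t)) := by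
    rw [one_smul, mul_smul f τ]; rfl
  rw [e2]
  have mW := memLp_top_rwt (d := d) s N
  have mV := memLp_top_rwt_mul_kgf (d := d) s N hω
  have mK := memLp_top_rwt_div (d := d) s N hω
  have mD := memLp_top_rwt_mul_sub (d := d) s N hω
  filter_upwards [eq,
    Lp.coeFn_add ((1 : ℂ) • W (ft (r2 t)) + τ • V (ft (r1 t)) + e • W (ft (p2 t)))
      ((τ * ω * e) • W (ft (p1 t)) + (f * τ) • K (ft (n3 t)) + (-(τ ^ 2) * ω * f) • K (ft (n2 t))),
    coeFn_lin3 1 τ e (W (ft (r2 t))) (V (ft (r1 t))) (W (ft (p2 t))),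
    coeFn_lin3 (τ * ω * e) (f * τ) (-(τ ^ 2) * ω * f) (W (ft (p1 t))) (K (ft (n3 t)))
      (K (ft (n2 t))),
    coeFn_lin4 1 τ e (f * τ) (W (ft (r1 t))) (V (ft (r t))) (W (ft (p1 t))) (K (ft (n2 t))),
    coeFn_lin3 (-ω) (τ * e) (τ * f) (W (ft (F t))) (D (ft (p1 t))) (K (ft (n3 t))),
    coeFn_mulOp mW (ft (r2 t)), coeFn_mulOp mV (ft (r1 t)), coeFn_mulOp mW (ft (p2 t)),
    coeFn_mulOp mW (ft (p1 t)), coeFn_mulOp mK (ft (n3 t)), coeFn_mulOp mK (ft (n2 t)),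
    coeFn_mulOp mW (ft (r1 t)), coeFn_mulOp mV (ft (r t)), coeFn_mulOp mW (ft (F t)),
    coeFn_mulOp mD (ft (p1 t))]
    with ξ g0 g1 g2 g3 g4 g5 k1 k2 k3 k4 k5 k6 k7 k8 k9 k10
  rw [g1, Pi.add_apply, g2, g3, g4, g5, k1, k2, k3, k4, k5, k6, k7, k8, k9, k10]
  have hk : ((rwt s N ξ / (ω + kgf ω ξ) : ℝ) : ℂ) * (ω + kgf ω ξ) = rwt s N ξ := by
    rw [← Complex.ofReal_add, ← Complex.ofReal_mul, div_mul_cancel₀]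
    linarith [le_kgf hω ξ]
  set k : ℂ := ((rwt s N ξ / (ω + kgf ω ξ) : ℝ) : ℂ) with hkd
  have hτ3 : Complex.I * ((σ * kgf ω ξ : ℝ) : ℂ) = τ * kgf ω ξ := by
    rw [hτ]; push_cast; ring
  rw [hτ3]
  push_cast at g0 ⊢
  linear_combination (rwt s N ξ : ℂ) * g0 + f * ft (n2 t) ξ * hk
    - (ω * f * k * ft (n2 t) ξ + kgf ω ξ ^ 2 * rwt s N ξ * ft (r t) ξ
      + kgf ω ξ * f * k * ft (n2 t) ξ) * hτ2

end ModY

/-! ### The remainder of the modulated wave -/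

/-- A solution of the Klein-Gordon equation with the data of the modulated profile, together with
the estimates of the profile. The function `φ2` is the second derivative of `φ`, and so on. -/
structure ModData (m : ℕ) (T ε γ : ℝ) (M C : ℝ≥0) (φ φ1 φ2 z z1 z2 z3 ψ ψ1 ψ2 : ℝ → L2 d) : Prop
    extends ProfileData m T γ M φ φ1 φ2 z z1 where
  hε : 0 < ε
  hεγ : ε < γ
  dz1 : ∀ t ∈ Icc 0 T, HasDerivWithinAt z1 (z2 t) (Icc 0 T) t
  dz2 : ∀ t ∈ Icc 0 T, HasDerivWithinAt z2 (z3 t) (Icc 0 T) t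
  lz : ∀ t ∈ Icc 0 T, HasDerivWithinAt (fun t => lift2 (z t)) (lift2 (z1 t)) (Icc 0 T) t
  lz1 : ∀ t ∈ Icc 0 T, HasDerivWithinAt (fun t => lift2 (z1 t)) (lift2 (z2 t)) (Icc 0 T) t
  eq1 : ∀ t ∈ Icc 0 T, ft ((2 * Complex.I) • z2 t + pm (z1 t) (φ t) + pm (z t) (φ1 t))
    =ᵐ[volume] fun ξ => -(lam ξ : ℂ) * ft (z1 t) ξ
  bz : ∀ t ∈ Icc 0 T, wn (jb (m + 6)) (z t) ≤ C
  bz1 : ∀ t ∈ Icc 0 T, wn (jb (m + 4)) (z1 t) ≤ C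
  bz2 : ∀ t ∈ Icc 0 T, ENNReal.ofReal γ * wn (jb (m + 2)) (z2 t) ≤ C
  bz3 : ∀ t ∈ Icc 0 T, ENNReal.ofReal (γ ^ 2) * wn (jb m) (z3 t) ≤ C
  dψ : ∀ t ∈ Icc 0 T, HasDerivWithinAt ψ (ψ1 t) (Icc 0 T) t
  dψ1 : ∀ t ∈ Icc 0 T, HasDerivWithinAt ψ1 (ψ2 t) (Icc 0 T) t
  eqψ : ∀ t ∈ Icc 0 T, ft (((ε ^ 2 : ℝ) : ℂ) • ψ2 t + ((1 / ε ^ 2 : ℝ) : ℂ) • ψ t + pm (φ t) (ψ t))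
    =ᵐ[volume] fun ξ => -(lam ξ : ℂ) * ft (ψ t) ξ
  rφ : ∀ t ∈ Icc 0 T, cj (φ t) = φ t
  i0 : ψ 0 = z 0 + cj (z 0)
  i1 : ψ1 0 = (Complex.I * (1 / ε ^ 2 : ℝ)) • z 0 - (Complex.I * (1 / ε ^ 2 : ℝ)) • cj (z 0)

/-- The carrier wave `e^{iωt} z(t)`. -/
noncomputable def car (ω : ℝ) (z : ℝ → L2 d) (t : ℝ) : L2 d := osc ω t • z t

theorem hasDerivWithinAt_car (ω : ℝ) {z : ℝ → L2 d} {z' : L2 d} {s : Set ℝ} {t : ℝ}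
    (h : HasDerivWithinAt z z' s t) :
    HasDerivWithinAt (car ω z) (osc ω t • (z' + (Complex.I * ω) • z t)) s t := by
  refine ((hasDerivWithinAt_osc ω t s).smul h).congr_deriv ?_
  rw [smul_add, smul_smul, mul_comm (osc ω t)]

/-- The remainder `v - a - conj a` of the expansion of `v` by a wave `a` and its conjugate. -/
noncomputable def modRem (v a : ℝ → L2 d) (t : ℝ) : L2 d := v t - a t - cj (a t)

theorem hasDerivWithinAt_modRem {v a : ℝ → L2 d} {v' a' : L2 d} {s : Set ℝ} {t : ℝ}
    (hv : HasDerivWithinAt v v' s t) (ha : HasDerivWithinAt a a' s t) :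
    HasDerivWithinAt (modRem v a) (v' - a' - cj a') s t :=
  (hv.sub ha).sub (hasDerivWithinAt_cj ha)

/-- The time derivative of the carrier wave. -/
noncomputable def car1 (ω : ℝ) (z z1 : ℝ → L2 d) (t : ℝ) : L2 d :=
  osc ω t • (z1 t + (Complex.I * ω) • z t)

/-- The second time derivative of the carrier wave. -/
noncomputable def car2 (ω : ℝ) (z z1 z2 : ℝ → L2 d) (t : ℝ) : L2 d :=
  osc ω t • (z2 t + (2 * Complex.I * ω) • z1 t + (-(ω : ℂ) ^ 2) • z t)

theorem hasDerivWithinAt_car1 (ω : ℝ) {z z1 z2 : ℝ → L2 d} {s : Set ℝ} {t : ℝ}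
    (h : HasDerivWithinAt z (z1 t) s t) (h1 : HasDerivWithinAt z1 (z2 t) s t) :
    HasDerivWithinAt (car1 ω z z1) (car2 ω z z1 z2 t) s t := by
  have := hasDerivWithinAt_car ω (h1.add (h.const_smul (Complex.I * (ω : ℂ))))
  refine this.congr_deriv ?_
  simp only [car2, Pi.add_apply, Pi.smul_apply]
  rw [smul_add (Complex.I * (ω : ℂ)), smul_smul,
    show Complex.I * (ω : ℂ) * (Complex.I * ω) = -(ω : ℂ) ^ 2 by
      linear_combination (ω : ℂ) ^ 2 * Complex.I_sq,
    show 2 * Complex.I * (ω : ℂ) = Complex.I * ω + Complex.I * ω by ring, add_smul]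
  abel_nf

section Mod

variable {m : ℕ} {T ε γ : ℝ} {M C : ℝ≥0} {φ φ1 φ2 z z1 z2 z3 ψ ψ1 ψ2 : ℝ → L2 d}

theorem ModData.w1_φ (hd : d ≤ 3) (h : ModData m T ε γ M C φ φ1 φ2 z z1 z2 z3 ψ ψ1 ψ2) {t : ℝ}
    (ht : t ∈ Icc 0 T) : w1 1 (φ t) < ∞ :=
  w1_one_lt_top hd (h.toProfileData.wn_φ_lt_top
    (by linarith [(Nat.cast_nonneg m : (0 : ℝ) ≤ m)]) ht)

theorem kgf_neg_arg (ω : ℝ) (ξ : Space d) : kgf ω (-ξ) = kgf ω ξ := by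
  simp [kgf, lam]

/-- The carrier wave solves the Klein-Gordon equation up to a source that involves only the second
derivative of the profile. -/
theorem ModData.ft_car2 (hd : d ≤ 3) (h : ModData m T ε γ M C φ φ1 φ2 z z1 z2 z3 ψ ψ1 ψ2) {ω : ℝ}
    (hω : 0 < ω) {t : ℝ} (ht : t ∈ Icc 0 T) :
    ft (car2 ω z z1 z2 t) =ᵐ[volume] fun ξ => ((-kgf ω ξ ^ 2 : ℝ) : ℂ) * ft (car ω z t) ξ
      + ft ((-ω : ℂ) • pm (φ t) (car ω z t) + osc ω t • z2 t) ξ := by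
  have e := h.eq t ht
  rw [car, pm_smul_right _ (h.w1_φ hd ht), car2]
  simp only [map_add, map_smul] at e ⊢
  filter_upwards [e, Lp.coeFn_add ((2 * Complex.I) • ft (z1 t)) (ft (pm (φ t) (z t))),
    Lp.coeFn_smul (2 * Complex.I) (ft (z1 t)),
    Lp.coeFn_smul (osc ω t)
      (ft (z2 t) + (2 * Complex.I * ω) • ft (z1 t) + (-(ω : ℂ) ^ 2) • ft (z t)),
    coeFn_lin3 1 (2 * Complex.I * ω) (-(ω : ℂ) ^ 2) (ft (z2 t)) (ft (z1 t)) (ft (z t)),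
    Lp.coeFn_smul (osc ω t) (ft (z t)), Lp.coeFn_smul (osc ω t) (ft (pm (φ t) (z t))),
    coeFn_lin2 (-ω : ℂ) (osc ω t) (osc ω t • ft (pm (φ t) (z t))) (ft (z2 t))]
    with ξ e0 e1 e2 e3 e4 e5 e6 e7
  rw [one_smul] at e4
  rw [e1, Pi.add_apply, e2, Pi.smul_apply, smul_eq_mul] at e0
  rw [e3, Pi.smul_apply, e4, e5, e7, Pi.smul_apply, e6, Pi.smul_apply, kgf_sq hω, smul_eq_mul,
    smul_eq_mul, smul_eq_mul]
  push_cast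
  linear_combination (ω : ℂ) * osc ω t * e0

/-- The remainder of the modulated wave solves the Klein-Gordon equation with the potential `φ` and
an oscillating source. The Schrödinger equation has removed the terms of order `ω` from the source.
-/
theorem ModData.ft_rem2 (hd : d ≤ 3) (h : ModData m T ε γ M C φ φ1 φ2 z z1 z2 z3 ψ ψ1 ψ2) {ω : ℝ}
    (hω : ω = 1 / ε ^ 2) {t : ℝ} (ht : t ∈ Icc 0 T) :
    ft (modRem ψ2 (car2 ω z z1 z2) t) =ᵐ[volume]
      fun ξ => -((kgf ω ξ ^ 2 : ℝ) : ℂ) * ft (modRem ψ (car ω z) t) ξ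
        - ω * ft (pm (φ t) (modRem ψ (car ω z) t)) ξ
        - osc ω t * ft (z2 t) ξ - osc (-ω) t * ft (cj (z2 t)) ξ := by
  have hε2 : (0 : ℝ) < ε ^ 2 := pow_pos h.hε 2
  have hω0 : 0 < ω := by rw [hω]; positivity
  have hωε : (ω : ℂ) * ε ^ 2 = 1 := by
    rw [hω]; push_cast; field_simp [h.hε.ne']
  have w := h.w1_φ hd ht
  have e1 := h.ft_car2 hd hω0 ht
  have e2 := ft_cj_eq_of (s := fun ξ => -kgf ω ξ ^ 2) (fun ξ => by rw [kgf_neg_arg]) e1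
  have e3 := h.eqψ t ht
  rw [← hω] at e3
  have hp : pm (φ t) (modRem ψ (car ω z) t) = (1 : ℂ) • pm (φ t) (ψ t)
      + (-1 : ℂ) • pm (φ t) (car ω z t) + (-1 : ℂ) • pm (φ t) (cj (car ω z t)) := by
    rw [← pm_smul_right _ w, ← pm_smul_right _ w, ← pm_smul_right _ w, ← pm_add_right w,
      ← pm_add_right w, modRem]
    congr 1
    simp [sub_eq_add_neg]
  have hr : ∀ (v a : ℝ → L2 d) (t : ℝ),
      modRem v a t = (1 : ℂ) • v t + (-1 : ℂ) • a t + (-1 : ℂ) • cj (a t) := by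
    intro v a t; simp [modRem, sub_eq_add_neg]
  rw [map_add, cj_smul, cj_smul, cj_pm w, h.rφ t ht, conj_osc] at e2
  rw [hp, hr, hr]
  simp only [map_add, map_smul] at e1 e2 e3 ⊢
  filter_upwards [e1, e2, e3,
    coeFn_lin3 1 (-1) (-1) (ft (ψ2 t)) (ft (car2 ω z z1 z2 t)) (ft (cj (car2 ω z z1 z2 t))),
    coeFn_lin3 1 (-1) (-1) (ft (ψ t)) (ft (car ω z t)) (ft (cj (car ω z t))),
    coeFn_lin3 1 (-1) (-1) (ft (pm (φ t) (ψ t))) (ft (pm (φ t) (car ω z t)))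
      (ft (pm (φ t) (cj (car ω z t)))),
    coeFn_lin3 ((ε ^ 2 : ℝ) : ℂ) (ω : ℂ) 1 (ft (ψ2 t)) (ft (ψ t)) (ft (pm (φ t) (ψ t))),
    coeFn_lin2 (-ω : ℂ) (osc ω t) (ft (pm (φ t) (car ω z t))) (ft (z2 t)),
    coeFn_lin2 (conj (-ω : ℂ)) (osc (-ω) t) (ft (pm (φ t) (cj (car ω z t)))) (ft (cj (z2 t)))]
    with ξ g1 g2 g3 k1 k2 k3 k4 k5 k6
  rw [one_smul] at k4
  rw [k5] at g1
  rw [k6] at g2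
  rw [k4] at g3
  rw [k1, k2, k3, g1, g2]
  have hc : conj (-(ω : ℂ)) = -ω := by simp
  rw [hc]
  rw [kgf_sq hω0] at *
  push_cast at g3 ⊢
  linear_combination (ω : ℂ) * g3 - ft (ψ2 t) ξ * hωε

end Mod

/-! ### Bounds of the Klein-Gordon remainder -/

theorem norm_mulOp_ft_le {W : Space d → ℝ} (hW : MemLp (fun ξ => (W ξ : ℂ)) ∞ volume) {f : L2 d}
    {C : ℝ≥0} (h : wn W f ≤ C) : ‖mulOp (fun ξ => (W ξ : ℂ)) (ft f)‖ ≤ C := by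
  rw [← enorm_mulOp_ft hW, enorm_eq_nnnorm] at h
  exact_mod_cast h

theorem wn_le_of_norm_mulOp_ft_le {W : Space d → ℝ} (hW : MemLp (fun ξ => (W ξ : ℂ)) ∞ volume)
    {f : L2 d} {C : ℝ≥0} (h : ‖mulOp (fun ξ => (W ξ : ℂ)) (ft f)‖ ≤ C) : wn W f ≤ C := by
  rw [← enorm_mulOp_ft hW, enorm_eq_nnnorm]
  exact_mod_cast h

/-- The coefficient of the energy in the source of the normal form. -/
noncomputable def rB (d m : ℕ) (M : ℝ≥0) : ℝ≥0 := pC d m * M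

/-- The part of the bound of the source of the normal form that does not depend on the energy. -/
noncomputable def rA (d m : ℕ) (M C : ℝ≥0) : ℝ≥0 := rB d m M * (2 * C) + lapC * C + C

/-- The bound of the energy of the Klein-Gordon remainder. -/
noncomputable def rE (d m : ℕ) (T : ℝ) (M C : ℝ≥0) : ℝ≥0 :=
  Real.toNNReal (Real.sqrt ((32 * C ^ 2 + 2 * rA d m M C ^ 2 * T) *
    Real.exp ((4 * rB d m M + 1) * T)))

section Mod

variable {m : ℕ} {T ε γ : ℝ} {M C : ℝ≥0} {φ φ1 φ2 z z1 z2 z3 ψ ψ1 ψ2 : ℝ → L2 d}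

theorem ModData.rem_zero (h : ModData m T ε γ M C φ φ1 φ2 z z1 z2 z3 ψ ψ1 ψ2) (ω : ℝ) :
    modRem ψ (car ω z) 0 = 0 := by
  simp [modRem, car, h.i0]

theorem ModData.rem1_zero (h : ModData m T ε γ M C φ φ1 φ2 z z1 z2 z3 ψ ψ1 ψ2) {ω : ℝ}
    (hω : ω = 1 / ε ^ 2) : modRem ψ1 (car1 ω z z1) 0 = -z1 0 - cj (z1 0) := by
  simp only [modRem, car1, h.i1, osc_zero_right, one_smul, map_add, cj_smul]
  rw [← hω]
  simp
  abel

theorem ofReal_sq_mul_le {x : ℝ≥0∞} (h : ModData m T ε γ M C φ φ1 φ2 z z1 z2 z3 ψ ψ1 ψ2)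
    (hx : ENNReal.ofReal (γ ^ 2) * x ≤ C) : ENNReal.ofReal (ε ^ 2) * x ≤ C := by
  refine le_trans ?_ hx
  have := h.hε
  have := h.hεγ
  gcongr

theorem ofReal_sq_mul_le' {x : ℝ≥0∞} (h : ModData m T ε γ M C φ φ1 φ2 z z1 z2 z3 ψ ψ1 ψ2)
    (hx : ENNReal.ofReal γ * x ≤ C) : ENNReal.ofReal (ε ^ 2) * x ≤ C := by
  refine le_trans ?_ hx
  have h1 := h.hε
  have h2 := h.hεγ
  have h3 := h.hγ1
  gcongr
  nlinarith

theorem wn_rwt_le (s : ℝ) (N : ℕ) (f : L2 d) : wn (rwt s N) f ≤ wn (jb s) f :=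
  wn_mono (fun ξ => by
    rw [abs_of_nonneg (rwt_nonneg _ _ _), abs_of_pos (jb_pos _ _)]
    exact rwt_le_jb s N ξ) f

theorem wn_rwt_div_le {ω : ℝ} (hε : 0 < ε) (hω : ω = 1 / ε ^ 2) (s : ℝ) (N : ℕ) (f : L2 d) :
    wn (fun ξ => rwt s N ξ / (ω + kgf ω ξ)) f ≤ ENNReal.ofReal (ε ^ 2) * wn (jb s) f := by
  refine wn_le_const_mul (fun ξ => ?_) f
  have hω0 : 0 < ω := by rw [hω]; positivity
  have h1 := le_kgf hω0 ξ
  rw [abs_of_nonneg (div_nonneg (rwt_nonneg _ _ _) (by linarith)), abs_of_pos (jb_pos _ _),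
    div_le_iff₀ (by linarith)]
  have h2 := rwt_le_jb s N ξ
  have h3 : ε ^ 2 * ω = 1 := by rw [hω]; field_simp
  have h4 : 1 ≤ ε ^ 2 * (ω + kgf ω ξ) := by nlinarith [pow_pos hε 2]
  nlinarith [jb_pos s ξ]

theorem wn_rwt_le_mul_kgf {ω : ℝ} (hε : 0 < ε) (hω : ω = 1 / ε ^ 2) (s : ℝ) (N : ℕ) (f : L2 d) :
    wn (rwt s N) f ≤ ENNReal.ofReal (ε ^ 2) * wn (fun ξ => rwt s N ξ * kgf ω ξ) f := by
  refine wn_le_const_mul (fun ξ => ?_) f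
  have hω0 : 0 < ω := by rw [hω]; positivity
  have h1 := le_kgf hω0 ξ
  have h2 := rwt_nonneg s N ξ
  rw [abs_of_nonneg h2, abs_of_nonneg (mul_nonneg h2 (hω0.le.trans h1))]
  have h3 : ε ^ 2 * ω = 1 := by rw [hω]; field_simp
  have h4 : 1 ≤ ε ^ 2 * kgf ω ξ := by nlinarith [pow_pos hε 2]
  nlinarith

theorem wn_rwt_mul_sub_le {ω : ℝ} (hω : 0 < ω) (s : ℝ) (N : ℕ) (f : L2 d) :
    wn (fun ξ => rwt s N ξ * (ω - kgf ω ξ)) f ≤ lapC * wn (jb (s + 2)) f := by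
  refine (wn_le_const_mul (C := (2 * Real.pi) ^ 2) (V := jb (s + 2)) (fun ξ => ?_) f).trans_eq ?_
  · rw [abs_mul, abs_of_nonneg (rwt_nonneg _ _ _), abs_of_pos (jb_pos _ _), jb_add]
    have h1 := rwt_le_jb s N ξ
    have h2 := abs_sub_kgf_le hω ξ
    have h3 := lam_le_jb_two ξ
    have h4 := jb_pos s ξ
    calc _ ≤ jb s ξ * ((2 * Real.pi) ^ 2 * jb 2 ξ) := by
          gcongr
          exact h2.trans h3
      _ = _ := by ring
  · rw [← coe_lapC, ENNReal.ofReal_coe_nnreal]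

theorem ModData.wn_z1_le' (h : ModData m T ε γ M C φ φ1 φ2 z z1 z2 z3 ψ ψ1 ψ2) {s : ℝ}
    (hs : s ≤ m + 4) {t : ℝ} (ht : t ∈ Icc 0 T) : wn (jb s) (z1 t) ≤ C :=
  (wn_jb_mono hs _).trans (h.bz1 t ht)

/-- The corrections of the normal form are bounded. -/
theorem ModData.norm_modY_sub_le (h : ModData m T ε γ M C φ φ1 φ2 z z1 z2 z3 ψ ψ1 ψ2) {ω : ℝ}
    (hω : ω = 1 / ε ^ 2) {σ : ℝ} (hσ : |σ| = 1) (N : ℕ) {r r1 p n : ℝ → L2 d} {t : ℝ}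
    (hp : wn (jb m) (p t) ≤ C) (hn : ENNReal.ofReal (ε ^ 2) * wn (jb m) (n t) ≤ C) :
    ‖modY (rwt m N) ω σ r r1 p n t - (mulOp (fun ξ => (rwt m N ξ : ℂ)) (ft (r1 t))
      + (Complex.I * σ) • mulOp (fun ξ => ((rwt m N ξ * kgf ω ξ : ℝ) : ℂ)) (ft (r t)))‖
      ≤ 2 * C := by
  have hω0 : 0 < ω := by have := h.hε; rw [hω]; positivity
  rw [modY, add_assoc, add_sub_cancel_left]
  refine (norm_add_le _ _).trans ?_
  rw [norm_smul, norm_smul, norm_smul, norm_osc, norm_osc, one_mul, one_mul, norm_mul,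
    Complex.norm_I, Complex.norm_real, Real.norm_eq_abs, hσ, one_mul, one_mul]
  have h1 := norm_mulOp_ft_le (memLp_top_rwt m N) ((wn_rwt_le m N _).trans hp)
  have h2 := norm_mulOp_ft_le (memLp_top_rwt_div m N hω0)
    ((wn_rwt_div_le h.hε hω m N _).trans hn)
  linarith

/-- The source of the normal form is bounded by the energy: the factor `ω` in front of `φ r` is
absorbed since the energy controls `Ω r` and `ω ≤ Ω`. -/
theorem ModData.norm_source_le (hd : d ≤ 3) (h : ModData m T ε γ M C φ φ1 φ2 z z1 z2 z3 ψ ψ1 ψ2)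
    {ω : ℝ} (hω : ω = 1 / ε ^ 2) {σ : ℝ} (hσ : |σ| = 1) (N : ℕ) {e f : ℂ} (he : ‖e‖ = 1)
    (hf : ‖f‖ = 1) {r p n : L2 d} {t : ℝ} (ht : t ∈ Icc 0 T)
    (hp : wn (jb (m + 2)) p ≤ C) (hn : ENNReal.ofReal (ε ^ 2) * wn (jb m) n ≤ C) :
    ‖((-ω : ℂ) • mulOp (fun ξ => (rwt m N ξ : ℂ)) (ft (pm (φ t) r))
      + (Complex.I * σ * e) • mulOp (fun ξ => ((rwt m N ξ * (ω - kgf ω ξ) : ℝ) : ℂ)) (ft p)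
      + (Complex.I * σ * f) •
        mulOp (fun ξ => ((rwt m N ξ / (ω + kgf ω ξ) : ℝ) : ℂ)) (ft n) : L2 d)‖
      ≤ rB d m M * ‖mulOp (fun ξ => ((rwt m N ξ * kgf ω ξ : ℝ) : ℂ)) (ft r)‖ + lapC * C + C := by
  have hω0 : 0 < ω := by have := h.hε; rw [hω]; positivity
  set V : L2 d →L[ℂ] L2 d := mulOp (fun ξ => ((rwt m N ξ * kgf ω ξ : ℝ) : ℂ)) with hV
  have h1 : ‖mulOp (fun ξ => ((rwt m N ξ * (ω - kgf ω ξ) : ℝ) : ℂ)) (ft p)‖ ≤ lapC * C := by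
    have := norm_mulOp_ft_le (C := lapC * C) (memLp_top_rwt_mul_sub m N hω0)
      ((wn_rwt_mul_sub_le hω0 m N p).trans (by push_cast; gcongr))
    exact_mod_cast this
  have h2 := norm_mulOp_ft_le (memLp_top_rwt_div m N hω0)
    ((wn_rwt_div_le h.hε hω m N _).trans hn)
  have hm : (0 : ℝ) ≤ m := Nat.cast_nonneg m
  have h3 : ω * ‖mulOp (fun ξ => (rwt m N ξ : ℂ)) (ft (pm (φ t) r))‖
      ≤ rB d m M * ‖V (ft r)‖ := by
    have k1 := wn_rwt_pm_le_peetre hd hm N (g := r)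
      (h.toProfileData.wn_φ_lt_top (s := m + 4) (by linarith) ht)
    have k2 : wn (jb (m + 4)) (φ t) ≤ M := (wn_jb_mono (by linarith) _).trans (h.bφ t ht)
    have k3 : wn (rwt m N) r
        ≤ ENNReal.ofReal (ε ^ 2) * wn (fun ξ => rwt m N ξ * kgf ω ξ) r :=
      wn_rwt_le_mul_kgf h.hε hω m N r
    rw [← enorm_mulOp_ft (memLp_top_rwt_mul_kgf m N hω0), enorm_eq_nnnorm] at k3
    have k4 := norm_mulOp_ft_le (f := pm (φ t) r) (memLp_top_rwt m N)
      (C := rB d m M * ((ε ^ 2).toNNReal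
        * ‖V (ft r)‖₊)) (k1.trans (by
          rw [rB]
          push_cast
          gcongr
          exact k3))
    push_cast at k4
    rw [Real.coe_toNNReal _ (sq_nonneg ε)] at k4
    calc _ ≤ ω * (rB d m M * (ε ^ 2
          * ‖V (ft r)‖)) := by gcongr
      _ = _ := by rw [hω]; field_simp [h.hε.ne']
  refine (norm_add₃_le).trans ?_
  simp only [norm_smul, norm_mul, he, hf, norm_neg, Complex.norm_I, Complex.norm_real,
    Real.norm_eq_abs, hσ, abs_of_pos hω0, one_mul]
  linarith

theorem norm_le_of_sum_diff {Y Z V W : L2 d} {c : ℝ}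
    (c1 : ‖Y - (W + (Complex.I * (1 : ℝ)) • V)‖ ≤ c)
    (c2 : ‖Z - (W + (Complex.I * (-1 : ℝ)) • V)‖ ≤ c) :
    ‖V‖ ≤ (‖Y‖ + ‖Z‖) / 2 + c ∧ ‖W‖ ≤ (‖Y‖ + ‖Z‖) / 2 + c := by
  set P := Y - (W + (Complex.I * (1 : ℝ)) • V) with hP
  set Q := Z - (W + (Complex.I * (-1 : ℝ)) • V) with hQ
  constructor
  · have k : (2 * Complex.I) • V = (Y - Z) - (P - Q) := by
      rw [hP, hQ]
      push_cast
      module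
    have k1 := congrArg norm k
    rw [norm_smul, norm_mul, Complex.norm_I, Complex.norm_two, mul_one] at k1
    linarith [norm_sub_le (Y - Z) (P - Q), norm_sub_le Y Z, norm_sub_le P Q]
  · have k : (2 : ℂ) • W = (Y + Z) - (P + Q) := by
      rw [hP, hQ]
      push_cast
      module
    have k1 := congrArg norm k
    rw [norm_smul, Complex.norm_two] at k1
    linarith [norm_sub_le (Y + Z) (P + Q), norm_add_le Y Z, norm_add_le P Q]

theorem norm_le_rE {d m : ℕ} {T : ℝ} {M C : ℝ≥0} {y z y0 z0 : ℝ} (hy : 0 ≤ y0)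
    (hz : 0 ≤ z0)
    (h : y ^ 2 + z ^ 2 ≤ (y0 ^ 2 + z0 ^ 2 + 2 * (rA d m M C : ℝ) ^ 2 * T)
      * Real.exp ((4 * rB d m M + 1) * T)) (h1 : y0 ≤ 4 * C) (h2 : z0 ≤ 4 * C) :
    y ≤ rE d m T M C ∧ z ≤ rE d m T M C := by
  have en2 : y ^ 2 + z ^ 2 ≤ (32 * C ^ 2 + 2 * rA d m M C ^ 2 * T) *
      Real.exp ((4 * rB d m M + 1) * T) := by
    refine h.trans ?_
    have k1 := pow_le_pow_left₀ hy h1 2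
    have k2 := pow_le_pow_left₀ hz h2 2
    exact mul_le_mul_of_nonneg_right (by linarith) (Real.exp_pos _).le
  rw [rE, Real.coe_toNNReal _ (Real.sqrt_nonneg _)]
  exact ⟨Real.le_sqrt_of_sq_le (by linarith [sq_nonneg z]),
    Real.le_sqrt_of_sq_le (by linarith [sq_nonneg y])⟩

/-- The bounds of the Klein-Gordon remainder and of its time derivative. Two energy variables are
needed: for `σ = 1` the source `e^{iωt} ∂ₜₜz` is resonant, and for `σ = -1` its complex conjugate.
-/
theorem ModData.wn_rem_le (hd : d ≤ 3) (h : ModData m T ε γ M C φ φ1 φ2 z z1 z2 z3 ψ ψ1 ψ2)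
    {ω : ℝ} (hω : ω = 1 / ε ^ 2) {t : ℝ} (ht : t ∈ Icc 0 T) :
    wn (jb m) (modRem ψ (car ω z) t) ≤ ENNReal.ofReal (ε ^ 2) * (rE d m T M C + 2 * C : ℝ≥0) ∧
      wn (jb m) (modRem ψ1 (car1 ω z z1) t) ≤ (rE d m T M C + 2 * C : ℝ≥0) := by
  have hω0 : 0 < ω := by have := h.hε; rw [hω]; positivity
  have hm : (0 : ℝ) ≤ m := Nat.cast_nonneg m
  set r := modRem ψ (car ω z) with hr
  set r1 := modRem ψ1 (car1 ω z z1) with hr1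
  set r2 := modRem ψ2 (car2 ω z z1 z2) with hr2
  set zb1 : ℝ → L2 d := fun t => cj (z1 t) with hzb1
  set zb2 : ℝ → L2 d := fun t => cj (z2 t) with hzb2
  set zb3 : ℝ → L2 d := fun t => cj (z3 t) with hzb3
  have dr : ∀ t ∈ Icc 0 T, HasDerivWithinAt r (r1 t) (Icc 0 T) t := fun t ht =>
    hasDerivWithinAt_modRem (h.dψ t ht) (hasDerivWithinAt_car ω (h.dz t ht))
  have dr1 : ∀ t ∈ Icc 0 T, HasDerivWithinAt r1 (r2 t) (Icc 0 T) t := fun t ht =>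
    hasDerivWithinAt_modRem (h.dψ1 t ht) (hasDerivWithinAt_car1 ω (h.dz t ht) (h.dz1 t ht))
  have e1 : ∀ t ∈ Icc 0 T, ENNReal.ofReal (ε ^ 2) * wn (jb m) (z2 t) ≤ C := fun t ht =>
    (mul_le_mul_right (wn_jb_mono (by linarith) _) _).trans (ofReal_sq_mul_le' h (h.bz2 t ht))
  have e2 : ∀ t ∈ Icc 0 T, ENNReal.ofReal (ε ^ 2) * wn (jb m) (z3 t) ≤ C := fun t ht =>
    ofReal_sq_mul_le h (h.bz3 t ht)
  have key : ∀ N : ℕ, ‖mulOp (fun ξ => ((rwt m N ξ * kgf ω ξ : ℝ) : ℂ)) (ft (r t))‖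
        ≤ (rE d m T M C + 2 * C : ℝ≥0) ∧
      ‖mulOp (fun ξ => (rwt m N ξ : ℂ)) (ft (r1 t))‖ ≤ (rE d m T M C + 2 * C : ℝ≥0) := by
    intro N
    set Y := modY (rwt m N) ω 1 r r1 z1 zb2 with hY
    set Z := modY (rwt m N) ω (-1) r r1 zb1 z2 with hZ
    have dY := fun t (ht : t ∈ Icc 0 T) => modY_deriv (s := m) (N := N) hω0 (σ := 1) (by norm_num)
      (F := fun t => pm (φ t) (r t)) (p2 := z2) (n3 := zb3) (dr t ht)
      (dr1 t ht) (h.dz1 t ht) (hasDerivWithinAt_cj (h.dz2 t ht)) (by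
        simpa only [one_mul] using h.ft_rem2 hd hω ht)
    have dZ := fun t (ht : t ∈ Icc 0 T) => modY_deriv (s := m) (N := N) hω0 (σ := -1) (by norm_num)
      (F := fun t => pm (φ t) (r t)) (p2 := zb2) (n3 := z3) (dr t ht)
      (dr1 t ht) (hasDerivWithinAt_cj (h.dz1 t ht)) (h.dz2 t ht) (by
        filter_upwards [h.ft_rem2 hd hω ht] with ξ hξ
        simp only [neg_mul, one_mul, neg_neg]
        rw [hξ]
        ring)
    choose! Y' dY hYG using dY
    choose! Z' dZ hZG using dZ
    have c1 := fun t (ht : t ∈ Icc 0 T) => h.norm_modY_sub_le hω (σ := 1) (by norm_num) N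
      (r := r) (r1 := r1) (p := z1) (n := zb2) (t := t)
      (h.wn_z1_le' (by linarith) ht) (by rw [wn_jb_cj]; exact e1 t ht)
    have c2 := fun t (ht : t ∈ Icc 0 T) => h.norm_modY_sub_le hω (σ := -1) (by norm_num) N
      (r := r) (r1 := r1) (p := zb1) (n := z2) (t := t)
      (by rw [wn_jb_cj]; exact h.wn_z1_le' (by linarith) ht) (e1 t ht)
    rw [← hY] at c1
    rw [← hZ] at c2
    set V : L2 d →L[ℂ] L2 d := mulOp (fun ξ => ((rwt m N ξ * kgf ω ξ : ℝ) : ℂ)) with hV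
    set W : L2 d →L[ℂ] L2 d := mulOp (fun ξ => (rwt m N ξ : ℂ)) with hW
    -- The sum and the difference of the two energy variables control `r1` and `r`.
    have hVW : ∀ t ∈ Icc 0 T, ‖V (ft (r t))‖ ≤ (‖Y t‖ + ‖Z t‖) / 2 + 2 * C ∧
        ‖W (ft (r1 t))‖ ≤ (‖Y t‖ + ‖Z t‖) / 2 + 2 * C :=
      fun t ht => norm_le_of_sum_diff (c1 t ht) (c2 t ht)
    have hA : (rA d m M C : ℝ) = rB d m M * (2 * C) + lapC * C + C := by simp [rA]
    have hG : ∀ t ∈ Icc 0 T, rB d m M * ‖V (ft (r t))‖ + lapC * C + C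
        ≤ rA d m M C + rB d m M * (‖Y t‖ + ‖Z t‖) := by
      intro t ht
      have k := mul_le_mul_of_nonneg_left (hVW t ht).1 (rB d m M).coe_nonneg
      have k2 : 0 ≤ (rB d m M : ℝ) * (‖Y t‖ + ‖Z t‖) := by positivity
      rw [hA]
      linarith
    have hB := (rB d m M).coe_nonneg
    have gY : ∀ t ∈ Icc 0 T, ∃ (s : Space d → ℝ) (G : L2 d),
        (Y' t =ᵐ[volume] fun ξ => Complex.I * s ξ * Y t ξ + G ξ) ∧
          ‖G‖ ≤ rA d m M C + rB d m M * (‖Y t‖ + ‖Z t‖) := fun t ht => by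
      refine ⟨_, _, hYG t ht, (h.norm_source_le hd hω (by norm_num) N (norm_osc _ _)
        (norm_osc _ _) ht (h.wn_z1_le' (by linarith) ht) (by rw [wn_jb_cj]; exact e2 t ht)).trans
          (hG t ht)⟩
    have gZ : ∀ t ∈ Icc 0 T, ∃ (s : Space d → ℝ) (G : L2 d),
        (Z' t =ᵐ[volume] fun ξ => Complex.I * s ξ * Z t ξ + G ξ) ∧
          ‖G‖ ≤ rA d m M C + rB d m M * (‖Y t‖ + ‖Z t‖) := fun t ht => by
      refine ⟨_, _, hZG t ht, (h.norm_source_le hd hω (by norm_num) N (norm_osc _ _)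
        (norm_osc _ _) ht (by rw [wn_jb_cj]; exact h.wn_z1_le' (by linarith) ht) (e2 t ht)).trans
          (hG t ht)⟩
    have en := energy_pair hB dY dZ gY gZ t ht
    have h0 := h.toProfileData.zero_mem
    have r0 : W (ft (r1 0)) = -W (ft (z1 0)) - W (ft (zb1 0)) := by
      rw [hr1, h.rem1_zero hω, map_sub, map_sub, map_neg, map_neg]
    have w1 : ‖W (ft (z1 0))‖ ≤ C := norm_mulOp_ft_le (memLp_top_rwt m N)
      ((wn_rwt_le m N _).trans (h.wn_z1_le' (by linarith) h0))
    have w2 : ‖W (ft (zb1 0))‖ ≤ C := norm_mulOp_ft_le (memLp_top_rwt m N)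
      ((wn_rwt_le m N _).trans (by rw [wn_jb_cj]; exact h.wn_z1_le' (by linarith) h0))
    have r0' : ‖W (ft (r1 0))‖ ≤ 2 * C := by
      rw [r0]
      refine (norm_sub_le _ _).trans ?_
      rw [norm_neg]
      linarith
    have v0 : V (ft (r 0)) = 0 := by rw [hr, h.rem_zero, map_zero, map_zero]
    have y0 : ‖Y 0‖ ≤ 4 * C := by
      have k := c1 0 h0
      rw [v0, smul_zero, add_zero] at k
      have := norm_le_norm_add_norm_sub' (Y 0) (W (ft (r1 0)))
      linarith
    have z0 : ‖Z 0‖ ≤ 4 * C := by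
      have k := c2 0 h0
      rw [v0, smul_zero, add_zero] at k
      have := norm_le_norm_add_norm_sub' (Z 0) (W (ft (r1 0)))
      linarith
    obtain ⟨yt, zt⟩ := norm_le_rE (norm_nonneg _) (norm_nonneg _) en y0 z0
    have hC : ((rE d m T M C + 2 * C : ℝ≥0) : ℝ) = rE d m T M C + 2 * C := by simp
    rw [hC]
    exact ⟨(hVW t ht).1.trans (by linarith), (hVW t ht).2.trans (by linarith)⟩
  refine ⟨wn_jb_le_of_rwt fun N => ?_, wn_jb_le_of_rwt fun N =>
    wn_le_of_norm_mulOp_ft_le (memLp_top_rwt m N) (key N).2⟩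
  refine (wn_rwt_le_mul_kgf h.hε hω m N _).trans ?_
  gcongr
  exact wn_le_of_norm_mulOp_ft_le (memLp_top_rwt_mul_kgf m N hω0) (key N).1

end Mod

/-! ### The wave equation with an oscillating source -/

/-- The weight `⟨ξ⟩ˢ |2πξ|ʲ`, cut off to an annulus. The exponent `j` may be negative; the cutoff
makes the weight bounded. -/
noncomputable def aw (s : ℝ) (n : ℕ) (j : ℤ) (ξ : Space d) : ℝ :=
  {ξ : Space d | ((n : ℝ) + 1)⁻¹ ≤ ‖ξ‖ ∧ ‖ξ‖ ≤ n + 1}.indicator (fun ξ => jb s ξ * kap ξ ^ j) ξ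

theorem measurable_aw (s : ℝ) (n : ℕ) (j : ℤ) : Measurable (aw s n j : Space d → ℝ) := by
  have h1 := measurable_jb (d := d) s
  have h2 := (continuous_kap (d := d)).measurable
  refine Measurable.indicator (h1.mul ?_) ?_
  · cases j with
    | ofNat k => simpa using h2.pow_const k
    | negSucc k =>
      simp only [zpow_negSucc]
      exact (h2.pow_const (k + 1)).inv
  · exact (measurableSet_le measurable_const measurable_norm).inter
      (measurableSet_le measurable_norm measurable_const)

theorem memLp_top_aw (s : ℝ) (n : ℕ) (j : ℤ) :
    MemLp (fun ξ : Space d => (aw s n j ξ : ℂ)) ∞ volume := by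
  set K : Set (Space d) := {ξ | ((n : ℝ) + 1)⁻¹ ≤ ‖ξ‖ ∧ ‖ξ‖ ≤ n + 1} with hK
  have hn : (0 : ℝ) < ((n : ℝ) + 1)⁻¹ := by positivity
  have hc : IsCompact K := by
    refine (isCompact_closedBall (0 : Space d) (n + 1)).of_isClosed_subset ?_ fun ξ hξ => ?_
    · exact (isClosed_le continuous_const continuous_norm).inter
        (isClosed_le continuous_norm continuous_const)
    · simpa using hξ.2
  have hcont : ContinuousOn (fun ξ : Space d => jb s ξ * kap ξ ^ j) K := by
    refine (continuous_jb s).continuousOn.mul (continuous_kap.continuousOn.zpow₀ j fun ξ hξ => ?_)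
    left
    have : 0 < ‖ξ‖ := hn.trans_le hξ.1
    rw [kap]; positivity
  obtain ⟨C, hC⟩ := hc.exists_bound_of_continuousOn hcont
  refine memLp_top_of_le (Complex.measurable_ofReal.comp (measurable_aw s n j)) (C := max C 0)
    fun ξ => ?_
  rw [Complex.norm_real, aw]
  by_cases h : ξ ∈ K
  · rw [indicator_of_mem h]; exact (hC ξ h).trans (le_max_left _ _)
  · rw [indicator_of_notMem h]; simp

theorem aw_add (s : ℝ) (n : ℕ) (j k : ℤ) (ξ : Space d) :
    aw s n (j + k) ξ = aw s n j ξ * kap ξ ^ k := by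
  rw [aw, aw]
  by_cases h : ((n : ℝ) + 1)⁻¹ ≤ ‖ξ‖ ∧ ‖ξ‖ ≤ n + 1
  · rw [indicator_of_mem (by exact h), indicator_of_mem (by exact h), zpow_add₀, mul_assoc]
    have : 0 < ‖ξ‖ := lt_of_lt_of_le (by positivity) h.1
    rw [kap]; positivity
  · rw [indicator_of_notMem (by exact h), indicator_of_notMem (by exact h), zero_mul]

theorem aw_nonneg (s : ℝ) (n : ℕ) (j : ℤ) (ξ : Space d) : 0 ≤ aw s n j ξ :=
  indicator_nonneg (fun ξ _ => mul_nonneg (jb_pos _ _).le (zpow_nonneg (kap_nonneg ξ) _)) ξ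

theorem aw_le (s : ℝ) (n : ℕ) (j : ℤ) (ξ : Space d) : aw s n j ξ ≤ jb s ξ * kap ξ ^ j :=
  indicator_le_self' (fun ξ _ => mul_nonneg (jb_pos _ _).le (zpow_nonneg (kap_nonneg ξ) _)) ξ

theorem kap_pow_le (k : ℕ) (ξ : Space d) : kap ξ ^ k ≤ (2 * Real.pi) ^ k * jb k ξ := by
  have h : jb (k : ℝ) ξ = jb 1 ξ ^ k := by
    rw [jb, jb, ← Real.rpow_mul_natCast (by positivity)]
    congr 1; ring
  rw [h, ← mul_pow]
  exact pow_le_pow_left₀ (kap_nonneg ξ) (kap_le_jb ξ) k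

theorem wn_aw_le (s : ℝ) (n : ℕ) {k : ℕ} (hk : k ≤ 3) (f : L2 d) :
    wn (aw s n k) f ≤ ENNReal.ofReal ((2 * Real.pi) ^ 3) * wn (jb (s + k)) f := by
  refine wn_le_const_mul (fun ξ => ?_) f
  have h1 := aw_le s n k ξ
  have h2 := kap_pow_le k ξ
  have hp : 1 ≤ 2 * Real.pi := by linarith [Real.pi_gt_three]
  have h3 := pow_le_pow_right₀ hp hk
  rw [abs_of_nonneg (aw_nonneg _ _ _ _), abs_of_pos (jb_pos _ _), jb_add]
  refine h1.trans ?_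
  have h4 := jb_pos (k : ℝ) ξ
  rw [zpow_natCast]
  calc jb s ξ * kap ξ ^ k ≤ jb s ξ * ((2 * Real.pi) ^ 3 * jb k ξ) := by
        have := (jb_pos s ξ).le
        gcongr
        exact h2.trans (by gcongr)
    _ = _ := by ring

theorem norm_aw_le {s : ℝ} {n : ℕ} {k : ℕ} (hk : k ≤ 3) {f : L2 d} {c B : ℝ} (hc : 0 ≤ c)
    (hB : 0 ≤ B) (h : ENNReal.ofReal c * wn (jb (s + k)) f ≤ ENNReal.ofReal B) :
    c * ‖mulOp (fun ξ => (aw s n k ξ : ℂ)) (ft f)‖ ≤ (2 * Real.pi) ^ 3 * B := by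
  have h1 := wn_aw_le s n hk f
  rw [← enorm_mulOp_ft (memLp_top_aw s n k), ← ofReal_norm] at h1
  rw [← ENNReal.ofReal_le_ofReal_iff (by positivity), ENNReal.ofReal_mul hc,
    ENNReal.ofReal_mul (by positivity)]
  calc _ ≤ ENNReal.ofReal c * (ENNReal.ofReal ((2 * Real.pi) ^ 3) * wn (jb (s + k)) f) := by gcongr
    _ = ENNReal.ofReal ((2 * Real.pi) ^ 3) * (ENNReal.ofReal c * wn (jb (s + k)) f) := by ring
    _ ≤ _ := by gcongr

/-- The energy variable of the wave equation, in the normal form that removes an oscillating source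
`Δ f`; here `κ = (4 ω² γ²)⁻¹`, where `2 ω` is the frequency of `f`. -/
noncomputable def waveY (s : ℝ) (n : ℕ) (γ κ σ : ℝ) (q q1 f f1 : ℝ → L2 d) (t : ℝ) : L2 d :=
  (γ : ℂ) • mulOp (fun ξ => (aw s n (-1) ξ : ℂ)) (ft (q1 t))
    + (-(γ * κ) : ℂ) • mulOp (fun ξ => (aw s n (1 : ℕ) ξ : ℂ)) (ft (f1 t))
    + (Complex.I * σ) • mulOp (fun ξ => (aw s n (0 : ℕ) ξ : ℂ)) (ft (q t))
    + (-(Complex.I * σ * κ)) • mulOp (fun ξ => (aw s n (2 : ℕ) ξ : ℂ)) (ft (f t))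

section Wave

variable {s γ κ ω T σ : ℝ} {n : ℕ} {q q1 q2 f f1 f2 p g h : ℝ → L2 d}

theorem waveY_deriv (hγ : 0 < γ) (hκ : 4 * ω ^ 2 * γ ^ 2 * κ = 1) (hσ : σ ^ 2 = 1) {t : ℝ}
    (dq : HasDerivWithinAt q (q1 t) (Icc 0 T) t) (dq1 : HasDerivWithinAt q1 (q2 t) (Icc 0 T) t)
    (df : HasDerivWithinAt f (f1 t) (Icc 0 T) t) (df1 : HasDerivWithinAt f1 (f2 t) (Icc 0 T) t)
    (hf2 : f2 t = (-(4 * ω ^ 2) : ℂ) • f t + p t)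
    (eq : (fun ξ => (γ ^ 2 : ℂ) * ft (q2 t) ξ) =ᵐ[volume]
      fun ξ => -(lam ξ : ℂ) * (ft (q t) ξ + ft (f t) ξ + ft (g t) ξ) + ft (h t) ξ) :
    ∃ Y' : L2 d, HasDerivWithinAt (waveY s n γ κ σ q q1 f f1) Y' (Icc 0 T) t ∧
      Y' =ᵐ[volume] fun ξ => Complex.I * ((σ * (kap ξ / γ) : ℝ) : ℂ)
          * waveY s n γ κ σ q q1 f f1 t ξ
        + ((-(γ : ℂ)⁻¹) • mulOp (fun ξ => (aw s n (1 : ℕ) ξ : ℂ)) (ft (g t))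
          + (γ : ℂ)⁻¹ • mulOp (fun ξ => (aw s n (-1) ξ : ℂ)) (ft (h t))
          + (-(γ * κ) : ℂ) • mulOp (fun ξ => (aw s n (1 : ℕ) ξ : ℂ)) (ft (p t))
          + (-(κ / γ) : ℂ) • mulOp (fun ξ => (aw s n (3 : ℕ) ξ : ℂ)) (ft (f t)) : L2 d) ξ := by
  have m0 := memLp_top_aw (d := d) s n (-1)
  have m1 := memLp_top_aw (d := d) s n (0 : ℕ)
  have m2 := memLp_top_aw (d := d) s n (1 : ℕ)
  have m3 := memLp_top_aw (d := d) s n (2 : ℕ)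
  have m4 := memLp_top_aw (d := d) s n (3 : ℕ)
  set A0 : L2 d →L[ℂ] L2 d := mulOp fun ξ => (aw s n (-1) ξ : ℂ) with hA0
  set A1 : L2 d →L[ℂ] L2 d := mulOp fun ξ => (aw s n (0 : ℕ) ξ : ℂ) with hA1
  set A2 : L2 d →L[ℂ] L2 d := mulOp fun ξ => (aw s n (1 : ℕ) ξ : ℂ) with hA2
  set A3 : L2 d →L[ℂ] L2 d := mulOp fun ξ => (aw s n (2 : ℕ) ξ : ℂ) with hA3
  set A4 : L2 d →L[ℂ] L2 d := mulOp fun ξ => (aw s n (3 : ℕ) ξ : ℂ) with hA4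
  have h1 := (hasDerivWithinAt_clm (A0.comp ft) dq1).const_smul (γ : ℂ)
  have h2 := (hasDerivWithinAt_clm (A2.comp ft) df1).const_smul (-(γ * κ) : ℂ)
  have h3 := (hasDerivWithinAt_clm (A1.comp ft) dq).const_smul (Complex.I * σ)
  have h4 := (hasDerivWithinAt_clm (A3.comp ft) df).const_smul (-(Complex.I * σ * κ))
  refine ⟨(γ : ℂ) • A0 (ft (q2 t)) + (-(γ * κ) : ℂ) • A2 (ft (f2 t))
    + (Complex.I * σ) • A1 (ft (q1 t)) + (-(Complex.I * σ * κ)) • A3 (ft (f1 t)),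
    ((h1.add h2).add h3).add h4, ?_⟩
  have e2 : waveY s n γ κ σ q q1 f f1 t = (γ : ℂ) • A0 (ft (q1 t))
    + (-(γ * κ) : ℂ) • A2 (ft (f1 t)) + (Complex.I * σ) • A1 (ft (q t))
    + (-(Complex.I * σ * κ)) • A3 (ft (f t)) := rfl
  have hf3 : ft (f2 t) =ᵐ[volume] fun ξ => -(4 * ω ^ 2) * ft (f t) ξ + ft (p t) ξ := by
    have := coeFn_lin2 (-(4 * ω ^ 2) : ℂ) 1 (ft (f t)) (ft (p t))
    rw [hf2, map_add, map_smul]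
    filter_upwards [this] with ξ hξ
    rw [one_smul] at hξ
    rw [hξ, one_mul]
  rw [e2]
  filter_upwards [eq, hf3,
    coeFn_lin4 (γ : ℂ) (-(γ * κ) : ℂ) (Complex.I * σ) (-(Complex.I * σ * κ)) (A0 (ft (q2 t)))
      (A2 (ft (f2 t))) (A1 (ft (q1 t))) (A3 (ft (f1 t))),
    coeFn_lin4 (γ : ℂ) (-(γ * κ) : ℂ) (Complex.I * σ) (-(Complex.I * σ * κ)) (A0 (ft (q1 t)))
      (A2 (ft (f1 t))) (A1 (ft (q t))) (A3 (ft (f t))),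
    coeFn_lin4 (-(γ : ℂ)⁻¹) (γ : ℂ)⁻¹ (-(γ * κ) : ℂ) (-(κ / γ) : ℂ) (A2 (ft (g t)))
      (A0 (ft (h t))) (A2 (ft (p t))) (A4 (ft (f t))),
    coeFn_mulOp m0 (ft (q2 t)), coeFn_mulOp m2 (ft (f2 t)), coeFn_mulOp m1 (ft (q1 t)),
    coeFn_mulOp m3 (ft (f1 t)), coeFn_mulOp m0 (ft (q1 t)), coeFn_mulOp m2 (ft (f1 t)),
    coeFn_mulOp m1 (ft (q t)), coeFn_mulOp m3 (ft (f t)), coeFn_mulOp m2 (ft (g t)),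
    coeFn_mulOp m0 (ft (h t)), coeFn_mulOp m2 (ft (p t)), coeFn_mulOp m4 (ft (f t))]
    with ξ g0 g1 g2 g3 g4 k1 k2 k3 k4 k5 k6 k7 k8 k9 l1 l2 l3
  rw [g2, g3, g4, k1, k2, k3, k4, k5, k6, k7, k8, k9, l1, l2, l3, g1]
  have a1 : aw s n (0 : ℕ) ξ = aw s n (-1) ξ * kap ξ := by
    have := aw_add s n (-1) 1 ξ; simpa using this
  have a2 : aw s n (1 : ℕ) ξ = aw s n (-1) ξ * kap ξ ^ 2 := by
    have := aw_add s n (-1) 2 ξ; simpa using this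
  have a3 : aw s n (2 : ℕ) ξ = aw s n (-1) ξ * kap ξ ^ 3 := by
    have := aw_add s n (-1) 3 ξ; simpa using this
  have a4 : aw s n (3 : ℕ) ξ = aw s n (-1) ξ * kap ξ ^ 4 := by
    have := aw_add s n (-1) 4 ξ; simpa using this
  rw [a1, a2, a3, a4]
  rw [lam_eq] at g0
  have hγ' : (γ : ℂ) ≠ 0 := by exact_mod_cast hγ.ne'
  have hσ' : (σ : ℂ) ^ 2 = 1 := by exact_mod_cast hσ
  have hκ' : 4 * (ω : ℂ) ^ 2 * γ ^ 2 * κ = 1 := by exact_mod_cast hκ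
  push_cast at g0 ⊢
  generalize (aw s n (-1) ξ : ℂ) = A at *
  generalize (kap ξ : ℂ) = k at *
  generalize ft (q2 t) ξ = Q2 at *
  generalize ft (q1 t) ξ = Q1 at *
  generalize ft (q t) ξ = Q at *
  generalize ft (f t) ξ = F at *
  generalize ft (f1 t) ξ = F1 at *
  generalize ft (g t) ξ = G at *
  generalize ft (h t) ξ = H at *
  generalize ft (p t) ξ = P at *
  field_simp
  linear_combination A * g0 + A * k ^ 2 * F * hκ' + (A * k ^ 4 * F * κ - A * k ^ 2 * Q) *
    (Complex.I ^ 2 * hσ' + Complex.I_sq)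

/-- The constant of the energy estimate of the wave equation. -/
noncomputable def wE (T : ℝ) (A : ℝ≥0) : ℝ :=
  (2 * Real.pi) ^ 3 * A * (Real.sqrt ((8 + 32 * T) * Real.exp T) + 2)

theorem wE_nonneg (T : ℝ) (A : ℝ≥0) : 0 ≤ wE T A := by unfold wE; positivity

/-- Bounds that are uniform in the cutoff of the weights are bounds without the cutoff. The origin,
where `|ξ|ʲ` is singular or takes a junk value, is a null set because `d ≥ 1`. -/
theorem wn_jb_le_of_aw (hd : 1 ≤ d) {f : L2 d} {j : ℤ} {r c : ℝ} {B : ℝ≥0∞} (hc : 0 ≤ c)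
    (hr : ∀ ξ : Space d, ξ ≠ 0 → jb r ξ ≤ c * (jb s ξ * kap ξ ^ j))
    (h : ∀ n, wn (aw s n j) f ≤ B) : wn (jb r) f ≤ ENNReal.ofReal c * B := by
  have : Nonempty (Fin d) := ⟨⟨0, hd⟩⟩
  refine wn_le_of_tendsto (V := fun n ξ => c * aw s n j ξ)
    (fun n => (measurable_aw s n j).const_mul c) ?_ fun n => ?_
  · have h0 : ∀ᵐ ξ : Space d, ξ ≠ 0 := compl_mem_ae_iff.2 (measure_singleton 0)
    filter_upwards [h0] with ξ hξ
    have hn : 0 < ‖ξ‖ := norm_pos_iff.2 hξ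
    filter_upwards [tendsto_natCast_atTop_atTop.eventually (eventually_ge_atTop ‖ξ‖),
      tendsto_natCast_atTop_atTop.eventually (eventually_ge_atTop ‖ξ‖⁻¹)] with n h1 h2
    rw [abs_of_pos (jb_pos _ _), abs_of_nonneg (mul_nonneg hc (aw_nonneg _ _ _ _)), aw,
      indicator_of_mem]
    · exact hr ξ hξ
    · exact ⟨inv_le_of_inv_le₀ hn (by linarith), by linarith⟩
  · refine (wn_le_const_mul (V := aw s n j) (C := c) (fun ξ => ?_) f).trans ?_
    · rw [abs_mul, abs_of_nonneg hc]
    · gcongr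
      exact h n

/-- The energy estimate of the wave equation `γ² ∂ₜₜq = Δ(q + f + g) + h` with zero data, where `f`
oscillates with the frequency `2 ω` up to the error `p` in its equation, while `g` and `h` are of
size `γ²`. The energy is that of `|ξ|⁻¹ q`, so `Δ g` costs one derivative of `g`, and `h` has to be
controlled with the weight `|ξ|⁻¹`. -/
theorem wave_bounds (hd : 1 ≤ d) (hT : 0 ≤ T) (hγ : 0 < γ) (hγ1 : γ ≤ 1) (hκ0 : 0 ≤ κ)
    (hκ : 4 * ω ^ 2 * γ ^ 2 * κ = 1) {A : ℝ≥0}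
    (dq : ∀ t ∈ Icc 0 T, HasDerivWithinAt q (q1 t) (Icc 0 T) t)
    (dq1 : ∀ t ∈ Icc 0 T, HasDerivWithinAt q1 (q2 t) (Icc 0 T) t)
    (df : ∀ t ∈ Icc 0 T, HasDerivWithinAt f (f1 t) (Icc 0 T) t)
    (df1 : ∀ t ∈ Icc 0 T, HasDerivWithinAt f1 (f2 t) (Icc 0 T) t)
    (hf2 : ∀ t ∈ Icc 0 T, f2 t = (-(4 * ω ^ 2) : ℂ) • f t + p t)
    (eq : ∀ t ∈ Icc 0 T, (fun ξ => (γ ^ 2 : ℂ) * ft (q2 t) ξ) =ᵐ[volume]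
      fun ξ => -(lam ξ : ℂ) * (ft (q t) ξ + ft (f t) ξ + ft (g t) ξ) + ft (h t) ξ)
    (q0 : q 0 = 0) (q10 : q1 0 = 0)
    (bg : ∀ t ∈ Icc 0 T, wn (jb (s + 1)) (g t) ≤ ENNReal.ofReal (A * γ ^ 2))
    (bh : ∀ t ∈ Icc 0 T, wn (fun ξ => jb s ξ / kap ξ) (h t) ≤ ENNReal.ofReal (A * γ ^ 2))
    (bp : ∀ t ∈ Icc 0 T,
      ENNReal.ofReal (γ ^ 2 * κ) * wn (jb (s + 1)) (p t) ≤ ENNReal.ofReal (A * γ ^ 2))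
    (bf : ∀ t ∈ Icc 0 T, ENNReal.ofReal κ * wn (jb (s + 3)) (f t) ≤ ENNReal.ofReal (A * γ ^ 2))
    (bf1 : ∀ t ∈ Icc 0 T,
      ENNReal.ofReal (γ * κ) * wn (jb (s + 1)) (f1 t) ≤ ENNReal.ofReal (A * γ)) :
    ∀ t ∈ Icc 0 T, wn (jb s) (q t) ≤ ENNReal.ofReal (wE T A * γ) ∧
      wn (jb (s - 1)) (q1 t) ≤ ENNReal.ofReal (2 * Real.pi * wE T A) := by
  intro t ht
  set Q : ℝ := (2 * Real.pi) ^ 3 with hQ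
  have hQ1 : 1 ≤ Q := one_le_pow₀ (by linarith [Real.pi_gt_three])
  have hA := A.coe_nonneg
  have h0T : (0 : ℝ) ∈ Icc 0 T := ⟨le_rfl, hT⟩
  have hγγ : γ ^ 2 ≤ γ := by nlinarith
  have hQA : (A : ℝ) ≤ Q * A := le_mul_of_one_le_left hA hQ1
  have key : ∀ n : ℕ, ‖mulOp (fun ξ => (aw s n (0 : ℕ) ξ : ℂ)) (ft (q t))‖ ≤ wE T A * γ ∧
      γ * ‖mulOp (fun ξ => (aw s n (-1) ξ : ℂ)) (ft (q1 t))‖ ≤ wE T A * γ := by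
    intro n
    have src : ∀ t ∈ Icc 0 T,
        ‖((-(γ : ℂ)⁻¹) • mulOp (fun ξ => (aw s n (1 : ℕ) ξ : ℂ)) (ft (g t))
          + (γ : ℂ)⁻¹ • mulOp (fun ξ => (aw s n (-1) ξ : ℂ)) (ft (h t))
          + (-(γ * κ) : ℂ) • mulOp (fun ξ => (aw s n (1 : ℕ) ξ : ℂ)) (ft (p t))
          + (-(κ / γ) : ℂ) • mulOp (fun ξ => (aw s n (3 : ℕ) ξ : ℂ)) (ft (f t)) : L2 d)‖
          ≤ 4 * Q * A * γ := by
      intro t ht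
      have i1 := norm_aw_le (s := s) (n := n) (k := 1) (by norm_num) (f := g t) zero_le_one
        (by positivity : (0 : ℝ) ≤ A * γ ^ 2) (by
          rw [ENNReal.ofReal_one, one_mul]; exact_mod_cast bg t ht)
      have i3 := norm_aw_le (s := s) (n := n) (k := 1) (by norm_num) (f := p t)
        (by positivity : 0 ≤ γ ^ 2 * κ) (by positivity : (0 : ℝ) ≤ A * γ ^ 2)
        (by exact_mod_cast bp t ht)
      have i4 := norm_aw_le (s := s) (n := n) (k := 3) (by norm_num) (f := f t) hκ0
        (by positivity : (0 : ℝ) ≤ A * γ ^ 2) (by exact_mod_cast bf t ht)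
      have i2 : ‖mulOp (fun ξ => (aw s n (-1) ξ : ℂ)) (ft (h t))‖ ≤ A * γ ^ 2 := by
        rw [← ENNReal.ofReal_le_ofReal_iff (by positivity), ofReal_norm,
          enorm_mulOp_ft (memLp_top_aw s n (-1))]
        refine (wn_mono (fun ξ => ?_) _).trans (bh t ht)
        rw [abs_of_nonneg (aw_nonneg _ _ _ _),
          abs_of_nonneg (div_nonneg (jb_pos _ _).le (kap_nonneg ξ))]
        refine (aw_le s n (-1) ξ).trans_eq ?_
        rw [zpow_neg_one, div_eq_mul_inv]
      refine (norm_add_le _ _).trans ((add_le_add_left norm_add₃_le _).trans ?_)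
      simp only [norm_smul, norm_neg, norm_inv, norm_mul, norm_div, Complex.norm_real,
        Real.norm_eq_abs, abs_of_pos hγ, abs_of_nonneg hκ0]
      refine le_of_mul_le_mul_left ?_ hγ
      rw [mul_add, mul_add, mul_add, mul_inv_cancel_left₀ hγ.ne', mul_inv_cancel_left₀ hγ.ne']
      have e3 : γ * (κ / γ * ‖mulOp (fun ξ => (aw s n (3 : ℕ) ξ : ℂ)) (ft (f t))‖)
          = κ * ‖mulOp (fun ξ => (aw s n (3 : ℕ) ξ : ℂ)) (ft (f t))‖ := by field_simp
      rw [e3]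
      have e4 : (A : ℝ) * γ ^ 2 ≤ Q * A * γ ^ 2 := by gcongr
      nlinarith
    have cor : ∀ (σ : ℝ), |σ| = 1 → ∀ t ∈ Icc 0 T,
        ‖waveY s n γ κ σ q q1 f f1 t - ((γ : ℂ) • mulOp (fun ξ => (aw s n (-1) ξ : ℂ)) (ft (q1 t))
          + (Complex.I * σ) • mulOp (fun ξ => (aw s n (0 : ℕ) ξ : ℂ)) (ft (q t)))‖
          ≤ 2 * Q * A * γ := by
      intro σ hσ t ht
      have i1 := norm_aw_le (s := s) (n := n) (k := 1) (by norm_num) (f := f1 t)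
        (by positivity : 0 ≤ γ * κ) (by positivity : (0 : ℝ) ≤ A * γ) (by exact_mod_cast bf1 t ht)
      have i2 := norm_aw_le (s := s) (n := n) (k := 2) (by norm_num) (f := f t) hκ0
        (by positivity : (0 : ℝ) ≤ A * γ ^ 2)
        ((mul_le_mul_right (wn_jb_mono (by norm_num) _) _).trans (bf t ht))
      rw [waveY, show ∀ a b c e : L2 d, a + b + c + e - (a + c) = b + e by intros; abel]
      refine (norm_add_le _ _).trans ?_
      simp only [norm_smul, norm_neg, norm_mul, Complex.norm_real, Complex.norm_I,
        Real.norm_eq_abs, abs_of_pos hγ, abs_of_nonneg hκ0, hσ, one_mul]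
      have e4 : Q * (A * γ ^ 2) ≤ Q * (A * γ) := by gcongr
      linarith
    have dY := fun t (ht : t ∈ Icc 0 T) => waveY_deriv (s := s) (n := n) (σ := 1) hγ hκ
      (by norm_num) (dq t ht) (dq1 t ht) (df t ht) (df1 t ht) (hf2 t ht) (eq t ht)
    have dZ := fun t (ht : t ∈ Icc 0 T) => waveY_deriv (s := s) (n := n) (σ := -1) hγ hκ
      (by norm_num) (dq t ht) (dq1 t ht) (df t ht) (df1 t ht) (hf2 t ht) (eq t ht)
    have c1 := cor 1 (by norm_num)
    have c2 := cor (-1) (by norm_num)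
    have s1 := src
    clear src cor
    set Y := waveY s n γ κ 1 q q1 f f1 with hY
    set Z := waveY s n γ κ (-1) q q1 f f1 with hZ
    choose! Y' dY hYG using dY
    choose! Z' dZ hZG using dZ
    have en := energy_pair (A := 4 * Q * A * γ) le_rfl dY dZ
      (fun t ht => ⟨_, _, hYG t ht, (s1 t ht).trans (by simp)⟩)
      (fun t ht => ⟨_, _, hZG t ht, (s1 t ht).trans (by simp)⟩) t ht
    have y0 : ‖Y 0‖ ≤ 2 * Q * A * γ := by
      have := c1 0 h0T
      rwa [q0, q10, map_zero, map_zero, map_zero, smul_zero, smul_zero, add_zero, sub_zero] at this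
    have z0 : ‖Z 0‖ ≤ 2 * Q * A * γ := by
      have := c2 0 h0T
      rwa [q0, q10, map_zero, map_zero, map_zero, smul_zero, smul_zero, add_zero, sub_zero] at this
    have en2 : ‖Y t‖ ^ 2 + ‖Z t‖ ^ 2 ≤ (Q * A * γ) ^ 2 * ((8 + 32 * T) * Real.exp T) := by
      refine en.trans ?_
      have k1 := pow_le_pow_left₀ (norm_nonneg _) y0 2
      have k2 := pow_le_pow_left₀ (norm_nonneg _) z0 2
      rw [mul_zero, zero_add, one_mul, ← mul_assoc]
      refine mul_le_mul_of_nonneg_right ?_ (Real.exp_pos _).le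
      linarith
    set S := Real.sqrt ((8 + 32 * T) * Real.exp T) with hS
    have hS2 : S ^ 2 = (8 + 32 * T) * Real.exp T := Real.sq_sqrt (by positivity)
    rw [← hS2, ← mul_pow] at en2
    have yt : ‖Y t‖ ≤ Q * A * γ * S :=
      abs_le_of_sq_le_sq' (by linarith [sq_nonneg ‖Z t‖]) (by positivity) |>.2
    have zt : ‖Z t‖ ≤ Q * A * γ * S :=
      abs_le_of_sq_le_sq' (by linarith [sq_nonneg ‖Y t‖]) (by positivity) |>.2
    obtain ⟨b1, b2⟩ := norm_le_of_sum_diff (c1 t ht) (c2 t ht)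
    rw [norm_smul, Complex.norm_real, Real.norm_of_nonneg hγ.le] at b2
    have hE : wE T A * γ = Q * A * γ * S + 2 * Q * A * γ := by rw [wE]; ring
    rw [hE]
    exact ⟨b1.trans (by linarith), b2.trans (by linarith)⟩
  have hwE := wE_nonneg T A
  constructor
  · have := wn_jb_le_of_aw (s := s) (r := s) hd (f := q t) (j := (0 : ℕ)) zero_le_one
      (fun ξ _ => by simp) (fun n => by
        rw [← enorm_mulOp_ft (memLp_top_aw s n (0 : ℕ)), ← ofReal_norm]
        exact ENNReal.ofReal_le_ofReal (key n).1)
    simpa using this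
  · have := wn_jb_le_of_aw (s := s) (r := s - 1) hd (f := q1 t) (j := -1) (c := 2 * Real.pi)
      (B := ENNReal.ofReal (wE T A)) (by positivity)
      (fun ξ hξ => ?_) (fun n => by
        rw [← enorm_mulOp_ft (memLp_top_aw s n (-1)), ← ofReal_norm]
        refine ENNReal.ofReal_le_ofReal (le_of_mul_le_mul_left ?_ hγ)
        rw [mul_comm γ (wE T A)]
        exact (key n).2)
    · rwa [ENNReal.ofReal_mul (by positivity)]
    · have hk : 0 < kap ξ := by have := norm_pos_iff.2 hξ; rw [kap]; positivity
      have h1 := kap_le_jb ξ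
      have h2 : jb s ξ = jb (s - 1) ξ * jb 1 ξ := by rw [← jb_add]; congr 1; ring
      rw [zpow_neg_one, h2, ← div_eq_mul_inv, mul_div_assoc', le_div_iff₀ hk]
      nlinarith [jb_pos (s - 1) ξ]

end Wave

/-! ### The square of the modulated wave -/

/-- The time derivative of the product `u v`. -/
noncomputable def prod1 (u v u1 v1 : ℝ → L2 d) (t : ℝ) : L2 d := pm (u1 t) (v t) + pm (u t) (v1 t)

/-- The second time derivative of the product `u v`. -/
noncomputable def prod2 (u v u1 v1 u2 v2 : ℝ → L2 d) (t : ℝ) : L2 d :=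
  pm (u2 t) (v t) + pm (u1 t) (v1 t) + (pm (u1 t) (v1 t) + pm (u t) (v2 t))

/-- The data of a modulated solution together with the wave equation of `φ` and the initial layer
`w`, whose time derivatives are `w1` and `w2`. -/
structure DensData (m : ℕ) (T ε γ : ℝ) (M C : ℝ≥0)
    (φ φ1 φ2 z z1 z2 z3 ψ ψ1 ψ2 w w1 w2 : ℝ → L2 d) : Prop
    extends ModData m T ε γ M C φ φ1 φ2 z z1 z2 z3 ψ ψ1 ψ2 where
  dw : ∀ t ∈ Icc 0 T, HasDerivWithinAt w (w1 t) (Icc 0 T) t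
  dw1 : ∀ t ∈ Icc 0 T, HasDerivWithinAt w1 (w2 t) (Icc 0 T) t
  eqφ : ∀ t ∈ Icc 0 T, ft ((γ ^ 2 : ℂ) • φ2 t)
    =ᵐ[volume] fun ξ => -(lam ξ : ℂ) * ft (φ t + pm (ψ t) (ψ t)) ξ
  eqw : ∀ t ∈ Icc 0 T, ft ((γ ^ 2 : ℂ) • w2 t) =ᵐ[volume] fun ξ => -(lam ξ : ℂ) * ft (w t) ξ
  iw : w 0 = φ 0 + (2 : ℂ) • pm (z 0) (cj (z 0))
  iw1 : w1 0 = φ1 0 + (2 : ℂ) • (pm (z1 0) (cj (z 0)) + pm (z 0) (cj (z1 0)))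

section Products

variable {m : ℕ} {T ε γ : ℝ} {M C : ℝ≥0} {φ φ1 φ2 z z1 z2 z3 ψ ψ1 ψ2 : ℝ → L2 d}

theorem ModData.wn_z_lt (h : ModData m T ε γ M C φ φ1 φ2 z z1 z2 z3 ψ ψ1 ψ2) {s : ℝ}
    (hs : s ≤ m + 6) {t : ℝ} (ht : t ∈ Icc 0 T) : wn (jb s) (z t) < ∞ :=
  wn_jb_lt_top_mono hs ((h.bz t ht).trans_lt ENNReal.coe_lt_top)

theorem ModData.wn_z1_lt (h : ModData m T ε γ M C φ φ1 φ2 z z1 z2 z3 ψ ψ1 ψ2) {s : ℝ}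
    (hs : s ≤ m + 4) {t : ℝ} (ht : t ∈ Icc 0 T) : wn (jb s) (z1 t) < ∞ :=
  wn_jb_lt_top_mono hs ((h.bz1 t ht).trans_lt ENNReal.coe_lt_top)

theorem ModData.wn_z2_lt (h : ModData m T ε γ M C φ φ1 φ2 z z1 z2 z3 ψ ψ1 ψ2) {s : ℝ}
    (hs : s ≤ m + 2) {t : ℝ} (ht : t ∈ Icc 0 T) : wn (jb s) (z2 t) < ∞ := by
  refine wn_jb_lt_top_mono hs (((le_div_of_ofReal_mul_le h.hγ (h.bz2 t ht))).trans_lt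
    ENNReal.coe_lt_top)

theorem ModData.w1_z (hd : d ≤ 3)
    (h : ModData m T ε γ M C φ φ1 φ2 z z1 z2 z3 ψ ψ1 ψ2) {t : ℝ} (ht : t ∈ Icc 0 T) :
    w1 1 (z t) < ∞ :=
  w1_one_lt_top hd (h.wn_z_lt (by linarith [(Nat.cast_nonneg m : (0 : ℝ) ≤ m)]) ht)

theorem ModData.w1_z1 (hd : d ≤ 3)
    (h : ModData m T ε γ M C φ φ1 φ2 z z1 z2 z3 ψ ψ1 ψ2) {t : ℝ} (ht : t ∈ Icc 0 T) :
    w1 1 (z1 t) < ∞ :=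
  w1_one_lt_top hd (h.wn_z1_lt (by linarith [(Nat.cast_nonneg m : (0 : ℝ) ≤ m)]) ht)

theorem ModData.w1_z2 (hd : d ≤ 3)
    (h : ModData m T ε γ M C φ φ1 φ2 z z1 z2 z3 ψ ψ1 ψ2) {t : ℝ} (ht : t ∈ Icc 0 T) :
    w1 1 (z2 t) < ∞ :=
  w1_one_lt_top hd (h.wn_z2_lt (by linarith [(Nat.cast_nonneg m : (0 : ℝ) ≤ m)]) ht)

theorem ModData.hasDerivWithinAt_z_mul (hd : d ≤ 3)
    (h : ModData m T ε γ M C φ φ1 φ2 z z1 z2 z3 ψ ψ1 ψ2) {v v1 : ℝ → L2 d}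
    {t : ℝ} (ht : t ∈ Icc 0 T) (dv : HasDerivWithinAt v (v1 t) (Icc 0 T) t) :
    HasDerivWithinAt (fun t => pm (z t) (v t)) (prod1 z v z1 v1 t) (Icc 0 T) t := by
  have hm := (Nat.cast_nonneg m : (0 : ℝ) ≤ m)
  exact hasDerivWithinAt_pm hd ht (fun t ht => h.wn_z_lt (by linarith) ht)
    (h.wn_z1_lt (by linarith) ht) (h.lz t ht) dv

theorem ModData.hasDerivWithinAt_prod1 (hd : d ≤ 3)
    (h : ModData m T ε γ M C φ φ1 φ2 z z1 z2 z3 ψ ψ1 ψ2) {v v1 v2 : ℝ → L2 d}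
    {t : ℝ} (ht : t ∈ Icc 0 T) (dv : HasDerivWithinAt v (v1 t) (Icc 0 T) t)
    (dv1 : HasDerivWithinAt v1 (v2 t) (Icc 0 T) t) :
    HasDerivWithinAt (prod1 z v z1 v1) (prod2 z v z1 v1 z2 v2 t) (Icc 0 T) t := by
  have hm := (Nat.cast_nonneg m : (0 : ℝ) ≤ m)
  exact (hasDerivWithinAt_pm hd ht (fun t ht => h.wn_z1_lt (by linarith) ht)
    (h.wn_z2_lt (by linarith) ht) (h.lz1 t ht) dv).add (h.hasDerivWithinAt_z_mul hd ht dv1)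

theorem ModData.cj_φ1 (h : ModData m T ε γ M C φ φ1 φ2 z z1 z2 z3 ψ ψ1 ψ2)
    {t : ℝ} (ht : t ∈ Icc 0 T) : cj (φ1 t) = φ1 t := by
  have h1 := hasDerivWithinAt_cj (h.dφ t ht)
  have h2 : HasDerivWithinAt φ (cj (φ1 t)) (Icc 0 T) t :=
    h1.congr (fun t ht => (h.rφ t ht).symm) (h.rφ t ht).symm
  exact (uniqueDiffOn_Icc h.hT t ht).eq_deriv _ h2 (h.dφ t ht)

/-- The second derivative of `|z|²` is a commutator of the Laplacian with products of the profile
and its time derivative, because of the Schrödinger equation: it gains a factor `ξ`. -/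
theorem ModData.rho2_eq (hd : d ≤ 3) (h : ModData m T ε γ M C φ φ1 φ2 z z1 z2 z3 ψ ψ1 ψ2) {t : ℝ}
    (ht : t ∈ Icc 0 T) {F1 F2 : L2 d} (hF1 : F1 = (2 * Complex.I) • z1 t + pm (φ t) (z t))
    (hF2 : F2 = (2 * Complex.I) • z2 t + pm (z1 t) (φ t) + pm (z t) (φ1 t)) :
    prod2 z (fun t => cj (z t)) z1 (fun t => cj (z1 t)) z2 (fun t => cj (z2 t)) t
      = (-(Complex.I / 2)) • ((pm (cj (z1 t)) F1 - pm (z t) (cj F2))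
        + (pm (cj (z t)) F2 - pm (z1 t) (cj F1))) := by
  have wz := h.w1_z hd ht
  have wz1 := h.w1_z1 hd ht
  have wz2 := h.w1_z2 hd ht
  have wφ := h.w1_φ hd ht
  have f1 := coeFn_lin2 (2 * Complex.I) 1 (z1 t) (pm (φ t) (z t))
  have f2 := coeFn_lin3 (2 * Complex.I) 1 1 (z2 t) (pm (z1 t) (φ t)) (pm (z t) (φ1 t))
  simp only [one_smul] at f1 f2
  rw [← hF1] at f1
  rw [← hF2] at f2
  have r1 := coeFn_cj (φ t)
  rw [h.rφ t ht] at r1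
  have r2 := coeFn_cj (φ1 t)
  rw [h.cj_φ1 ht] at r2
  have l1 := coeFn_lin4 1 1 1 1 (pm (z2 t) (cj (z t))) (pm (z1 t) (cj (z1 t)))
    (pm (z1 t) (cj (z1 t))) (pm (z t) (cj (z2 t)))
  have l2 := coeFn_lin4 1 (-1) 1 (-1) (pm (cj (z1 t)) F1) (pm (z t) (cj F2))
    (pm (cj (z t)) F2) (pm (z1 t) (cj F1))
  have e1 : prod2 z (fun t => cj (z t)) z1 (fun t => cj (z1 t)) z2 (fun t => cj (z2 t)) t
      = (1 : ℂ) • pm (z2 t) (cj (z t)) + (1 : ℂ) • pm (z1 t) (cj (z1 t))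
        + (1 : ℂ) • pm (z1 t) (cj (z1 t)) + (1 : ℂ) • pm (z t) (cj (z2 t)) := by
    simp only [one_smul, prod2]
    abel
  have e2 : (pm (cj (z1 t)) F1 - pm (z t) (cj F2)) + (pm (cj (z t)) F2 - pm (z1 t) (cj F1))
      = (1 : ℂ) • pm (cj (z1 t)) F1 + (-1 : ℂ) • pm (z t) (cj F2)
        + (1 : ℂ) • pm (cj (z t)) F2 + (-1 : ℂ) • pm (z1 t) (cj F1) := by
    simp only [one_smul, neg_smul]
    abel
  rw [e1, e2]
  refine Lp.ext ?_
  filter_upwards [l1, l2, Lp.coeFn_smul (-(Complex.I / 2)) ((1 : ℂ) • pm (cj (z1 t)) F1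
      + (-1 : ℂ) • pm (z t) (cj F2) + (1 : ℂ) • pm (cj (z t)) F2 + (-1 : ℂ) • pm (z1 t) (cj F1)),
    f1, f2, r1, r2, coeFn_cj (z t), coeFn_cj (z1 t), coeFn_cj (z2 t), coeFn_cj F1, coeFn_cj F2,
    coeFn_pm (g := cj (z t)) wz2, coeFn_pm (g := cj (z1 t)) wz1, coeFn_pm (g := cj (z2 t)) wz,
    coeFn_pm (f := cj (z1 t)) (g := F1) (by rwa [w1_one_cj]), coeFn_pm (g := cj F2) wz,
    coeFn_pm (f := cj (z t)) (g := F2) (by rwa [w1_one_cj]), coeFn_pm (g := cj F1) wz1,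
    coeFn_pm (g := z t) wφ, coeFn_pm (g := φ t) wz1, coeFn_pm (g := φ1 t) wz]
    with x g1 g2 g3 g4 g5 g6 g7 c1 c2 c3 c4 c5 p1 p2 p3 p4 p5 p6 p7 p8 p9 p10
  rw [g3, Pi.smul_apply, g1, g2, p1, p2, p3, p4, p5, p6, p7, c1, c2, c3, c4, c5, g4, g5, p8, p9,
    p10]
  simp only [map_add, map_mul, map_ofNat, Complex.conj_I, one_mul, ← g6, ← g7, smul_eq_mul]
  linear_combination (z2 t x * conj (z t x) + 2 * z1 t x * conj (z1 t x)
    + z t x * conj (z2 t x)) * Complex.I_sq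

/-- The square of a modulated sum: the nonoscillating part, the second harmonics and the terms that
contain the remainder. -/
theorem ModData.pm_psi (hd : d ≤ 3) (h : ModData m T ε γ M C φ φ1 φ2 z z1 z2 z3 ψ ψ1 ψ2) {ω : ℝ}
    {t : ℝ} (ht : t ∈ Icc 0 T) (hr : w1 1 (modRem ψ (car ω z) t) < ∞) :
    pm (ψ t) (ψ t) = (2 : ℂ) • pm (z t) (cj (z t))
      + (car (2 * ω) (fun t => pm (z t) (z t)) t + cj (car (2 * ω) (fun t => pm (z t) (z t)) t))
      + ((2 : ℂ) • pm (car ω z t + cj (car ω z t)) (modRem ψ (car ω z) t)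
        + pm (modRem ψ (car ω z) t) (modRem ψ (car ω z) t)) := by
  have wz := h.w1_z hd ht
  have wc : w1 1 (car ω z t) < ∞ := w1_smul_lt_top _ wz
  have wa : w1 1 (car ω z t + cj (car ω z t)) < ∞ := w1_add_lt_top wc (by rwa [w1_one_cj])
  set r := modRem ψ (car ω z) t with hrd
  have hψ : ψ t = (car ω z t + cj (car ω z t)) + r := by rw [hrd, modRem]; abel
  have wψ : w1 1 (ψ t) < ∞ := by rw [hψ]; exact w1_add_lt_top wa hr
  set a := car ω z t with ha
  set S := pm (z t) (z t) with hS
  set c := car (2 * ω) (fun t => pm (z t) (z t)) t with hc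
  have l1 := coeFn_lin3 2 1 1 (pm (z t) (cj (z t))) c (cj c)
  have l2 := coeFn_lin2 2 1 (pm (a + cj a) r) (pm r r)
  simp only [one_smul] at l1 l2
  rw [← add_assoc ((2 : ℂ) • pm (z t) (cj (z t)))]
  have ho : osc (2 * ω) t = osc ω t ^ 2 := by
    rw [osc, osc, ← Complex.exp_nat_mul]; congr 1; push_cast; ring
  have ho2 : osc ω t * conj (osc ω t) = 1 := by
    rw [Complex.mul_conj, Complex.normSq_eq_norm_sq, norm_osc]; simp
  refine Lp.ext ?_
  filter_upwards [l1, l2, Lp.coeFn_add ((2 : ℂ) • pm (z t) (cj (z t)) + c + cj c)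
      ((2 : ℂ) • pm (a + cj a) r + pm r r), coeFn_pm (g := ψ t) wψ, coeFn_pm (g := cj (z t)) wz,
    coeFn_cj (z t), coeFn_cj c, coeFn_cj a, Lp.coeFn_smul (osc (2 * ω) t) S,
    Lp.coeFn_smul (osc ω t) (z t), coeFn_pm (g := z t) wz, coeFn_pm (g := r) wa,
    coeFn_pm (g := r) hr, Lp.coeFn_add (a + cj a) r, Lp.coeFn_add a (cj a)]
    with x g1 g2 g3 g4 g5 g6 g7 g8 g9 g10 g11 g12 g13 g14 g15
  rw [← hψ] at g14
  rw [g4, g3, Pi.add_apply, g1, g2, g5, g6, g7, g12, g13, g14, Pi.add_apply, g15, Pi.add_apply, g8]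
  have g9' : c x = osc ω t ^ 2 * (z t x * z t x) := by
    rw [hc, car, g9, Pi.smul_apply, hS, g11, smul_eq_mul, ho]
  have g10' : a x = osc ω t * z t x := by rw [ha, car, g10, Pi.smul_apply, smul_eq_mul]
  rw [g9', g10']
  simp only [map_mul, map_pow]
  linear_combination 2 * z t x * conj (z t x) * ho2

end Products

/-! ### Bounds of products of the profile -/

/-- The constant of the bound of `|ξ|⁻¹ ∂ₜₜ|z|²`. -/
noncomputable def rhoC (d m : ℕ) (C : ℝ≥0) : ℝ≥0 :=
  4 * (Real.toNNReal (2 ^ (((m : ℝ) - 1) / 2) * (2 * Real.pi)) * (kemb d * C)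
    * (Real.toNNReal (2 * Real.pi) * C))

theorem one_le_two_pi : 1 ≤ 2 * Real.pi := by linarith [Real.pi_gt_three]

/-- The commutator `f Δg - g Δf` gains a factor `ξ`. -/
theorem wn_commutator_le (hd : d ≤ 3) {s : ℝ} (hs : 0 ≤ s) {f g F G : L2 d} {C : ℝ≥0}
    (hf : wn (jb (s + 3)) f ≤ C) (hg : wn (jb (s + 3)) g ≤ C)
    (hF : ft F =ᵐ[volume] fun ξ => -(lam ξ : ℂ) * ft f ξ)
    (hG : ft G =ᵐ[volume] fun ξ => -(lam ξ : ℂ) * ft g ξ) :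
    wn (fun ξ => jb s ξ / kap ξ) (pm f G - pm g F)
      ≤ (2 * (Real.toNNReal (2 ^ (s / 2) * (2 * Real.pi)) * (kemb d * C)
        * (Real.toNNReal (2 * Real.pi) * C)) : ℝ≥0) := by
  have hm := measurable_jb (d := d)
  have hw : ∀ f : L2 d, wn (jb (s + 3)) f ≤ C → w1 1 f < ∞ := fun f hf =>
    w1_one_lt_top hd (wn_jb_lt_top_mono (by linarith) (hf.trans_lt ENNReal.coe_lt_top))
  have key := wn_div_kap_le (W := jb s) (b := fun ξ => 2 ^ (s / 2) * jb s ξ) (hm s)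
    ((hm s).const_mul _) (fun ξ => (jb_pos _ _).le)
    (fun ξ => mul_nonneg (by positivity) (jb_pos _ _).le) (fun ξ η => by
      have := jb_peetre hs ξ η
      linarith) (hw f hf) (hw g hg) hF hG
  have hπ := one_le_two_pi
  have h2 : (0 : ℝ) < 2 ^ (s / 2) := by positivity
  have h1 : ∀ ξ : Space d, jb (s + 1) ξ = jb s ξ * jb 1 ξ := fun ξ => jb_add s 1 ξ
  have b0 : ENNReal.ofReal (2 ^ (s / 2) * (2 * Real.pi)) * w1 (jb (s + 1)) f
      ≤ (Real.toNNReal (2 ^ (s / 2) * (2 * Real.pi)) * (kemb d * C) : ℝ≥0) := by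
    have := w1_jb_le_two hd (s + 1) f
    push_cast
    rw [ENNReal.ofReal]
    gcongr
    refine this.trans ?_
    gcongr
    refine le_trans (le_of_eq ?_) hf
    congr 2; ring
  have b1 : w1 (fun ξ => 2 ^ (s / 2) * jb s ξ * kap ξ) f
      ≤ ENNReal.ofReal (2 ^ (s / 2) * (2 * Real.pi)) * w1 (jb (s + 1)) f := by
    rw [← w1_const_mul (by positivity) (hm _)]
    refine w1_mono (fun ξ => ?_) f
    rw [h1]
    have := kap_le_jb ξ
    have := jb_pos s ξ
    calc _ ≤ 2 ^ (s / 2) * jb s ξ * (2 * Real.pi * jb 1 ξ) := by gcongr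
      _ = _ := by ring
  have b2 : w1 (fun ξ => 2 ^ (s / 2) * jb s ξ) f
      ≤ ENNReal.ofReal (2 ^ (s / 2) * (2 * Real.pi)) * w1 (jb (s + 1)) f := by
    rw [← w1_const_mul (by positivity) (hm _)]
    refine w1_mono (fun ξ => ?_) f
    have h3 := jb_mono (show s ≤ s + 1 by linarith) ξ
    have := jb_pos s ξ
    calc _ ≤ 2 ^ (s / 2) * jb (s + 1) ξ := by gcongr
      _ ≤ 2 ^ (s / 2) * (2 * Real.pi) * jb (s + 1) ξ := by
        have := jb_pos (s + 1) ξ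
        gcongr
        nlinarith
  have g0 : ENNReal.ofReal (2 * Real.pi) * wn (jb (s + 1)) g
      ≤ (Real.toNNReal (2 * Real.pi) * C : ℝ≥0) := by
    push_cast
    rw [ENNReal.ofReal]
    gcongr
    exact (wn_jb_mono (by linarith) g).trans hg
  have g1 : wn (fun ξ => jb s ξ * kap ξ) g ≤ ENNReal.ofReal (2 * Real.pi) * wn (jb (s + 1)) g := by
    refine wn_le_const_mul (fun ξ => ?_) g
    rw [abs_of_nonneg (mul_nonneg (jb_pos _ _).le (kap_nonneg ξ)), abs_of_pos (jb_pos _ _), h1]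
    have := kap_le_jb ξ
    have := jb_pos s ξ
    calc _ ≤ jb s ξ * (2 * Real.pi * jb 1 ξ) := by gcongr
      _ = _ := by ring
  have g2 : wn (jb s) g ≤ ENNReal.ofReal (2 * Real.pi) * wn (jb (s + 1)) g := by
    refine wn_le_const_mul (fun ξ => ?_) g
    have h3 := jb_mono (show s ≤ s + 1 by linarith) ξ
    rw [abs_of_pos (jb_pos _ _), abs_of_pos (jb_pos _ _)]
    have := jb_pos (s + 1) ξ
    nlinarith
  calc _ ≤ _ := key
    _ ≤ (Real.toNNReal (2 ^ (s / 2) * (2 * Real.pi)) * (kemb d * C) : ℝ≥0)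
          * (Real.toNNReal (2 * Real.pi) * C : ℝ≥0)
        + (Real.toNNReal (2 ^ (s / 2) * (2 * Real.pi)) * (kemb d * C) : ℝ≥0)
          * (Real.toNNReal (2 * Real.pi) * C : ℝ≥0) := by
        gcongr
        · exact b1.trans b0
        · exact g2.trans g0
        · exact b2.trans b0
        · exact g1.trans g0
    _ = _ := by push_cast; ring

section Dens

variable {m : ℕ} {T ε γ : ℝ} {M C : ℝ≥0} {φ φ1 φ2 z z1 z2 z3 ψ ψ1 ψ2 w w1 w2 : ℝ → L2 d}

theorem ModData.wn_rho2_le (hd : d ≤ 3) (hm : 1 ≤ m)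
    (h : ModData m T ε γ M C φ φ1 φ2 z z1 z2 z3 ψ ψ1 ψ2) {t : ℝ} (ht : t ∈ Icc 0 T) :
    wn (fun ξ => jb ((m : ℝ) - 1) ξ / kap ξ)
      (prod2 z (fun t => cj (z t)) z1 (fun t => cj (z1 t)) z2 (fun t => cj (z2 t)) t)
      ≤ rhoC d m C := by
  have hm0 : (1 : ℝ) ≤ m := by exact_mod_cast hm
  have hW : Measurable fun ξ : Space d => jb ((m : ℝ) - 1) ξ / kap ξ :=
    (measurable_jb _).div continuous_kap.measurable
  rw [h.rho2_eq hd ht rfl rfl, wn_smul]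
  have e1 := h.eq t ht
  have e2 := h.eq1 t ht
  have e1' : ft (cj ((2 * Complex.I) • z1 t + pm (φ t) (z t)))
      =ᵐ[volume] fun ξ => -(lam ξ : ℂ) * ft (cj (z t)) ξ := by
    have := ft_cj_eq_of (s := fun ξ => -lam ξ) (h := 0) (fun ξ => by simp [lam])
      (g := z t) (f := (2 * Complex.I) • z1 t + pm (φ t) (z t)) (by
        filter_upwards [e1, Lp.coeFn_zero ℂ 2 (volume : Measure (Space d))] with ξ h1 h2
        rw [h1, map_zero, h2]; simp)
    filter_upwards [this, Lp.coeFn_zero ℂ 2 (volume : Measure (Space d))] with ξ h1 h2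
    rw [h1, map_zero, map_zero, h2]; simp
  have e2' : ft (cj ((2 * Complex.I) • z2 t + pm (z1 t) (φ t) + pm (z t) (φ1 t)))
      =ᵐ[volume] fun ξ => -(lam ξ : ℂ) * ft (cj (z1 t)) ξ := by
    have := ft_cj_eq_of (s := fun ξ => -lam ξ) (h := 0) (fun ξ => by simp [lam])
      (g := z1 t) (f := (2 * Complex.I) • z2 t + pm (z1 t) (φ t) + pm (z t) (φ1 t)) (by
        filter_upwards [e2, Lp.coeFn_zero ℂ 2 (volume : Measure (Space d))] with ξ h1 h2
        rw [h1, map_zero, h2]; simp)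
    filter_upwards [this, Lp.coeFn_zero ℂ 2 (volume : Measure (Space d))] with ξ h1 h2
    rw [h1, map_zero, map_zero, h2]; simp
  have bz : wn (jb ((m : ℝ) - 1 + 3)) (z t) ≤ C :=
    (wn_jb_mono (by linarith) _).trans (h.bz t ht)
  have bz1 : wn (jb ((m : ℝ) - 1 + 3)) (z1 t) ≤ C := h.wn_z1_le' (by linarith) ht
  have k1 := wn_commutator_le hd (by linarith) (by rwa [wn_jb_cj]) bz e2' e1
  have k2 := wn_commutator_le hd (by linarith) (by rwa [wn_jb_cj]) bz1 e1' e2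
  have hI : ‖-(Complex.I / 2)‖ₑ ≤ 1 := by
    rw [← ofReal_norm, norm_neg, norm_div, Complex.norm_I, Complex.norm_two]
    exact ENNReal.ofReal_le_one.2 (by norm_num)
  refine (mul_le_mul_left hI _).trans ?_
  rw [one_mul]
  refine (wn_add_le hW _ _).trans ((add_le_add k1 k2).trans_eq ?_)
  rw [← ENNReal.coe_add, rhoC]
  congr 1; ring

theorem ModData.wn_zz_le (hd : d ≤ 3) (h : ModData m T ε γ M C φ φ1 φ2 z z1 z2 z3 ψ ψ1 ψ2) {t : ℝ}
    (ht : t ∈ Icc 0 T) {k : ℕ} (hk : k ≤ 2) :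
    wn (jb (m + k)) (pm (z t) (z t)) ≤ (pC d (m + k) * C ^ 2 : ℝ≥0) := by
  have hk' : (k : ℝ) ≤ 2 := by exact_mod_cast hk
  have hm := (Nat.cast_nonneg m : (0 : ℝ) ≤ m)
  have := wn_pm_le_peetre hd (s := (m : ℝ) + k) (by positivity) (f := z t) (g := z t)
    (h.wn_z_lt (by linarith) ht)
  refine this.trans ?_
  have b1 := (wn_jb_mono (show (m : ℝ) + k + 2 ≤ m + 6 by linarith) (z t)).trans (h.bz t ht)
  have b2 := (wn_jb_mono (show (m : ℝ) + k ≤ m + 6 by linarith) (z t)).trans (h.bz t ht)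
  push_cast
  rw [pow_two, ← mul_assoc]
  gcongr

theorem ModData.wn_zz1_le (hd : d ≤ 3) (h : ModData m T ε γ M C φ φ1 φ2 z z1 z2 z3 ψ ψ1 ψ2) {t : ℝ}
    (ht : t ∈ Icc 0 T) :
    wn (jb m) (prod1 z z z1 z1 t) ≤ (2 * (pC d m * C ^ 2) : ℝ≥0) := by
  have hm := (Nat.cast_nonneg m : (0 : ℝ) ≤ m)
  have := wn_pm_le_peetre hd hm (f := z t) (g := z1 t) (h.wn_z_lt (by linarith) ht)
  have b1 := (wn_jb_mono (show (m : ℝ) + 2 ≤ m + 6 by linarith) (z t)).trans (h.bz t ht)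
  have b2 := h.wn_z1_le' (show (m : ℝ) ≤ m + 4 by linarith) ht
  have k : wn (jb m) (pm (z t) (z1 t)) ≤ (pC d m * C ^ 2 : ℝ≥0) := by
    refine this.trans ?_
    push_cast
    rw [pow_two, ← mul_assoc]
    gcongr
  rw [prod1, pm_comm (z1 t) (z t)]
  refine (wn_add_le (measurable_jb _) _ _).trans ((add_le_add k k).trans_eq ?_)
  rw [← ENNReal.coe_add, two_mul]

theorem ModData.wn_zz2_le (hd : d ≤ 3) (h : ModData m T ε γ M C φ φ1 φ2 z z1 z2 z3 ψ ψ1 ψ2) {t : ℝ}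
    (ht : t ∈ Icc 0 T) :
    ENNReal.ofReal γ * wn (jb m) (prod2 z z z1 z1 z2 z2 t) ≤ (4 * (pC d m * C ^ 2) : ℝ≥0) := by
  have hm := (Nat.cast_nonneg m : (0 : ℝ) ≤ m)
  have hγ := ofReal_le_one_of_le h.hγ1
  have b1 := (wn_jb_mono (show (m : ℝ) + 2 ≤ m + 6 by linarith) (z t)).trans (h.bz t ht)
  have b2 := h.wn_z1_le' (show (m : ℝ) ≤ m + 4 by linarith) ht
  have b3 := h.wn_z1_le' (show (m : ℝ) + 2 ≤ m + 4 by linarith) ht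
  have b4 : ENNReal.ofReal γ * wn (jb m) (z2 t) ≤ C :=
    (mul_le_mul_right (wn_jb_mono (by linarith) _) _).trans (h.bz2 t ht)
  have k1 : ENNReal.ofReal γ * wn (jb m) (pm (z t) (z2 t)) ≤ (pC d m * C ^ 2 : ℝ≥0) := by
    have := wn_pm_le_peetre hd hm (f := z t) (g := z2 t) (h.wn_z_lt (by linarith) ht)
    calc _ ≤ ENNReal.ofReal γ * (pC d m * wn (jb (m + 2)) (z t) * wn (jb m) (z2 t)) := by gcongr
      _ = pC d m * (wn (jb (m + 2)) (z t) * (ENNReal.ofReal γ * wn (jb m) (z2 t))) := by ring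
      _ ≤ pC d m * (C * C) := by gcongr
      _ = _ := by push_cast; ring
  have k2 : ENNReal.ofReal γ * wn (jb m) (pm (z1 t) (z1 t)) ≤ (pC d m * C ^ 2 : ℝ≥0) := by
    have := wn_pm_le_peetre hd hm (f := z1 t) (g := z1 t) (h.wn_z1_lt (by linarith) ht)
    calc _ ≤ 1 * (pC d m * wn (jb (m + 2)) (z1 t) * wn (jb m) (z1 t)) := by gcongr
      _ ≤ 1 * (pC d m * C * C) := by gcongr
      _ = _ := by push_cast; ring
  rw [prod2, pm_comm (z2 t) (z t)]
  have hj := measurable_jb (d := d) (m : ℝ)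
  calc _ ≤ ENNReal.ofReal γ * ((wn (jb m) (pm (z t) (z2 t)) + wn (jb m) (pm (z1 t) (z1 t)))
        + (wn (jb m) (pm (z1 t) (z1 t)) + wn (jb m) (pm (z t) (z2 t)))) := by
        gcongr
        exact (wn_add_le hj _ _).trans (add_le_add (wn_add_le hj _ _) (wn_add_le hj _ _))
    _ = (ENNReal.ofReal γ * wn (jb m) (pm (z t) (z2 t))
          + ENNReal.ofReal γ * wn (jb m) (pm (z1 t) (z1 t)))
        + (ENNReal.ofReal γ * wn (jb m) (pm (z1 t) (z1 t))
          + ENNReal.ofReal γ * wn (jb m) (pm (z t) (z2 t))) := by ring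
    _ ≤ _ := add_le_add (add_le_add k1 k2) (add_le_add k2 k1)
    _ = _ := by push_cast; ring

end Dens

/-! ### Bounds of the density remainder -/

theorem coe_mul_ofReal_le {x A : ℝ≥0} {a b : ℝ} (hx : x ≤ A) (hab : a ≤ b) :
    (x : ℝ≥0∞) * ENNReal.ofReal a ≤ ENNReal.ofReal (A * b) := by
  rw [ENNReal.ofReal_mul A.coe_nonneg, ENNReal.ofReal_coe_nnreal]
  gcongr

theorem le_sum_five (a b c e f : ℝ≥0) : a ≤ a + b + c + e + f ∧ b ≤ a + b + c + e + f ∧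
    c ≤ a + b + c + e + f ∧ e ≤ a + b + c + e + f ∧ f ≤ a + b + c + e + f := by
  have := a.coe_nonneg
  have := b.coe_nonneg
  have := c.coe_nonneg
  have := e.coe_nonneg
  have := f.coe_nonneg
  simp only [← NNReal.coe_le_coe, NNReal.coe_add]
  refine ⟨?_, ?_, ?_, ?_, ?_⟩ <;> linarith

theorem enorm_I_mul_ofReal {a : ℝ} (ha : 0 ≤ a) : ‖Complex.I * (a : ℂ)‖ₑ = ENNReal.ofReal a := by
  rw [← ofReal_norm, norm_mul, Complex.norm_I, one_mul, Complex.norm_real, Real.norm_of_nonneg ha]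

theorem wn_add_cj_le {s : ℝ} {f : L2 d} : wn (jb s) (f + cj f) ≤ 2 * wn (jb s) f := by
  refine (wn_add_le (measurable_jb s) _ _).trans ?_
  rw [wn_jb_cj, two_mul]

/-- The constant of the sources of the wave equation for the density remainder. -/
noncomputable def qA (d m : ℕ) (K R C : ℝ≥0) : ℝ≥0 :=
  pC d m * (4 * C * R + 2 * K * R ^ 2) + 2 * rhoC d m C + 8 * (pC d m * C ^ 2)
    + pC d (m + (2 : ℕ)) * C ^ 2 + 3 * (pC d m * C ^ 2)

theorem w1_one_le_embC (s : ℝ) (f : L2 d) : w1 1 f ≤ embC d s * wn (jb s) f := by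
  have := w1_jb_le 0 s f
  rwa [sub_zero, ← one_eq_jb_zero] at this

/-- The second harmonics `e^{2iωt} z² + c.c.` of `ψ²`. -/
noncomputable def harm (ω : ℝ) (z : ℝ → L2 d) (t : ℝ) : L2 d :=
  car (2 * ω) (fun t => pm (z t) (z t)) t + cj (car (2 * ω) (fun t => pm (z t) (z t)) t)

/-- The first time derivative of the second harmonics. -/
noncomputable def harm1 (ω : ℝ) (z z1 : ℝ → L2 d) (t : ℝ) : L2 d :=
  car1 (2 * ω) (fun t => pm (z t) (z t)) (prod1 z z z1 z1) t
    + cj (car1 (2 * ω) (fun t => pm (z t) (z t)) (prod1 z z z1 z1) t)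

/-- The second time derivative of the second harmonics. -/
noncomputable def harm2 (ω : ℝ) (z z1 z2 : ℝ → L2 d) (t : ℝ) : L2 d :=
  car2 (2 * ω) (fun t => pm (z t) (z t)) (prod1 z z z1 z1) (prod2 z z z1 z1 z2 z2) t
    + cj (car2 (2 * ω) (fun t => pm (z t) (z t)) (prod1 z z z1 z1) (prod2 z z z1 z1 z2 z2) t)

/-- What is left of the second derivative of the second harmonics after its main part. -/
noncomputable def harmP (ω : ℝ) (z z1 z2 : ℝ → L2 d) (t : ℝ) : L2 d :=
  osc (2 * ω) t • (prod2 z z z1 z1 z2 z2 t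
      + (2 * (Complex.I * ((2 * ω : ℝ) : ℂ))) • prod1 z z z1 z1 t)
    + cj (osc (2 * ω) t • (prod2 z z z1 z1 z2 z2 t
      + (2 * (Complex.I * ((2 * ω : ℝ) : ℂ))) • prod1 z z z1 z1 t))

theorem harm2_eq (ω : ℝ) (z z1 z2 : ℝ → L2 d) (t : ℝ) :
    harm2 ω z z1 z2 t = (-(4 * ω ^ 2) : ℂ) • harm ω z t + harmP ω z z1 z2 t := by
  have h : car2 (2 * ω) (fun t => pm (z t) (z t)) (prod1 z z z1 z1) (prod2 z z z1 z1 z2 z2) t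
      = (-(4 * ω ^ 2) : ℂ) • car (2 * ω) (fun t => pm (z t) (z t)) t
        + osc (2 * ω) t • (prod2 z z z1 z1 z2 z2 t
          + (2 * (Complex.I * ((2 * ω : ℝ) : ℂ))) • prod1 z z z1 z1 t) := by
    rw [car2, car, smul_comm (-(4 * ω ^ 2) : ℂ), ← smul_add]
    congr 1
    push_cast
    rw [show (2 * Complex.I * (2 * ω) : ℂ) = 2 * (Complex.I * (2 * ω)) by ring,
      show (-(2 * ω) ^ 2 : ℂ) = -(4 * ω ^ 2) by ring]
    abel
  have hc : conj (-(4 * ω ^ 2) : ℂ) = -(4 * ω ^ 2) := by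
    rw [map_neg, map_mul, map_pow, map_ofNat, Complex.conj_ofReal]
  rw [harm2, h, map_add, cj_smul, hc, harm, harmP]
  module

section Dens

variable {m : ℕ} {T ε γ : ℝ} {M C : ℝ≥0} {φ φ1 φ2 z z1 z2 z3 ψ ψ1 ψ2 w w1 w2 : ℝ → L2 d}

theorem ModData.hasDerivWithinAt_harm (hd : d ≤ 3)
    (h : ModData m T ε γ M C φ φ1 φ2 z z1 z2 z3 ψ ψ1 ψ2) (ω : ℝ) {t : ℝ} (ht : t ∈ Icc 0 T) :
    HasDerivWithinAt (harm ω z) (harm1 ω z z1 t) (Icc 0 T) t ∧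
      HasDerivWithinAt (harm1 ω z z1) (harm2 ω z z1 z2 t) (Icc 0 T) t := by
  have dS := h.hasDerivWithinAt_z_mul hd ht (v := z) (v1 := z1) (h.dz t ht)
  have dS1 := h.hasDerivWithinAt_prod1 hd ht (v := z) (v1 := z1) (v2 := z2) (h.dz t ht) (h.dz1 t ht)
  have k1 := hasDerivWithinAt_car (2 * ω) dS
  have k2 := hasDerivWithinAt_car1 (2 * ω) dS dS1
  exact ⟨k1.add (hasDerivWithinAt_cj k1), k2.add (hasDerivWithinAt_cj k2)⟩

theorem ModData.wn_harm_le (hd : d ≤ 3) (h : ModData m T ε γ M C φ φ1 φ2 z z1 z2 z3 ψ ψ1 ψ2)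
    (ω : ℝ) {t : ℝ} (ht : t ∈ Icc 0 T) :
    wn (jb (m + (2 : ℕ))) (harm ω z t) ≤ 2 * (pC d (m + (2 : ℕ)) * C ^ 2 : ℝ≥0) := by
  refine wn_add_cj_le.trans ?_
  gcongr
  rw [car, wn_osc_smul]
  exact h.wn_zz_le hd ht le_rfl

theorem ModData.wn_harm1_le (hd : d ≤ 3) (h : ModData m T ε γ M C φ φ1 φ2 z z1 z2 z3 ψ ψ1 ψ2)
    {ω : ℝ} (hω : 0 ≤ ω) {t : ℝ} (ht : t ∈ Icc 0 T) :
    wn (jb m) (harm1 ω z z1 t)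
      ≤ 2 * ((2 * (pC d m * C ^ 2) : ℝ≥0) + ENNReal.ofReal (2 * ω) * (pC d m * C ^ 2 : ℝ≥0)) := by
  refine wn_add_cj_le.trans ?_
  gcongr
  rw [car1, wn_osc_smul]
  refine (wn_add_le (measurable_jb _) _ _).trans ?_
  rw [wn_smul, enorm_I_mul_ofReal (by positivity)]
  have h1 := h.wn_zz1_le hd ht
  have h2 := h.wn_zz_le hd ht (k := 0) (by norm_num)
  simp only [Nat.cast_zero, add_zero] at h2
  gcongr

theorem ModData.wn_harmP_le (hd : d ≤ 3) (h : ModData m T ε γ M C φ φ1 φ2 z z1 z2 z3 ψ ψ1 ψ2)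
    {ω : ℝ} (hω : 0 ≤ ω) {t : ℝ} (ht : t ∈ Icc 0 T) :
    wn (jb m) (harmP ω z z1 z2 t) ≤ 2 * (wn (jb m) (prod2 z z z1 z1 z2 z2 t)
      + 2 * (ENNReal.ofReal (2 * ω) * (2 * (pC d m * C ^ 2) : ℝ≥0))) := by
  refine wn_add_cj_le.trans ?_
  gcongr
  rw [wn_osc_smul]
  refine (wn_add_le (measurable_jb _) _ _).trans ?_
  rw [wn_smul, enorm_mul, enorm_I_mul_ofReal (by positivity), mul_assoc]
  have h1 := h.wn_zz1_le hd ht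
  have h2 : ‖(2 : ℂ)‖ₑ = 2 := by
    rw [← ofReal_norm, Complex.norm_two]; simp
  rw [h2]
  gcongr

/-- The part of `ψ²` that contains the remainder `r`, where `a` is the carrier wave. -/
noncomputable def crossG (a r : ℝ → L2 d) (t : ℝ) : L2 d :=
  (2 : ℂ) • pm (a t + cj (a t)) (r t) + pm (r t) (r t)

theorem ModData.wn_crossG_le (hd : d ≤ 3) (h : ModData m T ε γ M C φ φ1 φ2 z z1 z2 z3 ψ ψ1 ψ2)
    {K R : ℝ≥0} (hK : embC d m ≤ K) {r : ℝ → L2 d} (ω : ℝ) {t : ℝ} (ht : t ∈ Icc 0 T)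
    (hr : wn (jb m) (r t) ≤ ENNReal.ofReal (ε ^ 2) * R) :
    wn (jb m) (crossG (car ω z) r t)
      ≤ (pC d m * (4 * C * R + 2 * K * R ^ 2) : ℝ≥0) * ENNReal.ofReal (ε ^ 2) := by
  have hm := (Nat.cast_nonneg m : (0 : ℝ) ≤ m)
  have hj := measurable_jb (d := d) (m : ℝ)
  set e := ENNReal.ofReal (ε ^ 2) with he
  have he1 : e ≤ 1 := ENNReal.ofReal_le_one.2 (by nlinarith [h.hε, h.hεγ, h.hγ1])
  have w1r : w1 1 (r t) ≤ K * (e * R) := (w1_one_le_embC m _).trans (by gcongr)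
  have w1r' : w1 1 (r t) < ∞ := w1r.trans_lt (by
    rw [he]
    exact ENNReal.mul_lt_top ENNReal.coe_lt_top
      (ENNReal.mul_lt_top ENNReal.ofReal_lt_top ENNReal.coe_lt_top))
  have ba : wn (jb (m + 2)) (car ω z t + cj (car ω z t)) ≤ 2 * C := by
    refine wn_add_cj_le.trans ?_
    rw [car, wn_osc_smul]
    gcongr
    exact (wn_jb_mono (by linarith) _).trans (h.bz t ht)
  have p1 := wn_pm_le_peetre hd hm (f := car ω z t + cj (car ω z t)) (g := r t)
    (ba.trans_lt (ENNReal.mul_lt_top (by simp) ENNReal.coe_lt_top))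
  have p2 := wn_pm_le_tame (d := d) hm (g := r t) w1r'
  have h2 : ‖(2 : ℂ)‖ₑ = 2 := by
    rw [← ofReal_norm, Complex.norm_two]; simp
  refine (wn_add_le hj _ _).trans ?_
  rw [wn_smul, h2]
  calc _ ≤ 2 * (pC d m * (2 * C) * (e * R))
        + pC d m * ((e * R) * (K * (e * R)) + (K * (e * R)) * (e * R)) := by
        gcongr
        · exact p1.trans (by gcongr)
        · exact p2.trans (by gcongr)
    _ = pC d m * (4 * C * R) * e + pC d m * (2 * K * R ^ 2) * e * e := by ring
    _ ≤ pC d m * (4 * C * R) * e + pC d m * (2 * K * R ^ 2) * e * 1 := by gcongr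
    _ = _ := by push_cast; ring

/-- The remainder `φ + 2 |z|² - w` is differentiable, and the bounds of it and of its time
derivative. -/
theorem DensData.wn_q_le (hd1 : 1 ≤ d) (hd : d ≤ 3) (hm : 1 ≤ m)
    (h : DensData m T ε γ M C φ φ1 φ2 z z1 z2 z3 ψ ψ1 ψ2 w w1 w2) {K R : ℝ≥0} (hK : embC d m ≤ K)
    {ω : ℝ} (hω : ω = 1 / ε ^ 2)
    (hr : ∀ t ∈ Icc 0 T, wn (jb m) (modRem ψ (car ω z) t) ≤ ENNReal.ofReal (ε ^ 2) * R) :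
    (∀ t ∈ Icc 0 T, HasDerivWithinAt (fun t => φ t + (2 : ℂ) • pm (z t) (cj (z t)) - w t)
      (φ1 t + (2 : ℂ) • prod1 z (fun t => cj (z t)) z1 (fun t => cj (z1 t)) t - w1 t)
        (Icc 0 T) t) ∧
    ∀ t ∈ Icc 0 T,
      wn (jb ((m : ℝ) - 1)) (φ t + (2 : ℂ) • pm (z t) (cj (z t)) - w t)
        ≤ ENNReal.ofReal (wE T (qA d m K R C) * γ) ∧
      wn (jb ((m : ℝ) - 1 - 1))
        (φ1 t + (2 : ℂ) • prod1 z (fun t => cj (z t)) z1 (fun t => cj (z1 t)) t - w1 t)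
        ≤ ENNReal.ofReal (2 * Real.pi * wE T (qA d m K R C)) := by
  have hε := h.hε
  have hεγ := h.hεγ
  have hγ := h.hγ
  have hγ1 := h.hγ1
  have hω0 : 0 < ω := by rw [hω]; positivity
  have H := h.toModData
  have hεγ2 : ε ^ 2 ≤ γ ^ 2 := pow_le_pow_left₀ hε.le hεγ.le 2
  set zb : ℝ → L2 d := fun t => cj (z t) with hzb
  set zb1 : ℝ → L2 d := fun t => cj (z1 t) with hzb1
  set zb2 : ℝ → L2 d := fun t => cj (z2 t) with hzb2
  -- This is `(4 ω² γ²)⁻¹`, the factor gained by integrating the frequency `2 ω` twice.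
  set κ : ℝ := ε ^ 4 / (4 * γ ^ 2) with hκ
  have dρ : ∀ t ∈ Icc 0 T, HasDerivWithinAt (fun t => pm (z t) (cj (z t)))
      (prod1 z zb z1 zb1 t) (Icc 0 T) t := fun t ht =>
    H.hasDerivWithinAt_z_mul hd ht (hasDerivWithinAt_cj (h.dz t ht))
  have dρ1 : ∀ t ∈ Icc 0 T, HasDerivWithinAt (prod1 z zb z1 zb1)
      (prod2 z zb z1 zb1 z2 zb2 t) (Icc 0 T) t := fun t ht =>
    H.hasDerivWithinAt_prod1 hd ht (hasDerivWithinAt_cj (h.dz t ht))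
      (hasDerivWithinAt_cj (h.dz1 t ht))
  have dq : ∀ t ∈ Icc 0 T, HasDerivWithinAt (fun t => φ t + (2 : ℂ) • pm (z t) (cj (z t)) - w t)
      (φ1 t + (2 : ℂ) • prod1 z zb z1 zb1 t - w1 t) (Icc 0 T) t := fun t ht =>
    ((h.dφ t ht).add ((dρ t ht).const_smul (2 : ℂ))).sub (h.dw t ht)
  have dq1 : ∀ t ∈ Icc 0 T, HasDerivWithinAt
      (fun t => φ1 t + (2 : ℂ) • prod1 z zb z1 zb1 t - w1 t)
      (φ2 t + (2 : ℂ) • prod2 z zb z1 zb1 z2 zb2 t - w2 t) (Icc 0 T) t := fun t ht =>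
    ((h.dφ1 t ht).add ((dρ1 t ht).const_smul (2 : ℂ))).sub (h.dw1 t ht)
  refine ⟨dq, ?_⟩
  have hwr : ∀ t ∈ Icc 0 T, KGZ.w1 1 (modRem ψ (car ω z) t) < ∞ := fun t ht =>
    (w1_one_le_embC m _).trans_lt (ENNReal.mul_lt_top (hK.trans_lt ENNReal.coe_lt_top)
      ((hr t ht).trans_lt (ENNReal.mul_lt_top ENNReal.ofReal_lt_top ENNReal.coe_lt_top)))
  set P := pC d m with hP
  set A := qA d m K R C with hA
  obtain ⟨a1, a2, a3, a4, a5⟩ := le_sum_five (P * (4 * C * R + 2 * K * R ^ 2)) (2 * rhoC d m C)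
    (8 * (P * C ^ 2)) (pC d (m + (2 : ℕ)) * C ^ 2) (3 * (P * C ^ 2))
  rw [hP, ← qA, ← hA] at a1 a2 a3 a4 a5
  rw [← hP] at a1 a3 a5
  refine wave_bounds (κ := κ) (ω := ω) (f := harm ω z) (f1 := harm1 ω z z1) (f2 := harm2 ω z z1 z2)
    (p := harmP ω z z1 z2) (g := crossG (car ω z) (modRem ψ (car ω z)))
    (h := fun t => ((2 * γ ^ 2 : ℝ) : ℂ) • prod2 z zb z1 zb1 z2 zb2 t) hd1 h.hT.le hγ hγ1
    (by positivity) (by rw [hω, hκ]; field_simp) dq dq1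
    (fun t ht => (H.hasDerivWithinAt_harm hd ω ht).1)
    (fun t ht => (H.hasDerivWithinAt_harm hd ω ht).2) (fun t _ => harm2_eq ω z z1 z2 t)
    (fun t ht => ?_) ?_ ?_ (fun t ht => ?_) (fun t ht => ?_) (fun t ht => ?_) (fun t ht => ?_)
    (fun t ht => ?_)
    -- The wave equation of the remainder: `2 |z|²` in `ψ²` cancels, and its second time derivative
    -- becomes a source.
  · have e1 := h.eqφ t ht
    have e2 := h.eqw t ht
    rw [H.pm_psi hd ht (hwr t ht)] at e1
    rw [show φ t + ((2 : ℂ) • pm (z t) (cj (z t))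
      + (car (2 * ω) (fun t => pm (z t) (z t)) t + cj (car (2 * ω) (fun t => pm (z t) (z t)) t))
      + ((2 : ℂ) • pm (car ω z t + cj (car ω z t)) (modRem ψ (car ω z) t)
        + pm (modRem ψ (car ω z) t) (modRem ψ (car ω z) t)))
      = (1 : ℂ) • φ t + (2 : ℂ) • pm (z t) (cj (z t)) + (1 : ℂ) • harm ω z t
        + (1 : ℂ) • crossG (car ω z) (modRem ψ (car ω z)) t by
      simp only [one_smul, harm, crossG]; abel] at e1
    rw [show φ t + (2 : ℂ) • pm (z t) (cj (z t)) - w t = (1 : ℂ) • φ t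
      + (2 : ℂ) • pm (z t) (cj (z t)) + (-1 : ℂ) • w t by simp [sub_eq_add_neg],
      show φ2 t + (2 : ℂ) • prod2 z zb z1 zb1 z2 zb2 t - w2 t = (1 : ℂ) • φ2 t
      + (2 : ℂ) • prod2 z zb z1 zb1 z2 zb2 t + (-1 : ℂ) • w2 t by simp [sub_eq_add_neg]]
    simp only [map_add, map_smul] at e1 e2 ⊢
    filter_upwards [e1, e2, Lp.coeFn_smul (γ ^ 2 : ℂ) (ft (φ2 t)),
      Lp.coeFn_smul (γ ^ 2 : ℂ) (ft (w2 t)),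
      coeFn_lin4 1 2 1 1 (ft (φ t)) (ft (pm (z t) (cj (z t)))) (ft (harm ω z t))
        (ft (crossG (car ω z) (modRem ψ (car ω z)) t)),
      coeFn_lin3 1 2 (-1) (ft (φ t)) (ft (pm (z t) (cj (z t)))) (ft (w t)),
      coeFn_lin3 1 2 (-1) (ft (φ2 t)) (ft (prod2 z zb z1 zb1 z2 zb2 t)) (ft (w2 t)),
      Lp.coeFn_smul ((2 * γ ^ 2 : ℝ) : ℂ) (ft (prod2 z zb z1 zb1 z2 zb2 t))]
      with ξ g1 g2 g3 g4 g5 g6 g7 g8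
    rw [g3, Pi.smul_apply, g5, smul_eq_mul] at g1
    rw [g4, Pi.smul_apply, smul_eq_mul] at g2
    rw [g6, g7, g8, Pi.smul_apply, smul_eq_mul]
    push_cast
    linear_combination g1 - g2
  · simp only [h.iw]; abel
  · simp only [h.iw1, prod1, hzb, hzb1]; abel
  · rw [sub_add_cancel]
    exact (H.wn_crossG_le hd hK ω ht (hr t ht)).trans (coe_mul_ofReal_le a1 hεγ2)
  · rw [wn_smul, ← ofReal_norm, Complex.norm_real, Real.norm_of_nonneg (by positivity)]
    refine (mul_le_mul_right (H.wn_rho2_le hd hm ht) _).trans ?_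
    refine le_trans (le_of_eq ?_) (coe_mul_ofReal_le a2 le_rfl)
    rw [ENNReal.ofReal_mul zero_le_two]
    push_cast
    simp
    ring
    -- The bound of `p`: it is of order `ω + γ⁻¹`, and `γ² κ ω ≤ ε²`, `γ κ ≤ ε²`.
  · rw [sub_add_cancel]
    have b1 := H.wn_zz2_le hd ht
    have b2 := H.wn_harmP_le hd hω0.le ht
    refine le_trans ?_ (coe_mul_ofReal_le a3 (le_refl (γ ^ 2)))
    have c1 : ENNReal.ofReal (γ ^ 2 * κ) * 2 ≤ ENNReal.ofReal (γ ^ 2) * ENNReal.ofReal γ := by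
      rw [← ENNReal.ofReal_mul (by positivity), show (2 : ℝ≥0∞) = ENNReal.ofReal 2 by simp,
        ← ENNReal.ofReal_mul (by positivity)]
      refine ENNReal.ofReal_le_ofReal ?_
      have e1 : γ ^ 2 * κ * 2 = ε ^ 2 * ε ^ 2 / 2 := by rw [hκ]; field_simp; norm_num
      rw [e1]
      have e2 : ε ^ 2 ≤ γ := by nlinarith
      have e3 : ε ^ 2 * ε ^ 2 ≤ γ ^ 2 * γ := by gcongr
      linarith [mul_pos (pow_pos hγ 2) hγ]
    have c2 : ENNReal.ofReal (γ ^ 2 * κ) * (2 * (2 * ENNReal.ofReal (2 * ω)))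
        ≤ 2 * ENNReal.ofReal (γ ^ 2) := by
      rw [show (2 : ℝ≥0∞) = ENNReal.ofReal 2 by simp, ← ENNReal.ofReal_mul (by positivity),
        ← ENNReal.ofReal_mul (by positivity), ← ENNReal.ofReal_mul (by positivity),
        ← ENNReal.ofReal_mul (by positivity)]
      refine ENNReal.ofReal_le_ofReal ?_
      have e1 : γ ^ 2 * κ * (2 * (2 * (2 * ω))) = 2 * ε ^ 2 := by rw [hκ, hω]; field_simp; norm_num
      linarith
    calc _ ≤ ENNReal.ofReal (γ ^ 2 * κ) * (2 * (wn (jb m) (prod2 z z z1 z1 z2 z2 t)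
          + 2 * (ENNReal.ofReal (2 * ω) * (2 * (P * C ^ 2) : ℝ≥0)))) := by gcongr
      _ = ENNReal.ofReal (γ ^ 2 * κ) * 2 * wn (jb m) (prod2 z z z1 z1 z2 z2 t)
          + ENNReal.ofReal (γ ^ 2 * κ) * (2 * (2 * ENNReal.ofReal (2 * ω)))
            * (2 * (P * C ^ 2) : ℝ≥0) := by ring
      _ ≤ ENNReal.ofReal (γ ^ 2) * ENNReal.ofReal γ * wn (jb m) (prod2 z z z1 z1 z2 z2 t)
          + 2 * ENNReal.ofReal (γ ^ 2) * (2 * (P * C ^ 2) : ℝ≥0) := by gcongr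
      _ = ENNReal.ofReal (γ ^ 2) * (ENNReal.ofReal γ * wn (jb m) (prod2 z z z1 z1 z2 z2 t))
          + 2 * ENNReal.ofReal (γ ^ 2) * (2 * (P * C ^ 2) : ℝ≥0) := by ring
      _ ≤ ENNReal.ofReal (γ ^ 2) * (4 * (P * C ^ 2) : ℝ≥0)
          + 2 * ENNReal.ofReal (γ ^ 2) * (2 * (P * C ^ 2) : ℝ≥0) := by gcongr
      _ = _ := by push_cast; ring
  · have b := H.wn_harm_le hd ω ht
    rw [show (m : ℝ) - 1 + 3 = m + (2 : ℕ) by push_cast; ring]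
    refine le_trans ?_ (coe_mul_ofReal_le a4 (le_refl (γ ^ 2)))
    have c1 : ENNReal.ofReal κ * 2 ≤ ENNReal.ofReal (γ ^ 2) := by
      rw [show (2 : ℝ≥0∞) = ENNReal.ofReal 2 by simp, ← ENNReal.ofReal_mul (by positivity)]
      refine ENNReal.ofReal_le_ofReal ?_
      rw [hκ, div_mul_eq_mul_div, div_le_iff₀ (by positivity)]
      nlinarith [mul_le_mul hεγ2 hεγ2 (by positivity) (by positivity), pow_pos hγ 4]
    calc _ ≤ ENNReal.ofReal κ * (2 * (pC d (m + (2 : ℕ)) * C ^ 2 : ℝ≥0)) := by gcongr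
      _ = ENNReal.ofReal κ * 2 * (pC d (m + (2 : ℕ)) * C ^ 2 : ℝ≥0) := by ring
      _ ≤ ENNReal.ofReal (γ ^ 2) * (pC d (m + (2 : ℕ)) * C ^ 2 : ℝ≥0) := by gcongr
      _ = _ := by ring
  · rw [sub_add_cancel]
    have b := H.wn_harm1_le hd hω0.le ht
    refine le_trans ?_ (coe_mul_ofReal_le a5 (le_refl γ))
    have e2 : ε ^ 2 ≤ 1 := by nlinarith
    have c1 : ENNReal.ofReal (γ * κ) * 2 ≤ ENNReal.ofReal γ := by
      rw [show (2 : ℝ≥0∞) = ENNReal.ofReal 2 by simp, ← ENNReal.ofReal_mul (by positivity)]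
      refine ENNReal.ofReal_le_ofReal ?_
      have e1 : γ * κ * 2 = ε ^ 2 * ε ^ 2 / (2 * γ) := by rw [hκ]; field_simp; norm_num
      rw [e1, div_le_iff₀ (by positivity)]
      nlinarith [mul_le_mul hεγ2 e2 (by positivity) (by positivity)]
    have c2 : ENNReal.ofReal (γ * κ) * (2 * ENNReal.ofReal (2 * ω)) ≤ ENNReal.ofReal γ := by
      rw [show (2 : ℝ≥0∞) = ENNReal.ofReal 2 by simp, ← ENNReal.ofReal_mul (by positivity),
        ← ENNReal.ofReal_mul (by positivity)]
      refine ENNReal.ofReal_le_ofReal ?_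
      have e1 : γ * κ * (2 * (2 * ω)) = ε ^ 2 / γ := by rw [hκ, hω]; field_simp; norm_num
      rw [e1, div_le_iff₀ hγ]
      linarith
    calc _ ≤ ENNReal.ofReal (γ * κ) * (2 * ((2 * (P * C ^ 2) : ℝ≥0)
          + ENNReal.ofReal (2 * ω) * (P * C ^ 2 : ℝ≥0))) := by gcongr
      _ = ENNReal.ofReal (γ * κ) * 2 * (2 * (P * C ^ 2) : ℝ≥0)
          + ENNReal.ofReal (γ * κ) * (2 * ENNReal.ofReal (2 * ω)) * (P * C ^ 2 : ℝ≥0) := by ring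
      _ ≤ ENNReal.ofReal γ * (2 * (P * C ^ 2) : ℝ≥0)
          + ENNReal.ofReal γ * (P * C ^ 2 : ℝ≥0) := by gcongr
      _ = _ := by push_cast; ring

end Dens

/-! ### From solutions to the data of the estimates -/

theorem cj_eq_self {f : L2 d} (h : ∀ᵐ x, (f x).im = 0) : cj f = f := by
  refine Lp.ext ?_
  filter_upwards [coeFn_cj f, h] with x h1 h2
  rw [h1, Complex.conj_eq_iff_im.2 h2]

theorem real_smul_eq (a : ℝ) (f : L2 d) : a • f = (a : ℂ) • f := by
  refine Lp.ext ?_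
  filter_upwards [Lp.coeFn_smul a f, Lp.coeFn_smul (a : ℂ) f] with x h1 h2
  rw [h1, h2, Pi.smul_apply, Pi.smul_apply, Complex.real_smul, smul_eq_mul]

theorem cj_deriv {T : ℝ} (hT : 0 < T) {u : ℝ → L2 d} {u' : L2 d} {t : ℝ} (ht : t ∈ Icc 0 T)
    (hu : ∀ t ∈ Icc 0 T, cj (u t) = u t) (h : HasDerivWithinAt u u' (Icc 0 T) t) : cj u' = u' := by
  have h2 : HasDerivWithinAt u (cj u') (Icc 0 T) t :=
    (hasDerivWithinAt_cj h).congr (fun t ht => (hu t ht).symm) (hu t ht).symm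
  exact (uniqueDiffOn_Icc hT t ht).eq_deriv _ h2 h

theorem hasDerivWithinAt_dt_zero {T : ℝ} (hT : 0 < T) {n : ℕ} {u : ℝ → L2 d}
    (hu : ContDiffOn ℝ n u (Icc 0 T)) (hn : 0 < n) {t : ℝ} (ht : t ∈ Icc 0 T) :
    HasDerivWithinAt u (dt T 1 u t) (Icc 0 T) t := by
  have h := hasDerivWithinAt_dt hT hu (k := 0) hn ht
  rw [dt_zero] at h
  exact h

theorem wn_le_supNorm {T s : ℝ} {u : ℝ → L2 d} {t : ℝ} (ht : t ∈ Icc 0 T) :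
    wn (jb s) (u t) ≤ supNorm T s u := by
  rw [← hNorm_eq_wn]
  exact le_iSup₂_of_le t ht le_rfl

section Solution

variable {m : ℕ} {T ε γ : ℝ} {M C : ℝ≥0} {ψ₀ ψ₁ φ₀ φ₁ : L2 d} {ψ φ z w z2 z3 : ℝ → L2 d}

theorem profileData_of_solution (hd : d ≤ 3) (hT : 0 < T) (hγ : 0 < γ) (hγ1 : γ ≤ 1)
    (hs : IsSolution T ε γ ψ₀ ψ₁ φ₀ φ₁ ψ φ) (hA : assumedNorm m T γ ψ₀ ψ₁ φ ≤ M)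
    (hz : IsProfile T ψ₀ ψ₁ φ z) :
    ProfileData m T γ M φ (dt T 1 φ) (dt T 2 φ) z (dt T 1 z) := by
  have hm := (Nat.cast_nonneg m : (0 : ℝ) ≤ m)
  have cφ : ContDiffOn ℝ (2 : ℕ) φ (Icc 0 T) := hs.contDiffOn_phi
  have cz : ContDiffOn ℝ (1 : ℕ) z (Icc 0 T) := by simpa using hz.contDiffOn
  have b : ∀ {x : ℝ≥0∞}, x ≤ assumedNorm m T γ ψ₀ ψ₁ φ → x ≤ M := fun h => h.trans hA
  have b1 : ∀ t ∈ Icc 0 T, wn (jb (m + 6)) (φ t) ≤ M := fun t ht => b <| by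
    rw [assumedNorm, add_assoc (hNorm _ _ + hNorm _ _ + _)]
    exact (wn_le_supNorm ht).trans (le_add_self.trans le_self_add)
  refine ⟨hT, hγ, hγ1, fun t ht => hasDerivWithinAt_dt_zero hT cφ (by norm_num) ht,
    fun t ht => hasDerivWithinAt_dt hT cφ (by norm_num) ht, continuousOn_dt hT cφ le_rfl,
    fun t ht => hasDerivWithinAt_dt_zero hT cz (by norm_num) ht, continuousOn_dt hT cz le_rfl,
    fun t ht => ?_, b1, fun t ht => b ?_, fun t ht => b ?_, b ?_⟩
  · refine LaplacianEq.fourier ((hz.eq t ht).congr ae_eq_rfl ?_)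
    have hw : w1 1 (φ t) < ∞ := w1_one_lt_top hd (wn_jb_lt_top_mono (by linarith)
      ((b1 t ht).trans_lt ENNReal.coe_lt_top))
    filter_upwards [coeFn_lin2 (2 * Complex.I) 1 (dt T 1 z t) (pm (φ t) (z t)),
      coeFn_pm (g := z t) hw] with x h1 h2
    rw [one_smul] at h1
    rw [h1, h2, one_mul]
  · rw [assumedNorm]
    refine le_trans ?_ le_self_add
    refine le_trans ?_ le_add_self
    gcongr
    exact wn_le_supNorm ht
  · rw [assumedNorm]
    refine le_trans ?_ le_add_self
    gcongr
    exact wn_le_supNorm ht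
  · rw [assumedNorm, hNorm_eq_wn, hNorm_eq_wn, hz.init, wn_smul]
    have h1 : ‖(1 / 2 : ℂ)‖ₑ ≤ 1 := by
      rw [← ofReal_norm]; exact ENNReal.ofReal_le_one.2 (by norm_num)
    have h2 : ‖Complex.I‖ₑ = 1 := by rw [← ofReal_norm]; simp
    calc _ ≤ 1 * (wn (jb (m + 6)) ψ₀ + wn (jb (m + 6)) ψ₁) := by
          gcongr
          refine (wn_sub_le (measurable_jb _) _ _).trans_eq ?_
          rw [wn_smul, h2, one_mul]
      _ ≤ _ := by
          rw [one_mul, add_assoc, add_assoc]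
          exact le_self_add

/-- The initial values of `ψ` and `∂ₜψ` are those of the leading part of the carrier wave since `z₀
= (ψ₀ - iψ₁) / 2` with real `ψ₀` and `ψ₁`; the remainder starts with `r = 0` and a bounded `∂ₜr`. -/
theorem modData_of_solution (hd : d ≤ 3) (hε : 0 < ε) (hεγ : ε < γ)
    (hs : IsSolution T ε γ ψ₀ ψ₁ φ₀ φ₁ ψ φ) (hz : IsProfile T ψ₀ ψ₁ φ z)
    (hP : ProfileData m T γ M φ (dt T 1 φ) (dt T 2 φ) z (dt T 1 z))
    (dz1 : ∀ t ∈ Icc 0 T, HasDerivWithinAt (dt T 1 z) (z2 t) (Icc 0 T) t)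
    (dz2 : ∀ t ∈ Icc 0 T, HasDerivWithinAt z2 (z3 t) (Icc 0 T) t)
    (lz : ∀ t ∈ Icc 0 T,
      HasDerivWithinAt (fun t => lift2 (z t)) (lift2 (dt T 1 z t)) (Icc 0 T) t)
    (lz1 : ∀ t ∈ Icc 0 T,
      HasDerivWithinAt (fun t => lift2 (dt T 1 z t)) (lift2 (z2 t)) (Icc 0 T) t)
    (eq1 : ∀ t ∈ Icc 0 T,
      ft ((2 * Complex.I) • z2 t + pm (dt T 1 z t) (φ t) + pm (z t) (dt T 1 φ t))
        =ᵐ[volume] fun ξ => -(lam ξ : ℂ) * ft (dt T 1 z t) ξ)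
    (hb : ∀ t ∈ Icc 0 T, wn (jb (m + 6)) (z t) ≤ C ∧ wn (jb (m + 4)) (dt T 1 z t) ≤ C ∧
      ENNReal.ofReal γ * wn (jb (m + 2)) (z2 t) ≤ C ∧
      ENNReal.ofReal (γ ^ 2) * wn (jb m) (z3 t) ≤ C) :
    ModData m T ε γ M C φ (dt T 1 φ) (dt T 2 φ) z (dt T 1 z) z2 z3 ψ (dt T 1 ψ) (dt T 2 ψ) := by
  have hm := (Nat.cast_nonneg m : (0 : ℝ) ≤ m)
  have hT := hP.hT
  have h0 := hP.zero_mem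
  have cψ : ContDiffOn ℝ (2 : ℕ) ψ (Icc 0 T) := hs.contDiffOn_psi
  have dψ : ∀ t ∈ Icc 0 T, HasDerivWithinAt ψ (dt T 1 ψ t) (Icc 0 T) t := fun t ht =>
    hasDerivWithinAt_dt_zero hT cψ (by norm_num) ht
  have rψ : ∀ t ∈ Icc 0 T, cj (ψ t) = ψ t := fun t ht => cj_eq_self (hs.real_psi t ht)
  have r0 : cj ψ₀ = ψ₀ := by rw [← hs.init_psi]; exact rψ 0 h0
  have hω : (1 / ε ^ 2 : ℝ) ≠ 0 := by positivity
  have r1 : cj ψ₁ = ψ₁ := by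
    have := cj_deriv hT h0 rψ (dψ 0 h0)
    rw [hs.init_dt_psi, map_smul] at this
    exact smul_right_injective _ hω this
  have hz0 : cj (z 0) = (1 / 2 : ℂ) • (ψ₀ + Complex.I • ψ₁) := by
    have hc : conj (1 / 2 : ℂ) = 1 / 2 := by
      rw [map_div₀, map_one, map_ofNat]
    rw [hz.init, cj_smul, map_sub, cj_smul, r0, r1, hc, Complex.conj_I, neg_smul, sub_neg_eq_add]
  refine { toProfileData := hP, hε := hε, hεγ := hεγ, dz1 := dz1, dz2 := dz2, lz := lz, lz1 := lz1,
           eq1 := eq1, bz := fun t ht => (hb t ht).1, bz1 := fun t ht => (hb t ht).2.1,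
           bz2 := fun t ht => (hb t ht).2.2.1, bz3 := fun t ht => (hb t ht).2.2.2,
           dψ := dψ, dψ1 := fun t ht => hasDerivWithinAt_dt hT cψ (by norm_num) ht,
           eqψ := fun t ht => ?_, rφ := fun t ht => cj_eq_self (hs.real_phi t ht), i0 := ?_,
           i1 := ?_ }
  · refine LaplacianEq.fourier ((hs.eq_psi t ht).congr ae_eq_rfl ?_)
    have hw : w1 1 (φ t) < ∞ := w1_one_lt_top hd (wn_jb_lt_top_mono (by linarith)
      ((hP.bφ t ht).trans_lt ENNReal.coe_lt_top))
    filter_upwards [coeFn_lin3 ((ε ^ 2 : ℝ) : ℂ) ((1 / ε ^ 2 : ℝ) : ℂ) 1 (dt T 2 ψ t) (ψ t)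
      (pm (φ t) (ψ t)), coeFn_pm (g := ψ t) hw] with x h1 h2
    rw [one_smul] at h1
    rw [h1, h2]
    push_cast
    ring
  · rw [hz0, hz.init, hs.init_psi]
    module
  · rw [hz0, hz.init, hs.init_dt_psi, real_smul_eq, ← smul_sub]
    rw [show (1 / 2 : ℂ) • (ψ₀ - Complex.I • ψ₁) - (1 / 2 : ℂ) • (ψ₀ + Complex.I • ψ₁)
      = (-Complex.I) • ψ₁ by module, smul_smul]
    congr 1
    linear_combination (((1 / ε ^ 2 : ℝ) : ℂ)) * Complex.I_sq

/-- The initial layer is chosen so that `q` and `∂ₜq` vanish at time `0`: by the Schrödinger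
equation, `∂ₜ|z|² = Im(conj z Δz)`. -/
theorem densData_of_solution (hd : d ≤ 3) (hs : IsSolution T ε γ ψ₀ ψ₁ φ₀ φ₁ ψ φ)
    (hw : IsInitialLayer T γ φ₀ φ₁ (z 0) w)
    (hM : ModData m T ε γ M C φ (dt T 1 φ) (dt T 2 φ) z (dt T 1 z) z2 z3 ψ (dt T 1 ψ) (dt T 2 ψ))
    (hψ : ∀ t ∈ Icc 0 T, w1 1 (ψ t) < ∞) :
    DensData m T ε γ M C φ (dt T 1 φ) (dt T 2 φ) z (dt T 1 z) z2 z3 ψ (dt T 1 ψ) (dt T 2 ψ)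
      w (dt T 1 w) (dt T 2 w) := by
  have hT := hM.hT
  have h0 := hM.toProfileData.zero_mem
  have cw : ContDiffOn ℝ (2 : ℕ) w (Icc 0 T) := hw.contDiffOn
  have wz := hM.w1_z hd h0
  have wz1 := hM.w1_z1 hd h0
  refine { toModData := hM, dw := fun t ht => hasDerivWithinAt_dt_zero hT cw (by norm_num) ht,
           dw1 := fun t ht => hasDerivWithinAt_dt hT cw (by norm_num) ht,
           eqφ := fun t ht => ?_, eqw := fun t ht => ?_, iw := ?_, iw1 := ?_ }
  · refine LaplacianEq.fourier ((hs.eq_phi t ht).congr ?_ ?_)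
    · filter_upwards [Lp.coeFn_add (φ t) (pm (ψ t) (ψ t)), coeFn_pm (g := ψ t) (hψ t ht)]
        with x h1 h2
      rw [h1, Pi.add_apply, h2, pow_two]
    · filter_upwards [Lp.coeFn_smul (γ ^ 2 : ℂ) (dt T 2 φ t)] with x h1
      rw [h1, Pi.smul_apply, smul_eq_mul]
  · refine LaplacianEq.fourier ((hw.eq t ht).congr ae_eq_rfl ?_)
    filter_upwards [Lp.coeFn_smul (γ ^ 2 : ℂ) (dt T 2 w t)] with x h1
    rw [h1, Pi.smul_apply, smul_eq_mul]
  · have hl := coeFn_lin2 1 2 (φ 0) (pm (z 0) (cj (z 0)))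
    rw [one_smul] at hl
    refine Lp.ext ?_
    filter_upwards [hl, coeFn_pm (g := cj (z 0)) wz, coeFn_cj (z 0), hw.init] with x h1 h2 h3 h4
    rw [h1, h2, h3, h4, hs.init_phi, Complex.mul_conj, Complex.normSq_eq_norm_sq, one_mul]
  · obtain ⟨g, hg, hgw⟩ := hw.init_dt
    have hge : g = (2 * Complex.I) • dt T 1 z 0 + pm (φ 0) (z 0) := by
      refine ft_injective (Lp.ext ?_)
      exact hg.fourier.trans (hM.eq 0 h0).symm
    have hl := coeFn_lin3 1 2 2 (dt T 1 φ 0) (pm (dt T 1 z 0) (cj (z 0)))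
      (pm (z 0) (cj (dt T 1 z 0)))
    rw [one_smul, add_assoc, ← smul_add] at hl
    have hl2 := coeFn_lin2 (2 * Complex.I) 1 (dt T 1 z 0) (pm (φ 0) (z 0))
    rw [one_smul, ← hge] at hl2
    have hφ1 : dt T 1 φ 0 =ᵐ[volume] fun x => (1 / γ : ℂ) * φ₁ x := by
      rw [hs.init_dt_phi, real_smul_eq]
      filter_upwards [Lp.coeFn_smul ((1 / γ : ℝ) : ℂ) φ₁] with x h1
      rw [h1, Pi.smul_apply, smul_eq_mul]
      push_cast
      rfl
    refine Lp.ext ?_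
    filter_upwards [hl, hl2, hφ1, hgw, hs.real_phi 0 h0, coeFn_pm (g := cj (z 0)) wz1,
      coeFn_pm (g := cj (dt T 1 z 0)) wz, coeFn_cj (z 0), coeFn_cj (dt T 1 z 0),
      coeFn_pm (g := z 0) (hM.w1_φ hd h0)] with x k1 k2 k3 k4 k5 k6 k7 k8 k9 k10
    rw [k1, k3, k4, k6, k7, k8, k9, k2, k10, one_mul, one_mul, add_assoc]
    congr 1
    generalize z 0 x = Z at *
    generalize dt T 1 z 0 x = Z1 at *
    generalize φ 0 x = F at *
    apply Complex.ext
    · simp [k5]; ring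
    · simp [k5]; ring

end Solution

end KGZ

theorem proposition2p1 (d m : ℕ) (hd : 1 ≤ d) (hd3 : d ≤ 3) (hm : (d : ℝ) / 2 < m)
    (T : ℝ) (hT : 0 < T) (M : ℝ≥0) :
    ∃ C : ℝ≥0, ∀ ε γ : ℝ, 0 < ε → ε < γ → γ ≤ 1 →
      ∀ (ψ₀ ψ₁ φ₀ φ₁ : KGZ.L2 d) (ψ φ z w : ℝ → KGZ.L2 d),
        KGZ.IsSolution T ε γ ψ₀ ψ₁ φ₀ φ₁ ψ φ →
        KGZ.assumedNorm m T γ ψ₀ ψ₁ φ ≤ M →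
        KGZ.IsProfile T ψ₀ ψ₁ φ z →
        KGZ.IsInitialLayer T γ φ₀ φ₁ (z 0) w →
          -- the estimates of the profile
          ContDiffOn ℝ 3 z (Icc 0 T) ∧
          (∀ t ∈ Icc (0 : ℝ) T,
            KGZ.hNorm (m + 6) (z t) + KGZ.hNorm (m + 4) (KGZ.dt T 1 z t)
              + ENNReal.ofReal γ * KGZ.hNorm (m + 2) (KGZ.dt T 2 z t)
              + ENNReal.ofReal (γ ^ 2) * KGZ.hNorm m (KGZ.dt T 3 z t) ≤ C) ∧
          -- the estimates of the two remainders
          ∃ r q : ℝ → KGZ.L2 d,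
            KGZ.IsModulatedExpansion T ε ψ z r ∧ KGZ.IsDensityExpansion T φ z w q ∧
            DifferentiableOn ℝ r (Icc 0 T) ∧ DifferentiableOn ℝ q (Icc 0 T) ∧
            KGZ.supNorm T m r ≤ C * ENNReal.ofReal (ε ^ 2) ∧
            KGZ.supNorm T m (KGZ.dt T 1 r) ≤ C ∧
            KGZ.supNorm T (m - 1) q ≤ C * ENNReal.ofReal γ ∧
            KGZ.supNorm T (m - 2) (KGZ.dt T 1 q) ≤ C := by
  have hd1 : (1 : ℝ) ≤ d := by exact_mod_cast hd
  have hm1 : 1 ≤ m := Nat.one_le_iff_ne_zero.2 fun h0 => by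
    rw [h0, Nat.cast_zero] at hm
    linarith
  have hK : KGZ.embC d m ≤ (KGZ.embC d m).toNNReal :=
    (ENNReal.coe_toNNReal (KGZ.embC_lt_top (by linarith)).ne).ge
  obtain ⟨C, hC⟩ := KGZ.profile_bounds d m hd3 hm1 T M
  set R : ℝ≥0 := KGZ.rE d m T M C + 2 * C with hR
  set E : ℝ := KGZ.wE T (KGZ.qA d m (KGZ.embC d m).toNNReal R C) with hE
  have hE0 : 0 ≤ E := KGZ.wE_nonneg _ _
  refine ⟨4 * C + R + E.toNNReal + (2 * Real.pi * E).toNNReal, ?_⟩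
  intro ε γ hε hεγ hγ1 ψ₀ ψ₁ φ₀ φ₁ ψ φ z w hs hA hz hw
  have hP := KGZ.profileData_of_solution hd3 hT (hε.trans hεγ) hγ1 hs hA hz
  obtain ⟨z2, z3, dz1, dz2, cz3, lz, lz1, eq1, hb⟩ := hC γ _ _ _ _ _ hP
  have hM := KGZ.modData_of_solution hd3 hε hεγ hs hz hP dz1 dz2 lz lz1 eq1 hb
  set ω : ℝ := 1 / ε ^ 2 with hω
  have hr := fun t (ht : t ∈ Icc 0 T) => hM.wn_rem_le hd3 hω ht
  set r := KGZ.modRem ψ (KGZ.car ω z) with hrd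
  have hψr : ∀ t, ψ t = (KGZ.car ω z t + KGZ.cj (KGZ.car ω z t)) + r t := fun t => by
    rw [hrd, KGZ.modRem]; abel
  have hψ : ∀ t ∈ Icc 0 T, KGZ.w1 1 (ψ t) < ∞ := by
    intro t ht
    have wc : KGZ.w1 1 (KGZ.car ω z t) < ∞ := KGZ.w1_smul_lt_top _ (hM.w1_z hd3 ht)
    rw [hψr t]
    exact KGZ.w1_add_lt_top (KGZ.w1_add_lt_top wc (by rwa [KGZ.w1_one_cj]))
      ((KGZ.w1_one_le_embC m _).trans_lt (ENNReal.mul_lt_top (hK.trans_lt ENNReal.coe_lt_top)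
        ((hr t ht).1.trans_lt (ENNReal.mul_lt_top ENNReal.ofReal_lt_top ENNReal.coe_lt_top))))
  have hD := KGZ.densData_of_solution hd3 hs hw hM hψ
  obtain ⟨dq, hq⟩ := hD.wn_q_le hd hd3 hm1 hK hω fun t ht => (hr t ht).1
  have dr : ∀ t ∈ Icc 0 T, HasDerivWithinAt r
      (KGZ.modRem (KGZ.dt T 1 ψ) (KGZ.car1 ω z (KGZ.dt T 1 z)) t) (Icc 0 T) t := fun t ht =>
    KGZ.hasDerivWithinAt_modRem (hM.dψ t ht) (KGZ.hasDerivWithinAt_car ω (hM.dz t ht))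
  have e2 : ∀ t ∈ Icc 0 T, KGZ.dt T 2 z t = z2 t := fun t ht =>
    KGZ.dt_succ_eq hT (fun t _ => rfl) ht (dz1 t ht)
  have e3 : ∀ t ∈ Icc 0 T, KGZ.dt T 3 z t = z3 t := fun t ht =>
    KGZ.dt_succ_eq hT e2 ht (dz2 t ht)
  have c1 : (C : ℝ≥0∞) + C + C + C
      ≤ ((4 * C + R + E.toNNReal + (2 * Real.pi * E).toNNReal : ℝ≥0) : ℝ≥0∞) := by
    rw [← ENNReal.coe_add, ← ENNReal.coe_add, ← ENNReal.coe_add]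
    refine ENNReal.coe_le_coe.2 ?_
    rw [add_assoc (4 * C), add_assoc (4 * C)]
    exact le_trans (le_of_eq (by ring)) le_self_add
  have c2 : R ≤ 4 * C + R + E.toNNReal + (2 * Real.pi * E).toNNReal := by
    rw [add_assoc (4 * C + R), add_comm (4 * C), add_assoc]; exact le_self_add
  have c3 : E.toNNReal ≤ 4 * C + R + E.toNNReal + (2 * Real.pi * E).toNNReal := by
    rw [add_right_comm]; exact le_add_self
  have c4 : (2 * Real.pi * E).toNNReal ≤ 4 * C + R + E.toNNReal + (2 * Real.pi * E).toNNReal :=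
    le_add_self
  refine ⟨?_, fun t ht => ?_, r, fun t => φ t + (2 : ℂ) • KGZ.pm (z t) (KGZ.cj (z t)) - w t,
    fun t ht => ?_, fun t ht => ?_, fun t ht => (dr t ht).differentiableWithinAt,
    fun t ht => (dq t ht).differentiableWithinAt, iSup₂_le fun t ht => ?_,
    iSup₂_le fun t ht => ?_, iSup₂_le fun t ht => ?_, iSup₂_le fun t ht => ?_⟩
  · have k0 : ContDiffOn ℝ (0 : ℕ) z3 (Icc 0 T) := by
      rw [Nat.cast_zero]; exact contDiffOn_zero.2 cz3
    have k3 := KGZ.contDiffOn_succ_of_hasDeriv hT hM.dz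
      (KGZ.contDiffOn_succ_of_hasDeriv hT dz1 (KGZ.contDiffOn_succ_of_hasDeriv hT dz2 k0))
    exact k3
  · rw [e2 t ht, e3 t ht]
    simp only [KGZ.hNorm_eq_wn]
    obtain ⟨b0, b1, b2, b3⟩ := hb t ht
    exact (add_le_add (add_le_add (add_le_add b0 b1) b2) b3).trans c1
  · have ho : Complex.exp (Complex.I * (t / ε ^ 2)) = KGZ.osc ω t := by
      rw [KGZ.osc, hω]; congr 1; push_cast; ring
    have ho' : Complex.exp (-(Complex.I * (t / ε ^ 2))) = conj (KGZ.osc ω t) := by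
      rw [KGZ.conj_osc, KGZ.osc, hω]; congr 1; push_cast; ring
    rw [ho, ho', hψr t]
    filter_upwards [Lp.coeFn_add (KGZ.car ω z t + KGZ.cj (KGZ.car ω z t)) (r t),
      Lp.coeFn_add (KGZ.car ω z t) (KGZ.cj (KGZ.car ω z t)), KGZ.coeFn_cj (KGZ.car ω z t),
      Lp.coeFn_smul (KGZ.osc ω t) (z t)] with x h1 h2 h3 h4
    rw [h1, Pi.add_apply, h2, Pi.add_apply, h3, KGZ.car, h4, Pi.smul_apply, smul_eq_mul, map_mul]
  · have hl := KGZ.coeFn_lin3 1 2 (-1) (φ t) (KGZ.pm (z t) (KGZ.cj (z t))) (w t)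
    rw [one_smul, neg_one_smul, ← sub_eq_add_neg] at hl
    filter_upwards [hl, KGZ.coeFn_pm (g := KGZ.cj (z t)) (hM.w1_z hd3 ht), KGZ.coeFn_cj (z t)]
      with x h1 h2 h3
    rw [h1, h2, h3, Complex.mul_conj, Complex.normSq_eq_norm_sq]
    ring
  · rw [KGZ.hNorm_eq_wn, mul_comm]
    refine (hr t ht).1.trans ?_
    gcongr
  · rw [KGZ.hNorm_eq_wn, KGZ.dt_succ_eq hT (fun t _ => by rw [KGZ.dt_zero]) ht (dr t ht)]
    exact (hr t ht).2.trans (ENNReal.coe_le_coe.2 c2)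
  · rw [KGZ.hNorm_eq_wn]
    refine (hq t ht).1.trans ?_
    rw [ENNReal.ofReal_mul hE0]
    gcongr
    exact ENNReal.coe_le_coe.2 c3
  · rw [KGZ.hNorm_eq_wn, KGZ.dt_succ_eq hT (fun t _ => by rw [KGZ.dt_zero]) ht (dq t ht)]
    have h2 : (m : ℝ) - 2 = m - 1 - 1 := by ring
    rw [h2]
    exact (hq t ht).2.trans (ENNReal.coe_le_coe.2 c4)
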